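/- Let $K$ be an algebraically closed field that is complete with respect to a non-trivial non-archimedean absolute value, let $\mathsf{P}^1$ be the Berkovich projective line over $K$, with Gauss point $\mathcal{S}_G$, and let $f\in K(z)$ be a rational function of degree $d>1$. *Notation.* Let $h\in K(z)$ have degree $>0$; it acts on $\mathsf{P}^1$, with local degrees $\deg_{\mathcal S}h$. The pullback of a Radon measure $\nu$ on $\mathsf{P}^1$ is $h^*\nu=\int\bigl(\sum_{\mathcal{S}'\in h^{-1}(\mathcal{S})}(\deg_{\mathcal{S}'}h)\,\delta_{\mathcal{S}'}\bigr)\,d\nu(\mathcal{S})$. Put $\Gamma_G=\{\mathcal{S}_G\}$ and $\Gamma_h=\{\mathcal{S}_G,h(\mathcal{S}_G)\}$. For a finite set $\Gamma$ of type II points, $S(\Gamma)$ is the partition of $\mathsf{P}^1$ into the components of $\mathsf{P}^1\setminus\Gamma$ and the singletons $\{\mathcal{S}\}$, $\mathcal{S}\in\Gamma$. The quantization $(\pi_{\mathsf{P}^1,\Gamma})_*\nu$ of $\nu$ is the measure on the discrete measurable space $S(\Gamma)$ giving mass $\nu(U)$ to each $U\in S(\Gamma)$, i.e. the pushforward of $\nu$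 under the factor map $\mathsf{P}^1\to S(\Gamma)$. For $\Gamma\subset\Gamma'$, $(\pi_{\Gamma',\Gamma})_*$ is the pushforward of measures under the projection $S(\Gamma')\to S(\Gamma)$ sending each cell $V$ to the cell $U\supset V$. For a direction $\vec v$ at $\mathcal{S}_G$, let $U_{\vec v}$ be the corresponding component of $\mathsf{P}^1\setminus\{\mathcal{S}_G\}$, and let $U_{h_*\vec v}$ be the component of $\mathsf{P}^1\setminus\{h(\mathcal{S}_G)\}$ into which $h$ maps the points of $U_{\vec v}$ close to $\mathcal{S}_G$. The directional local degree $m_{\vec v}(h)$ is the local degree of the reduction of $A\circ h\circ B$ at $\tilde a$, where $A,B\in\mathrm{PGL}(2,K)$ satisfy $B(\mathcal{S}_G)=\mathcal{S}_G$ and $A(h(\mathcal{S}_G))=\mathcal{S}_G$, and $\tilde a$ is the reduction of a point $a\in\mathbb{P}^1(K)$ with $B(a)\in U_{\vec v}$. The surplus local degree $s_{\vec v}(h)\in\mathbb{Z}_{\ge0}$ is the number such that for every $\mathcal{S}'\ne h(\mathcal{S}_G)$, $(h^*\delta_{\mathcal{S}'})(U_{\vec v})$ equals $m_{\vec v}(h)+s_{\vec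 v}(h)$ if $\mathcal{S}'\in U_{h_*\vec v}$, and $s_{\vec v}(h)$ otherwise. For $V\in S(\Gamma_h)$ and $U\in S(\Gamma_G)$ the quantized local degree is $$m_{V,U_{\vec v}}(h)=\begin{cases}m_{\vec v}(h)+s_{\vec v}(h)&\text{if }V\subset U_{h_*\vec v},\\ s_{\vec v}(h)&\text{if }V\cap U_{h_*\vec v}=\emptyset,\end{cases}\qquad m_{V,\{\mathcal{S}_G\}}(h)=\begin{cases}\deg_{\mathcal{S}_G}h&\text{if }V=\{h(\mathcal{S}_G)\},\\0&\text{otherwise.}\end{cases}$$ The quantized pullback of a measure $\omega$ on $S(\Gamma_h)$ is the measure $(h_{\Gamma_G,\Gamma_h})^*\omega$ on $S(\Gamma_G)$ with $\bigl((h_{\Gamma_G,\Gamma_h})^*\omega\bigr)(\{U\})=\sum_{V\in S(\Gamma_h)}m_{V,U}(h)\,\omega(\{V\})$ for $U\in S(\Gamma_G)$, extended to arbitrary subsets of $S(\Gamma_G)$ by summation over their elements. A probability measure $\omega$ on $S(\Gamma_h)$ satisfies the *quantized $h$-balanced property* if $(\deg h)^{-1}(h_{\Gamma_G,\Gamma_h})^*\omega=(\pi_{\Gamma_h,\Gamma_G})_*\omega$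 as measures on $S(\Gamma_G)$. **Lemma.** Let $\nu$ be a Radon probability measure on $\mathsf{P}^1$ such that $f^*\nu=d\cdot\nu$ and $\nu(\{f(\mathcal{S}_G)\})=0$. Then for every integer $n\ge1$, $(\pi_{\mathsf{P}^1,\Gamma_{f^n}})_*\nu$ is a probability measure on $S(\Gamma_{f^n})$ and satisfies the quantized $f^n$-balanced property, where $f^n$ denotes the $n$-th iterate of $f$. -/

import Mathlib

open MeasureTheory Set Filter Topology
open scoped ENNReal NNReal OnePoint Polynomial

noncomputable section

/-! ### Rational functions over a field, acting on `ℙ¹(F) = F ∪ {∞}` -/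

namespace RatMap

variable {F : Type*} [Field F]

/-- The degree of the rational function `h = P / Q` in lowest terms: `max (deg P) (deg Q)`. -/
def degree (h : RatFunc F) : ℕ := max h.num.natDegree h.denom.natDegree

/-- The composition `g ∘ h`, i.e. substitution of `h` for the variable in `g`. -/
def comp (g h : RatFunc F) : RatFunc F := RatFunc.eval RatFunc.C h g

/-- The `n`-th iterate `f ∘ ⋯ ∘ f` as a rational function. -/
def iter (f : RatFunc F) (n : ℕ) : RatFunc F := (fun g => comp f g)^[n] RatFunc.X

/-- The value in `ℙ¹(F)` of `h` at a finite point. -/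
def evalFin (h : RatFunc F) (a : F) : OnePoint F :=
  open Classical in
  if h.denom.eval a = 0 then ∞ else ((h.num.eval a / h.denom.eval a : F) : OnePoint F)

/-- The action of `h` on `ℙ¹(F)`; near `∞` one uses the coordinate `1 / z`. -/
def eval (h : RatFunc F) : OnePoint F → OnePoint F
  | ∞ => evalFin (comp h RatFunc.X⁻¹) 0
  | OnePoint.some a => evalFin h a

/-- The polynomial whose finite zeros are the solutions of `h = b`, with multiplicity. -/
def fiberPoly (h : RatFunc F) : OnePoint F → F[X]
  | ∞ => h.denom
  | OnePoint.some b => h.num - Polynomial.C b * h.denom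

/-- The local degree of `h` at a finite point `a`: the order of vanishing at `a` of `h - h(a)`
(of `1 / h` if `h(a) = ∞`). -/
def degAtFin (h : RatFunc F) (a : F) : ℕ := (fiberPoly h (evalFin h a)).rootMultiplicity a

/-- The local degree `deg_a h` at a point `a` of `ℙ¹(F)`. -/
def degAt (h : RatFunc F) : OnePoint F → ℕ
  | ∞ => degAtFin (comp h RatFunc.X⁻¹) 0
  | OnePoint.some a => degAtFin h a

theorem ne_C_of_degree_pos {h : RatFunc F} (hd : 0 < degree h) : ¬ ∃ c, h = RatFunc.C c := by
  rintro ⟨c, rfl⟩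
  simp [degree] at hd

theorem eval₂_ne_zero {h : RatFunc F} (hd : 0 < degree h) {q : F[X]} (hq : q ≠ 0) :
    q.eval₂ RatFunc.C h ≠ 0 := by
  intro h0
  have ht := RatFunc.transcendental_of_ne_C h (ne_C_of_degree_pos hd)
  exact hq ((transcendental_iff.mp ht) q (by
    rw [Polynomial.aeval_def]; exact h0))

theorem comp_C (c : F) (h : RatFunc F) : comp (RatFunc.C c) h = RatFunc.C c := by
  simp [comp]

theorem comp_add {h : RatFunc F} (hd : 0 < degree h) (φ ψ : RatFunc F) :
    comp (φ + ψ) h = comp φ h + comp ψ h :=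
  RatFunc.eval_add RatFunc.C h (eval₂_ne_zero hd φ.denom_ne_zero)
    (eval₂_ne_zero hd ψ.denom_ne_zero)

theorem comp_mul {h : RatFunc F} (hd : 0 < degree h) (φ ψ : RatFunc F) :
    comp (φ * ψ) h = comp φ h * comp ψ h :=
  RatFunc.eval_mul RatFunc.C h (eval₂_ne_zero hd φ.denom_ne_zero)
    (eval₂_ne_zero hd ψ.denom_ne_zero)

end RatMap

/-! ### The Berkovich projective line -/

namespace Berk

open RatMap

/-- The Berkovich affine line over `K`: multiplicative (non-archimedean) seminorms on the
polynomial ring `K[X]` that extend the absolute value of `K`. -/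
structure A1 (K : Type*) [NontriviallyNormedField K] where
  /-- The seminorm. -/
  val : K[X] → ℝ≥0
  val_C : ∀ c : K, val (Polynomial.C c) = ‖c‖₊
  val_add_le : ∀ p q : K[X], val (p + q) ≤ max (val p) (val q)
  val_mul : ∀ p q : K[X], val (p * q) = val p * val q

/-- The Berkovich projective line over `K`. A point `x` is given by the values
`val φ = |φ(x)| ∈ [0, ∞]` at `x` of all rational functions `φ ∈ K(z)` (`∞` at poles), that is, by a
`[0, ∞]`-valued multiplicative seminorm on the function field `K(z)` that extends the absolute
value of `K`; multiplicativity is required wherever the product is not of the form `0 · ∞`.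

The points at which `z` takes a finite value are exactly those of the Berkovich affine line: such
a point is determined by its restriction to `K[z]`, a multiplicative seminorm, through
`|P / Q| = |P| / |Q|` in lowest terms, and conversely see `P1.ofA1`. The one remaining point is
`∞`. The symmetric description has the advantage of not singling out a coordinate. -/
structure P1 (K : Type*) [NontriviallyNormedField K] where
  /-- The value `|φ(x)| ∈ [0, ∞]` of a rational function at the point. -/
  val : RatFunc K → ℝ≥0∞
  val_C : ∀ c : K, val (RatFunc.C c) = ‖c‖ₑ
  val_add_le : ∀ φ ψ : RatFunc K, val (φ + ψ) ≤ max (val φ) (val ψ)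
  val_mul : ∀ φ ψ : RatFunc K, ¬ (val φ = 0 ∧ val ψ = ⊤) → ¬ (val φ = ⊤ ∧ val ψ = 0) →
    val (φ * ψ) = val φ * val ψ

variable {K : Type*} [NontriviallyNormedField K]

/-- The (Gel'fand, weak) topology: the coarsest one making all `x ↦ |φ(x)| ∈ [0, ∞]` continuous. -/
instance : TopologicalSpace (P1 K) := TopologicalSpace.induced P1.val inferInstance

instance : MeasurableSpace (P1 K) := borel (P1 K)

instance : BorelSpace (P1 K) := ⟨rfl⟩

namespace A1

theorem val_one (p : A1 K) : p.val 1 = 1 := by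
  simpa using p.val_C 1

theorem val_zero (p : A1 K) : p.val 0 = 0 := by
  simpa using p.val_C 0

theorem not_both_zero (p : A1 K) {a b : K[X]} (h : IsCoprime a b) :
    ¬ (p.val a = 0 ∧ p.val b = 0) := by
  rintro ⟨ha, hb⟩
  obtain ⟨u, v, huv⟩ := h
  have := p.val_add_le (u * a) (v * b)
  rw [huv, p.val_one, p.val_mul, p.val_mul, ha, hb] at this
  simp at this

/-- The value in `[0, ∞]` of a rational function at a point of the Berkovich affine line. -/
def ratVal (p : A1 K) (φ : RatFunc K) : ℝ≥0∞ := (p.val φ.num : ℝ≥0∞) / (p.val φ.denom : ℝ≥0∞)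

theorem ratVal_div (p : A1 K) (a b : K[X]) (hb : b ≠ 0)
    (hab : ¬ (p.val a = 0 ∧ p.val b = 0)) :
    p.ratVal (algebraMap K[X] (RatFunc K) a / algebraMap K[X] (RatFunc K) b)
      = (p.val a : ℝ≥0∞) / (p.val b : ℝ≥0∞) := by
  set φ := algebraMap K[X] (RatFunc K) a / algebraMap K[X] (RatFunc K) b with hφ
  have key : φ.num * b = a * φ.denom := by
    have := RatFunc.num_div_denom φ
    have hd := RatFunc.algebraMap_ne_zero φ.denom_ne_zero
    have hb' := RatFunc.algebraMap_ne_zero hb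
    apply RatFunc.algebraMap_injective K
    rw [map_mul, map_mul]
    rw [hφ, div_eq_div_iff hd hb'] at this
    exact this
  obtain ⟨c, hc⟩ : φ.denom ∣ b :=
    (RatFunc.isCoprime_num_denom φ).symm.dvd_of_dvd_mul_left ⟨a, by rw [key, mul_comm]⟩
  have ha : a = φ.num * c := by
    apply mul_right_cancel₀ φ.denom_ne_zero
    rw [← key]; nth_rewrite 1 [hc]; ring
  have hc0 : p.val c ≠ 0 := by
    intro h0
    apply hab
    rw [ha, hc, p.val_mul, p.val_mul, h0]; simp
  unfold ratVal
  have ea : p.val a = p.val (φ.num * c) := by rw [← ha]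
  have eb : p.val b = p.val (φ.denom * c) := by rw [← hc]
  rw [ea, eb, p.val_mul, p.val_mul, ENNReal.coe_mul, ENNReal.coe_mul,
    ENNReal.mul_div_mul_right _ _ (by exact_mod_cast hc0) ENNReal.coe_ne_top]

end A1

namespace P1

/-- The inclusion of the Berkovich affine line into the Berkovich projective line. -/
def ofA1 (p : A1 K) : P1 K where
  val := p.ratVal
  val_C c := by
    simp [A1.ratVal, p.val_C, p.val_one, enorm_eq_nnnorm]
  val_add_le φ ψ := by
    by_cases hφ : p.val φ.denom = 0
    · have : p.val φ.num ≠ 0 := fun h =>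
        p.not_both_zero (RatFunc.isCoprime_num_denom φ) ⟨h, hφ⟩
      have : p.ratVal φ = ⊤ := by simp [A1.ratVal, hφ, ENNReal.div_zero, this]
      simp [this]
    by_cases hψ : p.val ψ.denom = 0
    · have : p.val ψ.num ≠ 0 := fun h =>
        p.not_both_zero (RatFunc.isCoprime_num_denom ψ) ⟨h, hψ⟩
      have : p.ratVal ψ = ⊤ := by simp [A1.ratVal, hψ, ENNReal.div_zero, this]
      simp [this]
    have hd1 := RatFunc.algebraMap_ne_zero φ.denom_ne_zero
    have hd2 := RatFunc.algebraMap_ne_zero ψ.denom_ne_zero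
    have e : φ + ψ = algebraMap K[X] (RatFunc K) (φ.num * ψ.denom + φ.denom * ψ.num) /
        algebraMap K[X] (RatFunc K) (φ.denom * ψ.denom) := by
      conv_lhs => rw [← RatFunc.num_div_denom φ, ← RatFunc.num_div_denom ψ]
      rw [div_add_div _ _ hd1 hd2]; simp
    have e1 : p.ratVal φ =
        (p.val (φ.num * ψ.denom) : ℝ≥0∞) / (p.val (φ.denom * ψ.denom) : ℝ≥0∞) := by
      rw [p.val_mul, p.val_mul, ENNReal.coe_mul, ENNReal.coe_mul,
        ENNReal.mul_div_mul_right _ _ (by exact_mod_cast hψ) ENNReal.coe_ne_top, A1.ratVal]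
    have e2 : p.ratVal ψ =
        (p.val (φ.denom * ψ.num) : ℝ≥0∞) / (p.val (φ.denom * ψ.denom) : ℝ≥0∞) := by
      rw [p.val_mul, p.val_mul, ENNReal.coe_mul, ENNReal.coe_mul,
        ENNReal.mul_div_mul_left _ _ (by exact_mod_cast hφ) ENNReal.coe_ne_top, A1.ratVal]
    rw [e1, e2, e, p.ratVal_div _ _ (mul_ne_zero φ.denom_ne_zero ψ.denom_ne_zero)
      (by rw [p.val_mul φ.denom]; simp [hφ, hψ])]
    rcases le_max_iff.mp (p.val_add_le (φ.num * ψ.denom) (φ.denom * ψ.num)) with h | h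
    · exact le_max_of_le_left (ENNReal.div_le_div_right (by exact_mod_cast h) _)
    · exact le_max_of_le_right (ENNReal.div_le_div_right (by exact_mod_cast h) _)
  val_mul φ ψ h1 h2 := by
    have cφ := p.not_both_zero (RatFunc.isCoprime_num_denom φ)
    have cψ := p.not_both_zero (RatFunc.isCoprime_num_denom ψ)
    have e : φ * ψ = algebraMap K[X] (RatFunc K) (φ.num * ψ.num) /
        algebraMap K[X] (RatFunc K) (φ.denom * ψ.denom) := by
      conv_lhs => rw [← RatFunc.num_div_denom φ, ← RatFunc.num_div_denom ψ]
      rw [div_mul_div_comm]; simp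
    have hne : ¬ (p.val (φ.num * ψ.num) = 0 ∧ p.val (φ.denom * ψ.denom) = 0) := by
      rw [p.val_mul, p.val_mul, mul_eq_zero, mul_eq_zero]
      rintro ⟨hn | hn, hd | hd⟩
      · exact cφ ⟨hn, hd⟩
      · refine h1 ⟨by simp [A1.ratVal, hn], ?_⟩
        have : p.val ψ.num ≠ 0 := fun h => cψ ⟨h, hd⟩
        simp [A1.ratVal, hd, ENNReal.div_zero, this]
      · refine h2 ⟨?_, by simp [A1.ratVal, hn]⟩
        have : p.val φ.num ≠ 0 := fun h => cφ ⟨h, hd⟩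
        simp [A1.ratVal, hd, ENNReal.div_zero, this]
      · exact cψ ⟨hn, hd⟩
    have hinv : ((p.val φ.denom : ℝ≥0∞) * (p.val ψ.denom : ℝ≥0∞))⁻¹
        = (p.val φ.denom : ℝ≥0∞)⁻¹ * (p.val ψ.denom : ℝ≥0∞)⁻¹ :=
      ENNReal.mul_inv (Or.inr ENNReal.coe_ne_top) (Or.inl ENNReal.coe_ne_top)
    rw [e, p.ratVal_div _ _ (mul_ne_zero φ.denom_ne_zero ψ.denom_ne_zero) hne,
      p.val_mul, p.val_mul, ENNReal.coe_mul, ENNReal.coe_mul]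
    simp only [A1.ratVal, div_eq_mul_inv]
    rw [hinv]
    ring

/-- The action on the Berkovich projective line of a non-constant rational function `h`:
`|φ(h(x))| = |(φ ∘ h)(x)|` for all `φ ∈ K(z)`. (Constant `h` do not occur; they get the identity as
a default value.) -/
def map (h : RatFunc K) (x : P1 K) : P1 K :=
  if hd : 0 < degree h then
    { val := fun φ => x.val (comp φ h)
      val_C := fun c => by rw [comp_C]; exact x.val_C c
      val_add_le := fun φ ψ => by rw [comp_add hd]; exact x.val_add_le _ _
      val_mul := fun φ ψ h1 h2 => by rw [comp_mul hd]; exact x.val_mul _ _ h1 h2 }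
  else x

/-- The point of the Berkovich affine line given by `a ∈ K`: the seminorm `p ↦ |p(a)|`. -/
def affPoint [IsUltrametricDist K] (a : K) : A1 K where
  val p := ‖p.eval a‖₊
  val_C c := by simp
  val_add_le p q := by
    rw [Polynomial.eval_add]; exact IsUltrametricDist.nnnorm_add_le_max _ _
  val_mul p q := by simp

/-- The inclusion of the classical projective line `ℙ¹(K)` into the Berkovich projective line;
`∞` is the image of `0` under `z ↦ 1 / z`. -/
def classical [IsUltrametricDist K] : OnePoint K → P1 K
  | ∞ => map RatFunc.X⁻¹ (ofA1 (affPoint 0))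
  | OnePoint.some a => ofA1 (affPoint a)

/-- The Gauss norm on `K[X]`: the maximum of the absolute values of the coefficients. -/
def gaussA1 [IsUltrametricDist K] : A1 K where
  val p := ⟨p.gaussNorm (NormedField.toAbsoluteValue K) 1,
    Polynomial.gaussNorm_nonneg _ _ zero_le_one⟩
  val_C c := by
    apply NNReal.eq
    exact Polynomial.gaussNorm_C (NormedField.toAbsoluteValue K) 1 c
  val_add_le p q := by
    have := Polynomial.isNonarchimedean_gaussNorm (NormedField.toAbsoluteValue K)
      (IsUltrametricDist.isNonarchimedean_norm) zero_le_one p q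
    exact this
  val_mul p q := by
    apply NNReal.eq
    exact Polynomial.gaussNorm_mul (v := NormedField.toAbsoluteValue K)
      (IsUltrametricDist.isNonarchimedean_norm) one_pos p q

/-- The Gauss (canonical) point `S_G` of the Berkovich projective line. -/
def gauss [IsUltrametricDist K] : P1 K := ofA1 gaussA1

end P1

/-! ### Factor spaces and quantization -/

/-- The partition `S(Γ)` of the Berkovich projective line into the components of the complement
of `Γ` and the singletons of `Γ`. -/
def cells (Γ : Set (P1 K)) : Set (Set (P1 K)) :=
  {U | (∃ y, y ∉ Γ ∧ U = connectedComponentIn Γᶜ y) ∨ ∃ x ∈ Γ, U = {x}}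

/-- The factor space of the Berkovich projective line by the partition `S(Γ)`. -/
def Factor (Γ : Set (P1 K)) : Type _ := {U : Set (P1 K) // U ∈ cells Γ}

/-- All subsets of the factor space are measurable. -/
instance (Γ : Set (P1 K)) : MeasurableSpace (Factor Γ) := ⊤

open Classical in
/-- The factor map, sending a point to the cell that contains it. -/
def factorMap (Γ : Set (P1 K)) (x : P1 K) : Factor Γ :=
  if hx : x ∈ Γ then ⟨{x}, Or.inr ⟨x, hx, rfl⟩⟩
  else ⟨connectedComponentIn Γᶜ x, Or.inl ⟨x, hx, rfl⟩⟩

/-- The quantization (pushforward under the factor map) of a measure. -/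
def quantize (Γ : Set (P1 K)) (ν : Measure (P1 K)) : Measure (Factor Γ) :=
  ν.map (factorMap Γ)

theorem Factor.nonempty {Γ : Set (P1 K)} (V : Factor Γ) : V.1.Nonempty := by
  obtain ⟨V, ⟨y, hy, rfl⟩ | ⟨x, _, rfl⟩⟩ := V
  · exact ⟨y, mem_connectedComponentIn hy⟩
  · exact ⟨x, rfl⟩

/-- For `Γ ⊆ Γ'`, the projection of factor spaces, sending a cell for `Γ'` to the cell for `Γ` that
contains it. -/
def factorProj (Γ' Γ : Set (P1 K)) (V : Factor Γ') : Factor Γ := factorMap Γ V.nonempty.some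

variable [IsUltrametricDist K]

/-! ### Local degrees and the pullback of measures -/

/-- The number of solutions in `W ∩ ℙ¹(K)` of `h = b`, counted with multiplicity. -/
def classicalCount (h : RatFunc K) (W : Set (P1 K)) (b : OnePoint K) : ℕ :=
  ∑ᶠ a ∈ {a : OnePoint K | RatMap.eval h a = b ∧ P1.classical a ∈ W}, degAt h a

/-- The local degree `deg_x h` at a point `x` of the Berkovich projective line: the least `m` such
that some open neighbourhood `W` of `x` contains, for every `b ∈ ℙ¹(K)`, at most `m` classical
solutions of `h = b` counted with multiplicity. This is the extension of the classical local
degree for which, for `V` open and `U` a component of `h⁻¹(V)`, the sum of the local degrees over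
the fibre in `U` of a point of `V` is a constant `deg (h : U → V)`: it equals `deg (h : U → V)`
for every sufficiently small such `U ∋ x`. -/
def localDegree (h : RatFunc K) (x : P1 K) : ℕ :=
  sInf {m : ℕ | ∃ W : Set (P1 K), IsOpen W ∧ x ∈ W ∧ ∀ b : OnePoint K, classicalCount h W b ≤ m}

/-- The pullback `h^* δ_y = ∑_{x ∈ h⁻¹(y)} (deg_x h) δ_x` of a Dirac measure. -/
def pullbackDirac (h : RatFunc K) (y : P1 K) : Measure (P1 K) :=
  Measure.sum fun x : (P1.map h ⁻¹' {y} : Set (P1 K)) =>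
    (localDegree h x : ℝ≥0∞) • Measure.dirac (x : P1 K)

/-- The pullback `h^* ν = ∫ (h^* δ_y) dν(y)` of a measure. -/
def pullback (h : RatFunc K) (ν : Measure (P1 K)) : Measure (P1 K) :=
  ν.bind (pullbackDirac h)

/-! ### Directions, directional and surplus local degrees -/

/-- The directions at `x`, each identified with the corresponding component `U_v` of the complement
of `x`. -/
def directions (x : P1 K) : Set (Set (P1 K)) :=
  {v | ∃ y, y ≠ x ∧ v = connectedComponentIn {x}ᶜ y}

/-- The component `U_{h_* v}` of the direction `h_* v` at `h(x)`, for a direction `v` at `x`: the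
component of the complement of `h(x)` into which `h` maps all points of `U_v` close to `x`. -/
def tangentImage (h : RatFunc K) (x : P1 K) (v : Set (P1 K)) : Set (P1 K) :=
  ⋃₀ {w | w ∈ directions (P1.map h x) ∧ ∀ᶠ y in 𝓝[v] x, P1.map h y ∈ w}

variable (K) in
/-- The valuation ring of `K`. -/
abbrev IntRing : ValuationSubring K := (NormedField.valuation (K := K)).valuationSubring

variable (K) in
/-- The residue field of `K`. -/
abbrev ResField : Type _ := IsLocalRing.ResidueField (IntRing K)

/-- `φ` is the reduction of `h`: writing `h = P / Q` with `P, Q` integral, `φ = P~ / Q~`, where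
`Q~ ≠ 0`. (If `h` is written with integral coefficients, not all in the maximal ideal, then
`Q~ = 0` means that the reduction is the constant `∞`, which is not an element of `k(z)`.) -/
def IsReduction (h : RatFunc K) (φ : RatFunc (ResField K)) : Prop :=
  ∃ P Q : (IntRing K)[X], Q.map (IsLocalRing.residue (IntRing K)) ≠ 0 ∧
    h = algebraMap K[X] (RatFunc K) (P.map (IntRing K).subtype) /
      algebraMap K[X] (RatFunc K) (Q.map (IntRing K).subtype) ∧
    φ = algebraMap (ResField K)[X] (RatFunc (ResField K))
          (P.map (IsLocalRing.residue (IntRing K))) /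
        algebraMap (ResField K)[X] (RatFunc (ResField K))
          (Q.map (IsLocalRing.residue (IntRing K)))

/-- The reduction `ℙ¹(K) → ℙ¹(k)` of classical points. -/
def redPt : OnePoint K → OnePoint (ResField K)
  | ∞ => ∞
  | OnePoint.some a =>
    open Classical in
    if ha : a ∈ IntRing K then
      ((IsLocalRing.residue (IntRing K) ⟨a, ha⟩ : ResField K) : OnePoint (ResField K))
    else ∞

/-- The directional local degree `m_v(h)` in the direction `v` at a type II point `x`. Choose
Möbius transformations `A`, `B` with `B(S_G) = x` and `A(h(x)) = S_G`, and `a ∈ ℙ¹(K)` with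
`B(a) ∈ U_v`; then `m_v(h)` is the local degree at the reduction of `a` of the reduction of
`A ∘ h ∘ B`. It does not depend on the choices: the set below is a singleton. -/
def dirDegree (h : RatFunc K) (x : P1 K) (v : Set (P1 K)) : ℕ :=
  sInf {m : ℕ | ∃ A B : RatFunc K, degree A = 1 ∧ degree B = 1 ∧
    P1.map B P1.gauss = x ∧ P1.map A (P1.map h x) = P1.gauss ∧
    ∃ a : OnePoint K, P1.map B (P1.classical a) ∈ v ∧
    ∃ φ : RatFunc (ResField K), IsReduction (comp A (comp h B)) φ ∧ m = degAt φ (redPt a)}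

open Classical in
/-- The surplus local degree `s_v(h)` in the direction `v` at `x`: the natural number `s` such that
for every `y ≠ h(x)`, the mass `(h^* δ_y)(U_v)` is `m_v(h) + s` if `y ∈ U_{h_* v}`, and `s`
otherwise. -/
def surplusDegree (h : RatFunc K) (x : P1 K) (v : Set (P1 K)) : ℕ :=
  sInf {s : ℕ | ∀ y, y ≠ P1.map h x → pullbackDirac h y v =
    if y ∈ tangentImage h x v then ((dirDegree h x v + s : ℕ) : ℝ≥0∞) else (s : ℝ≥0∞)}

/-! ### Quantized local degrees and the quantized balanced property -/

variable (K) in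
/-- `Γ_G = {S_G}`. -/
def gaussSet : Set (P1 K) := {P1.gauss}

/-- `Γ_h = {S_G, h(S_G)}`. -/
def vertexSet (h : RatFunc K) : Set (P1 K) := {P1.gauss, P1.map h P1.gauss}

open Classical in
/-- The quantized local degree `m_{V,U}(h)` for `V ∈ S(Γ_h)` and `U ∈ S(Γ_G)`; a `U` other than
`{S_G}` is a direction at `S_G`, and a `V` not contained in `U_{h_* v}` is disjoint from it. -/
def quantDegree (h : RatFunc K) (V : Factor (vertexSet h)) (U : Factor (gaussSet K)) : ℕ :=
  if U.1 = {P1.gauss} then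
    if V.1 = {P1.map h P1.gauss} then localDegree h P1.gauss else 0
  else
    if V.1 ⊆ tangentImage h P1.gauss U.1 then
      dirDegree h P1.gauss U.1 + surplusDegree h P1.gauss U.1
    else surplusDegree h P1.gauss U.1

/-- The quantized pullback of a measure `ω` on the factor space of `Γ_h`: the measure on the factor
space of `Γ_G` that gives to each cell `U` the mass `∑_V m_{V,U}(h) ω(V)`. -/
def quantPullback (h : RatFunc K) (ω : Measure (Factor (vertexSet h))) :
    Measure (Factor (gaussSet K)) :=
  Measure.sum fun U => (∑' V, (quantDegree h V U : ℝ≥0∞) * ω {V}) • Measure.dirac U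

/-- The quantized `h`-balanced property of `ω`: the quantized pullback of `ω`, divided by
`deg h`, is the projection of `ω` to the factor space of `Γ_G`. -/
def QuantBalanced (h : RatFunc K) (ω : Measure (Factor (vertexSet h))) : Prop :=
  (degree h : ℝ≥0∞)⁻¹ • quantPullback h ω = ω.map (factorProj (vertexSet h) (gaussSet K))

end Berk

end

/-! Write h = f^n, d = deg f, and G for the Gauss point. Comparing masses at a point x in f^*ν = dν
gives d ν{x} = deg_x(f) ν{f(x)} with deg_x(f) > 0, so x is an atom exactly when f(x) is. Hence
ν{f(G)} = 0 forces ν{G} = 0, and then ν{h(G)} = 0. For a direction v at G, iterating the invariance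
gives ∫ (h^*δ_y)(U_v) dν(y) = d^n ν(U_v). For y ≠ h(G), that is for almost every y, the integrand is
the quantized degree of the cell of S(Γ_h) containing y, so the integral is Σ_V m_{V,U_v} ν(V): this
is the balance equation at U_v. At the cell {G} both sides vanish. Equality on cells suffices
although a factor space may be uncountable and carries all subsets as measurable sets: by regularity
the null cells have null union, so a quantized measure is a sum of point masses (`quantize_eq_sum`).

The substance is the claim about the integrand (`pullbackDirac_direction`). Several degrees are
defined as infima or unions, and must be shown to have the intended values.

Fibres with multiplicity are encoded as tuples M of d points for which the function a ↦ ∏ |a - M_i|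
is proportional to a ↦ |P(a) - Q(a) y|, where h = P/Q and d = deg h. In normalized coordinates this
is a closed condition on (y, M) in a compact space, and over classical y it holds by factoring a
polynomial. As classical points are dense, every y has such a tuple (`exists_isFiber`). The tuple is
unique up to order, because the growth of the product on annuli counts the points in each disc.
Multiplicities in it are the local degrees (`localDegree_eq`), and fibres of compositions are
obtained by substitution (`pullbackDirac_comp`).

For directions, Möbius changes of coordinate reduce to h(G) = G with reduction φ. The components of
the complement of G are the residue classes, and roots in a residue disc are counted by root
multiplicities of reduced polynomials. Comparing lowest terms before and after reduction, the number
of solutions of h = b in a residue disc is a constant, the surplus, plus the local degree of φ when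
b lies in the image class. Since the count is locally constant in y off h(G), and the components are
connected, this extends from classical b to all y ≠ h(G). -/

noncomputable section

/-! ### Rational functions: composition, fibre polynomials, multiplicities at infinity -/

namespace RatMap

section Field

variable {F : Type*} [Field F]

/-- Substitution of a non-constant rational function, as a ring homomorphism. -/
def compHom (h : RatFunc F) (hd : 0 < degree h) : RatFunc F →+* RatFunc F where
  toFun φ := comp φ h
  map_one' := by simp [comp]
  map_zero' := by simp [comp]
  map_add' := comp_add hd
  map_mul' := comp_mul hd

theorem compHom_apply (h : RatFunc F) (hd : 0 < degree h) (φ : RatFunc F) :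
    compHom h hd φ = comp φ h := rfl

theorem comp_X (h : RatFunc F) : comp RatFunc.X h = h := by simp [comp]

theorem comp_algebraMap (p : F[X]) (h : RatFunc F) :
    comp (algebraMap F[X] (RatFunc F) p) h = p.eval₂ RatFunc.C h := by
  simp [comp, RatFunc.eval_algebraMap]

theorem compHom_comp_C (h : RatFunc F) (hd : 0 < degree h) :
    (compHom h hd).comp RatFunc.C = RatFunc.C :=
  RingHom.ext fun c => comp_C c h

theorem comp_assoc {f g : RatFunc F} (hg : 0 < degree g) (φ : RatFunc F) :
    comp (comp φ f) g = comp φ (comp f g) := by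
  rw [← compHom_apply g hg (comp φ f)]
  conv_lhs => rw [comp, RatFunc.eval]
  rw [map_div₀, Polynomial.hom_eval₂, Polynomial.hom_eval₂, compHom_comp_C]
  rfl

theorem comp_sub {h : RatFunc F} (hd : 0 < degree h) (φ ψ : RatFunc F) :
    comp (φ - ψ) h = comp φ h - comp ψ h := map_sub (compHom h hd) φ ψ

theorem comp_inv {h : RatFunc F} (hd : 0 < degree h) (φ : RatFunc F) :
    comp φ⁻¹ h = (comp φ h)⁻¹ := map_inv₀ (compHom h hd) φ

theorem degree_pos_iff {h : RatFunc F} : 0 < degree h ↔ ¬ ∃ c, h = RatFunc.C c := by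
  refine ⟨ne_C_of_degree_pos, fun H => ?_⟩
  by_contra h0
  have h1 : h.num.natDegree = 0 := by unfold degree at h0; omega
  have h2 : h.denom.natDegree = 0 := by unfold degree at h0; omega
  apply H
  refine ⟨h.num.coeff 0 / h.denom.coeff 0, ?_⟩
  rw [map_div₀, ← RatFunc.algebraMap_C, ← RatFunc.algebraMap_C,
    ← Polynomial.eq_C_of_natDegree_eq_zero h1, ← Polynomial.eq_C_of_natDegree_eq_zero h2,
    RatFunc.num_div_denom]

theorem degree_comp_pos {f g : RatFunc F} (hf : 0 < degree f) (hg : 0 < degree g) :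
    0 < degree (comp f g) := by
  rw [degree_pos_iff] at hf ⊢
  rintro ⟨c, hc⟩
  refine hf ⟨c, (compHom g hg).injective ?_⟩
  rw [compHom_apply, compHom_apply, comp_C, hc]

/-- Two coprime representations of a fraction divide each other, so they differ by a unit, the one
introduced by normalizing the denominator. All later statements on numerators and denominators
therefore hold up to a constant `u`. -/
theorem num_denom_of_coprime {P Q : F[X]} (hQ : Q ≠ 0) (hPQ : IsCoprime P Q) :
    ∃ u : F, u ≠ 0 ∧
      (algebraMap F[X] (RatFunc F) P / algebraMap F[X] (RatFunc F) Q).num = Polynomial.C u * P ∧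
      (algebraMap F[X] (RatFunc F) P / algebraMap F[X] (RatFunc F) Q).denom
        = Polynomial.C u * Q := by
  set φ := algebraMap F[X] (RatFunc F) P / algebraMap F[X] (RatFunc F) Q with hφ
  have key : φ.num * Q = P * φ.denom := by
    have := RatFunc.num_div_denom φ
    have hd := RatFunc.algebraMap_ne_zero φ.denom_ne_zero
    have hb' := RatFunc.algebraMap_ne_zero hQ
    apply RatFunc.algebraMap_injective F
    rw [map_mul, map_mul]
    rw [hφ, div_eq_div_iff hd hb'] at this
    exact this
  have h1 : φ.denom ∣ Q :=
    (RatFunc.isCoprime_num_denom φ).symm.dvd_of_dvd_mul_left ⟨P, by rw [key, mul_comm]⟩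
  have h2 : Q ∣ φ.denom := hPQ.symm.dvd_of_dvd_mul_left ⟨φ.num, by rw [← key, mul_comm]⟩
  obtain ⟨v, hv⟩ := associated_of_dvd_dvd h2 h1
  obtain ⟨u, hu, hu'⟩ := Polynomial.isUnit_iff.mp v.isUnit
  refine ⟨u, hu.ne_zero, ?_, ?_⟩
  · apply mul_right_cancel₀ hQ
    rw [key, ← hv, ← hu']; ring
  · rw [← hv, ← hu']; ring

/-- The homogenization of degree `d` of `p`, evaluated at a pair of polynomials. -/
def homEval (d : ℕ) (p P Q : F[X]) : F[X] :=
  ∑ j ∈ Finset.range (d + 1), Polynomial.C (p.coeff j) * P ^ j * Q ^ (d - j)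

theorem algebraMap_homEval {d : ℕ} {p P Q : F[X]} (hp : p.natDegree ≤ d) (hQ : Q ≠ 0) :
    algebraMap F[X] (RatFunc F) (homEval d p P Q) = algebraMap F[X] (RatFunc F) Q ^ d *
      p.eval₂ RatFunc.C (algebraMap F[X] (RatFunc F) P / algebraMap F[X] (RatFunc F) Q) := by
  have hQ' := RatFunc.algebraMap_ne_zero hQ
  rw [Polynomial.eval₂_eq_sum_range' _ (Nat.lt_succ_of_le hp), homEval, map_sum, Finset.mul_sum]
  refine Finset.sum_congr rfl fun j hj => ?_
  have hj' : j ≤ d := Nat.lt_succ_iff.mp (Finset.mem_range.mp hj)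
  simp only [map_mul, map_pow, RatFunc.algebraMap_C]
  rw [div_pow, ← Nat.sub_add_cancel hj', pow_add, Nat.add_sub_cancel]
  field_simp

theorem eval_homEval {d : ℕ} {p P Q : F[X]} (hp : p.natDegree ≤ d) {a : F} (hQ : Q.eval a ≠ 0) :
    (homEval d p P Q).eval a = Q.eval a ^ d * p.eval (P.eval a / Q.eval a) := by
  rw [Polynomial.eval_eq_sum_range' (Nat.lt_succ_of_le hp), homEval, Polynomial.eval_finsetSum,
    Finset.mul_sum]
  refine Finset.sum_congr rfl fun j hj => ?_
  have hj' : j ≤ d := Nat.lt_succ_iff.mp (Finset.mem_range.mp hj)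
  simp only [Polynomial.eval_mul, Polynomial.eval_pow, Polynomial.eval_C]
  rw [div_pow, ← Nat.sub_add_cancel hj', pow_add, Nat.add_sub_cancel]
  field_simp

theorem eval_homEval_of_eq_zero {d : ℕ} {p P Q : F[X]} {a : F} (hQ : Q.eval a = 0) :
    (homEval d p P Q).eval a = p.coeff d * P.eval a ^ d := by
  rw [homEval, Polynomial.eval_finsetSum, Finset.sum_range_succ, Finset.sum_eq_zero]
  · simp
  · intro j hj
    have := Finset.mem_range.mp hj
    simp [hQ, zero_pow (Nat.sub_ne_zero_of_lt this)]

theorem homEval_one_X (d : ℕ) (p : F[X]) (hp : p.natDegree ≤ d) :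
    homEval d p 1 Polynomial.X = p.reflect d := by
  ext i
  simp only [homEval, one_pow, mul_one, Polynomial.finsetSum_coeff, Polynomial.coeff_C_mul_X_pow,
    Polynomial.coeff_reflect]
  by_cases hi : i ≤ d
  · rw [Polynomial.revAt_le hi, Finset.sum_eq_single (d - i)]
    · rw [if_pos (by omega)]
    · intro j hj hne
      have := Finset.mem_range.mp hj
      rw [if_neg (by omega)]
    · intro hn
      exact absurd (Finset.mem_range.mpr (by omega)) hn
  · rw [Polynomial.revAt_eq_self_of_lt (by omega),
      Polynomial.coeff_eq_zero_of_natDegree_lt (by omega)]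
    refine Finset.sum_eq_zero fun j hj => ?_
    rw [if_neg (by omega)]

theorem homEval_ne_zero {d : ℕ} {p R S : F[X]} (hp : p.natDegree ≤ d) (hp0 : p ≠ 0) (hS : S ≠ 0)
    (hg : 0 < degree (algebraMap F[X] (RatFunc F) R / algebraMap F[X] (RatFunc F) S)) :
    homEval d p R S ≠ 0 := by
  intro h0
  have := algebraMap_homEval (P := R) hp hS
  rw [h0, map_zero] at this
  exact mul_ne_zero (pow_ne_zero _ (RatFunc.algebraMap_ne_zero hS)) (eval₂_ne_zero hg hp0) this.symm

theorem comp_div {d : ℕ} {P Q R S : F[X]} (hP : P.natDegree ≤ d) (hQ : Q.natDegree ≤ d)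
    (hS : S ≠ 0)
    (hg : 0 < degree (algebraMap F[X] (RatFunc F) R / algebraMap F[X] (RatFunc F) S)) :
    comp (algebraMap F[X] (RatFunc F) P / algebraMap F[X] (RatFunc F) Q)
      (algebraMap F[X] (RatFunc F) R / algebraMap F[X] (RatFunc F) S) =
    algebraMap F[X] (RatFunc F) (homEval d P R S) /
      algebraMap F[X] (RatFunc F) (homEval d Q R S) := by
  rw [← compHom_apply _ hg, map_div₀, compHom_apply, compHom_apply, comp_algebraMap,
    comp_algebraMap, algebraMap_homEval hP hS, algebraMap_homEval hQ hS,
    mul_div_mul_left _ _ (pow_ne_zero _ (RatFunc.algebraMap_ne_zero hS))]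

theorem X_inv_eq : (RatFunc.X : RatFunc F)⁻¹ =
    algebraMap F[X] (RatFunc F) 1 / algebraMap F[X] (RatFunc F) Polynomial.X := by
  simp

theorem degree_X_inv : degree (RatFunc.X : RatFunc F)⁻¹ = 1 := by
  obtain ⟨u, hu, h1, h2⟩ := num_denom_of_coprime (F := F) (P := 1) (Q := Polynomial.X)
    Polynomial.X_ne_zero isCoprime_one_left
  rw [X_inv_eq, degree, h1, h2]
  simp [hu]

theorem degree_X : degree (RatFunc.X : RatFunc F) = 1 := by
  simp [degree]

theorem comp_div_X_inv {d : ℕ} {P Q : F[X]} (hP : P.natDegree ≤ d) (hQ : Q.natDegree ≤ d) :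
    comp (algebraMap F[X] (RatFunc F) P / algebraMap F[X] (RatFunc F) Q) RatFunc.X⁻¹ =
    algebraMap F[X] (RatFunc F) (P.reflect d) / algebraMap F[X] (RatFunc F) (Q.reflect d) := by
  rw [← homEval_one_X d P hP, ← homEval_one_X d Q hQ, X_inv_eq]
  exact comp_div hP hQ Polynomial.X_ne_zero (by rw [← X_inv_eq, degree_X_inv]; exact one_pos)

theorem num_natDegree_le (h : RatFunc F) : h.num.natDegree ≤ degree h := le_max_left _ _

theorem denom_natDegree_le (h : RatFunc F) : h.denom.natDegree ≤ degree h := le_max_right _ _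

/-- Numerator and denominator, homogenized in degree `degree h`, do not vanish together at infinity.
-/
theorem coeff_degree_ne_zero {h : RatFunc F} :
    h.num.coeff (degree h) ≠ 0 ∨ h.denom.coeff (degree h) ≠ 0 := by
  by_contra! H
  rcases le_total h.num.natDegree h.denom.natDegree with hle | hle
  · rw [degree, max_eq_right hle] at H
    exact h.denom_ne_zero (Polynomial.leadingCoeff_eq_zero.mp H.2)
  · rw [degree, max_eq_left hle] at H
    have h0 := Polynomial.leadingCoeff_eq_zero.mp H.1
    rw [h0] at hle
    have h1 : h.denom.natDegree = 0 := by simpa using hle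
    have := H.2
    rw [h0] at this
    simp only [Polynomial.natDegree_zero] at this
    rw [← h1] at this
    exact h.denom_ne_zero (Polynomial.leadingCoeff_eq_zero.mp this)

theorem not_both_root (h : RatFunc F) (a : F) : ¬ (h.num.eval a = 0 ∧ h.denom.eval a = 0) := by
  rintro ⟨h1, h2⟩
  obtain ⟨u, v, huv⟩ := RatFunc.isCoprime_num_denom h
  have := congrArg (Polynomial.eval a) huv
  simp [h1, h2] at this

theorem fiberPoly_ne_zero {h : RatFunc F} (hd : 0 < degree h) (b : OnePoint F) :
    fiberPoly h b ≠ 0 := by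
  induction b using OnePoint.rec with
  | infty => exact h.denom_ne_zero
  | coe b =>
    intro h0
    apply ne_C_of_degree_pos hd
    refine ⟨b, ?_⟩
    have : h.num = Polynomial.C b * h.denom := sub_eq_zero.mp h0
    rw [← RatFunc.num_div_denom h]
    conv_lhs => rw [this]
    rw [map_mul, mul_div_cancel_right₀ _ (RatFunc.algebraMap_ne_zero h.denom_ne_zero),
      RatFunc.algebraMap_C]

theorem fiberPoly_natDegree_le (h : RatFunc F) (b : OnePoint F) :
    (fiberPoly h b).natDegree ≤ degree h := by
  induction b using OnePoint.rec with
  | infty => exact denom_natDegree_le h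
  | coe b =>
    refine (Polynomial.natDegree_sub_le _ _).trans (max_le (num_natDegree_le h) ?_)
    exact (Polynomial.natDegree_C_mul_le _ _).trans (denom_natDegree_le h)

theorem evalFin_eq_iff (h : RatFunc F) (a : F) (b : OnePoint F) :
    evalFin h a = b ↔ (fiberPoly h b).eval a = 0 := by
  have hn := not_both_root h a
  induction b using OnePoint.rec with
  | infty =>
    by_cases h0 : h.denom.eval a = 0
    · simp [evalFin, fiberPoly, h0]
    · simp [evalFin, fiberPoly, h0]
  | coe b =>
    by_cases h0 : h.denom.eval a = 0
    · have : h.num.eval a ≠ 0 := fun h1 => hn ⟨h1, h0⟩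
      simp [evalFin, fiberPoly, h0, this]
    · simp only [evalFin, h0, if_false, fiberPoly, Polynomial.eval_sub, Polynomial.eval_mul,
        Polynomial.eval_C, OnePoint.coe_eq_coe]
      rw [div_eq_iff h0, sub_eq_zero]

open Classical in
theorem rootMultiplicity_fiberPoly (h : RatFunc F) (a : F) (b : OnePoint F) :
    (fiberPoly h b).rootMultiplicity a = if evalFin h a = b then degAtFin h a else 0 := by
  split_ifs with hab
  · rw [degAtFin, hab]
  · exact Polynomial.rootMultiplicity_eq_zero fun hr => hab ((evalFin_eq_iff h a b).mpr hr)

theorem degAtFin_pos {h : RatFunc F} (hd : 0 < degree h) (a : F) : 0 < degAtFin h a :=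
  (Polynomial.rootMultiplicity_pos (fiberPoly_ne_zero hd _)).mpr ((evalFin_eq_iff h a _).mp rfl)

/-- `p.reverse` has nonzero constant term, and reflecting in degree `d` only multiplies it by a
power of `X`. The drop of degree is thus the multiplicity of infinity as a root. -/
theorem rootMultiplicity_zero_reflect {d : ℕ} {p : F[X]} (hp : p ≠ 0) (hd : p.natDegree ≤ d) :
    (p.reflect d).rootMultiplicity 0 = d - p.natDegree := by
  have : p.reflect d = p.reverse * Polynomial.X ^ (d - p.natDegree) := by
    have := Polynomial.reflect_mul p 1 (F := p.natDegree) (G := d - p.natDegree) le_rfl (by simp)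
    rw [mul_one, Polynomial.reflect_one, Nat.add_sub_cancel' hd] at this
    exact this
  have h0 : p.reverse ≠ 0 := by simpa using hp
  have h1 := Polynomial.rootMultiplicity_mul_X_sub_C_pow (a := 0) (n := d - p.natDegree) h0
  rw [Polynomial.C_0, sub_zero] at h1
  rw [this, h1, Polynomial.rootMultiplicity_eq_zero, zero_add]
  rw [Polynomial.IsRoot, ← Polynomial.coeff_zero_eq_eval_zero, Polynomial.coeff_zero_reverse]
  simpa using hp

end Field

section AlgClosed

variable {F : Type*} [Field F] [IsAlgClosed F]

theorem isCoprime_of_no_common_root {P Q : F[X]} (hQ : Q ≠ 0)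
    (H : ∀ a, ¬ (P.eval a = 0 ∧ Q.eval a = 0)) : IsCoprime P Q := by
  classical
  rw [← EuclideanDomain.gcd_isUnit_iff]
  by_contra hu
  have h0 : EuclideanDomain.gcd P Q ≠ 0 := fun h => hQ (EuclideanDomain.gcd_eq_zero_iff.mp h).2
  obtain ⟨a, ha⟩ := IsAlgClosed.exists_root (EuclideanDomain.gcd P Q) (by
    intro hdeg
    exact hu (Polynomial.isUnit_iff_degree_eq_zero.mpr hdeg))
  exact H a ⟨Polynomial.eval_eq_zero_of_dvd_of_eval_eq_zero (EuclideanDomain.gcd_dvd_left P Q) ha,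
    Polynomial.eval_eq_zero_of_dvd_of_eval_eq_zero (EuclideanDomain.gcd_dvd_right P Q) ha⟩

/-- Substitution cancels nothing: the homogenizations of the numerator and denominator of `f` have
no common zero in the projective line, hence neither do their values at the coprime pair of `g`.
Poles of `g` correspond to the point at infinity. -/
theorem num_denom_comp (f : RatFunc F) {g : RatFunc F} (hg : 0 < degree g) :
    ∃ u : F, u ≠ 0 ∧
      (comp f g).num = Polynomial.C u * homEval (degree f) f.num g.num g.denom ∧
      (comp f g).denom = Polynomial.C u * homEval (degree f) f.denom g.num g.denom := by
  have hg' := hg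
  rw [← RatFunc.num_div_denom g] at hg'
  have e : comp f g = algebraMap F[X] (RatFunc F) (homEval (degree f) f.num g.num g.denom) /
      algebraMap F[X] (RatFunc F) (homEval (degree f) f.denom g.num g.denom) := by
    conv_lhs => rw [← RatFunc.num_div_denom f, ← RatFunc.num_div_denom g]
    exact comp_div (num_natDegree_le f) (denom_natDegree_le f) g.denom_ne_zero hg'
  rw [e]
  apply num_denom_of_coprime
  · exact homEval_ne_zero (denom_natDegree_le f) f.denom_ne_zero g.denom_ne_zero hg'
  · apply isCoprime_of_no_common_root
    · exact homEval_ne_zero (denom_natDegree_le f) f.denom_ne_zero g.denom_ne_zero hg'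
    · rintro a ⟨h1, h2⟩
      by_cases hQ : g.denom.eval a = 0
      · rw [eval_homEval_of_eq_zero hQ] at h1 h2
        have hP : g.num.eval a ≠ 0 := fun h => not_both_root g a ⟨h, hQ⟩
        rcases coeff_degree_ne_zero (h := f) with h | h
        · exact mul_ne_zero h (pow_ne_zero _ hP) h1
        · exact mul_ne_zero h (pow_ne_zero _ hP) h2
      · rw [eval_homEval (num_natDegree_le f) hQ] at h1
        rw [eval_homEval (denom_natDegree_le f) hQ] at h2
        exact not_both_root f _ ⟨(mul_eq_zero.mp h1).resolve_left (pow_ne_zero _ hQ),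
          (mul_eq_zero.mp h2).resolve_left (pow_ne_zero _ hQ)⟩

/-- Evaluation of the coefficients of a composition at a point where `g` is finite. -/
theorem eval_num_denom_comp (f : RatFunc F) {g : RatFunc F} (hg : 0 < degree g) :
    ∃ u : F, u ≠ 0 ∧ ∀ a, g.denom.eval a ≠ 0 →
      (comp f g).num.eval a =
        u * g.denom.eval a ^ degree f * f.num.eval (g.num.eval a / g.denom.eval a) ∧
      (comp f g).denom.eval a =
        u * g.denom.eval a ^ degree f * f.denom.eval (g.num.eval a / g.denom.eval a) := by
  obtain ⟨u, hu, h1, h2⟩ := num_denom_comp f hg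
  refine ⟨u, hu, fun a ha => ?_⟩
  rw [h1, h2, Polynomial.eval_mul, Polynomial.eval_mul, eval_homEval (num_natDegree_le f) ha,
    eval_homEval (denom_natDegree_le f) ha, Polynomial.eval_C, mul_assoc, mul_assoc]
  exact ⟨rfl, rfl⟩

theorem fiberPoly_comp_X_inv (h : RatFunc F) :
    ∃ u : F, u ≠ 0 ∧ ∀ b, fiberPoly (comp h RatFunc.X⁻¹) b =
      Polynomial.C u * (fiberPoly h b).reflect (degree h) := by
  have e : comp h RatFunc.X⁻¹ = algebraMap F[X] (RatFunc F) (h.num.reflect (degree h)) /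
      algebraMap F[X] (RatFunc F) (h.denom.reflect (degree h)) := by
    conv_lhs => rw [← RatFunc.num_div_denom h]
    exact comp_div_X_inv (num_natDegree_le h) (denom_natDegree_le h)
  have hr : h.denom.reflect (degree h) ≠ 0 := by simpa using h.denom_ne_zero
  have hc : IsCoprime (h.num.reflect (degree h)) (h.denom.reflect (degree h)) := by
    apply isCoprime_of_no_common_root hr
    rw [← homEval_one_X _ _ (num_natDegree_le h), ← homEval_one_X _ _ (denom_natDegree_le h)]
    rintro a ⟨h1, h2⟩
    by_cases ha : (Polynomial.X : F[X]).eval a = 0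
    · rw [eval_homEval_of_eq_zero ha] at h1 h2
      rcases coeff_degree_ne_zero (h := h) with h' | h'
      · exact h' (by simpa using h1)
      · exact h' (by simpa using h2)
    · rw [eval_homEval (num_natDegree_le h) ha] at h1
      rw [eval_homEval (denom_natDegree_le h) ha] at h2
      exact not_both_root h _ ⟨(mul_eq_zero.mp h1).resolve_left (pow_ne_zero _ ha),
          (mul_eq_zero.mp h2).resolve_left (pow_ne_zero _ ha)⟩
  obtain ⟨u, hu, h1, h2⟩ := num_denom_of_coprime hr hc
  refine ⟨u, hu, fun b => ?_⟩
  rw [e]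
  induction b using OnePoint.rec with
  | infty => exact h2
  | coe b =>
    simp only [fiberPoly]
    rw [h1, h2, Polynomial.reflect_sub, Polynomial.reflect_C_mul]
    ring

open Classical in
-- In the coordinate 1 / z the fibre polynomial is reflected, so its missing degree is the
-- multiplicity of infinity as a solution. This makes every fibre have exactly `degree h` points.
theorem natDegree_fiberPoly {h : RatFunc F} (hd : 0 < degree h) (b : OnePoint F) :
    degree h - (fiberPoly h b).natDegree = if eval h ∞ = b then degAt h ∞ else 0 := by
  obtain ⟨u, hu, hf⟩ := fiberPoly_comp_X_inv h
  have := rootMultiplicity_fiberPoly (comp h RatFunc.X⁻¹) 0 b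
  rw [hf b] at this
  change _ = if evalFin (comp h RatFunc.X⁻¹) 0 = b then degAtFin (comp h RatFunc.X⁻¹) 0 else 0
  rw [← this, Polynomial.rootMultiplicity_mul, Polynomial.rootMultiplicity_C, zero_add,
    rootMultiplicity_zero_reflect (fiberPoly_ne_zero hd b) (fiberPoly_natDegree_le h b)]
  apply mul_ne_zero (by simpa using hu)
  simpa using fiberPoly_ne_zero hd b

/-- The factor of a fibre polynomial corresponding to a point of the projective line. -/
def linAt (a : F) : OnePoint F → F
  | ∞ => 1
  | OnePoint.some r => a - r

open Classical in
theorem exists_tuple_of_multiset {α : Type*} (S : Multiset α) {n : ℕ} (hn : Multiset.card S = n) :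
    ∃ t : Fin n → α, Finset.univ.val.map t = S ∧
      ∀ x, (Finset.univ.filter fun i => t i = x).card = S.count x := by
  subst hn
  obtain ⟨t, ht⟩ : ∃ t : Fin (Multiset.card S) → α, Finset.univ.val.map t = S := by
    induction S using Quot.inductionOn with
    | h l => exact ⟨l.get, (Fin.univ_val_map l.get).trans (by rw [List.ofFn_get]; rfl)⟩
  refine ⟨t, ht, fun x => ?_⟩
  have e2 : S.count x = (Finset.univ.val.map t).count x := by rw [ht]
  rw [e2, Multiset.count_map, Finset.card_def, Finset.filter_val]
  congr 1
  exact Multiset.filter_congr fun i _ => eq_comm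

open Classical in
/-- The fibre of a rational function over a classical point, with multiplicities. -/
theorem exists_classical_fiber {h : RatFunc F} (hd : 0 < degree h) (b : OnePoint F) :
    ∃ t : Fin (degree h) → OnePoint F, ∃ c : F, c ≠ 0 ∧
      (∀ a, (fiberPoly h b).eval a = c * ∏ i, linAt a (t i)) ∧
      (∀ x, (Finset.univ.filter fun i => t i = x).card = if eval h x = b then degAt h x else 0) ∧
      Finset.univ.val.map t = (fiberPoly h b).roots.map (OnePoint.some : F → OnePoint F) +
        Multiset.replicate (degree h - (fiberPoly h b).natDegree) OnePoint.infty := by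
  set p := fiberPoly h b with hp
  have hp0 : p ≠ 0 := fiberPoly_ne_zero hd b
  have hsplit := IsAlgClosed.splits p
  have hcard : Multiset.card p.roots = p.natDegree := hsplit.natDegree_eq_card_roots.symm
  set S : Multiset (OnePoint F) :=
    p.roots.map (OnePoint.some : F → OnePoint F) + Multiset.replicate (degree h - p.natDegree) (OnePoint.infty : OnePoint F) with hS
  have hSc : Multiset.card S = degree h := by
    rw [hS, Multiset.card_add, Multiset.card_map, Multiset.card_replicate, hcard]
    exact Nat.add_sub_cancel' (fiberPoly_natDegree_le h b)
  obtain ⟨t, ht, htc⟩ := exists_tuple_of_multiset S hSc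
  refine ⟨t, p.leadingCoeff, Polynomial.leadingCoeff_ne_zero.mpr hp0, fun a => ?_, fun x => ?_, ht⟩
  · have e1 : ∏ i, linAt a (t i) = ((Finset.univ.val.map t).map (linAt a)).prod := by
      rw [Multiset.map_map]; rfl
    rw [e1, ht, hS, Multiset.map_add, Multiset.prod_add, Multiset.map_map, Multiset.map_replicate,
      Multiset.prod_replicate]
    conv_lhs => rw [hsplit.eq_prod_roots]
    rw [Polynomial.eval_mul, Polynomial.eval_C, Polynomial.eval_multiset_prod, Multiset.map_map]
    simp [linAt, Function.comp_def]
  · rw [htc, hS, Multiset.count_add, Multiset.count_replicate]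
    induction x using OnePoint.rec with
    | infty =>
      rw [if_pos rfl, natDegree_fiberPoly hd, Multiset.count_eq_zero_of_notMem, zero_add]
      simp
    | coe x =>
      rw [if_neg (OnePoint.infty_ne_coe x), add_zero,
        Multiset.count_map_eq_count' _ _ (OnePoint.coe_injective), Polynomial.count_roots]
      exact rootMultiplicity_fiberPoly h x b

omit [IsAlgClosed F] in
theorem degAt_pos {h : RatFunc F} (hd : 0 < degree h) (x : OnePoint F) : 0 < degAt h x := by
  induction x using OnePoint.rec with
  | infty =>
    exact degAtFin_pos (degree_comp_pos hd (by rw [degree_X_inv]; exact one_pos)) 0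
  | coe x => exact degAtFin_pos hd x

end AlgClosed

end RatMap

/-! ### Points of the Berkovich line: compactness, determination by |z - a|, action on classical
points -/

namespace Berk

open RatMap

variable {K : Type*} [NontriviallyNormedField K]

namespace A1

theorem ext_val {p q : A1 K} (h : ∀ f, p.val f = q.val f) : p = q := by
  cases p; cases q
  congr
  exact funext h

/-- A point of the affine line as a multiplicative map. -/
def valHom (p : A1 K) : K[X] →* ℝ≥0 where
  toFun := p.val
  map_one' := p.val_one
  map_mul' := p.val_mul

theorem ext_linear [IsAlgClosed K] {p q : A1 K}
    (h : ∀ a, p.val (Polynomial.X - Polynomial.C a) = q.val (Polynomial.X - Polynomial.C a)) :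
    p = q := by
  apply ext_val
  intro f
  rw [(IsAlgClosed.splits f).eq_prod_roots]
  change p.valHom _ = q.valHom _
  rw [map_mul, map_mul, map_multiset_prod, map_multiset_prod, Multiset.map_map, Multiset.map_map]
  congr 1
  · exact (p.val_C _).trans (q.val_C _).symm
  · congr 1
    exact Multiset.map_congr rfl fun a _ => h a

end A1

namespace P1

theorem ext_val {x y : P1 K} (h : ∀ φ, x.val φ = y.val φ) : x = y := by
  cases x; cases y
  congr
  exact funext h

theorem isInducing_val : IsInducing (P1.val : P1 K → RatFunc K → ℝ≥0∞) := ⟨rfl⟩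

theorem injective_val : Function.Injective (P1.val : P1 K → RatFunc K → ℝ≥0∞) :=
  fun _ _ h => ext_val fun φ => congrFun h φ

theorem continuous_val (φ : RatFunc K) : Continuous fun x : P1 K => x.val φ :=
  (continuous_apply φ).comp isInducing_val.continuous

instance : T2Space (P1 K) := T2Space.of_injective_continuous injective_val isInducing_val.continuous

/-- The axioms pass to pointwise limits. For multiplicativity the excluded products 0 · ∞ are
exactly where multiplication on [0, ∞] is discontinuous. Compactness of the line follows from that
of the product. -/
theorem isClosed_range_val : IsClosed (range (P1.val : P1 K → RatFunc K → ℝ≥0∞)) := by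
  rw [isClosed_iff_ultrafilter]
  intro v u hu hr
  have hr' : ∀ᶠ w in (u : Filter (RatFunc K → ℝ≥0∞)), ∃ x : P1 K, x.val = w := hr
  have ht : ∀ φ, Tendsto (fun w : RatFunc K → ℝ≥0∞ => w φ) u (𝓝 (v φ)) := fun φ =>
    ((continuous_apply φ).tendsto v).mono_left hu
  refine ⟨⟨v, fun c => ?_, fun φ ψ => ?_, fun φ ψ h1 h2 => ?_⟩, rfl⟩
  · refine tendsto_nhds_unique (ht _) (tendsto_const_nhds.congr' ?_)
    filter_upwards [hr'] with w ⟨x, hx⟩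
    rw [← hx, x.val_C]
  · refine le_of_tendsto_of_tendsto (ht _) ((ht φ).max (ht ψ)) ?_
    filter_upwards [hr'] with w ⟨x, hx⟩
    rw [← hx]
    exact x.val_add_le φ ψ
  · have hm := ENNReal.Tendsto.mul (ht φ) (by tauto) (ht ψ) (by tauto)
    refine tendsto_nhds_unique (ht _) (hm.congr' ?_)
    -- Being a product that is not 0 · ∞ is an open condition, so it already holds for the nearby
    -- seminorms, to which `val_mul` applies.
    have aux : ∀ φ ψ : RatFunc K, ¬ (v φ = 0 ∧ v ψ = ⊤) →
        ∀ᶠ w in (u : Filter (RatFunc K → ℝ≥0∞)), ¬ (w φ = 0 ∧ w ψ = ⊤) := by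
      intro φ ψ h
      rcases not_and_or.mp h with h | h
      · filter_upwards [(ht φ).eventually_ne h] with w hw using fun H => hw H.1
      · filter_upwards [(ht ψ).eventually_ne h] with w hw using fun H => hw H.2
    filter_upwards [hr', aux φ ψ h1, aux ψ φ (fun H => h2 ⟨H.2, H.1⟩)] with w ⟨x, hx⟩ ha hb
    rw [← hx] at ha hb ⊢
    exact (x.val_mul φ ψ ha (fun H => hb ⟨H.2, H.1⟩)).symm

instance : CompactSpace (P1 K) :=
  (Topology.IsClosedEmbedding.mk ⟨isInducing_val, injective_val⟩ isClosed_range_val).compactSpace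

theorem val_zero (x : P1 K) : x.val 0 = 0 := by simpa using x.val_C 0

theorem val_one (x : P1 K) : x.val 1 = 1 := by simpa [enorm_eq_nnnorm] using x.val_C 1

theorem val_C_mul (x : P1 K) {c : K} (hc : c ≠ 0) (φ : RatFunc K) :
    x.val (RatFunc.C c * φ) = ‖c‖ₑ * x.val φ := by
  have h0 : ‖c‖ₑ ≠ 0 := by simpa using hc
  have h1 : ‖c‖ₑ ≠ ⊤ := enorm_ne_top
  rw [x.val_mul, x.val_C]
  · rw [x.val_C]; exact fun H => h0 H.1
  · rw [x.val_C]; exact fun H => h1 H.1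

theorem val_neg (x : P1 K) (φ : RatFunc K) : x.val (-φ) = x.val φ := by
  have := x.val_C_mul (c := -1) (by simp) φ
  simpa using this

theorem val_sub_comm (x : P1 K) (φ ψ : RatFunc K) : x.val (φ - ψ) = x.val (ψ - φ) := by
  rw [← neg_sub, val_neg]

theorem val_add_eq_right (x : P1 K) {φ ψ : RatFunc K} (h : x.val φ < x.val ψ) :
    x.val (φ + ψ) = x.val ψ := by
  apply le_antisymm
  · exact (x.val_add_le φ ψ).trans (max_le h.le le_rfl)
  · by_contra! H
    have := x.val_add_le (φ + ψ) (-φ)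
    rw [add_neg_cancel_comm, val_neg] at this
    exact absurd this (not_le.mpr (max_lt H h))

theorem val_inv (x : P1 K) {φ : RatFunc K} (hφ : φ ≠ 0) : x.val φ⁻¹ = (x.val φ)⁻¹ := by
  have hm : φ * φ⁻¹ = 1 := mul_inv_cancel₀ hφ
  by_cases h1 : x.val φ = 0 ∧ x.val φ⁻¹ = ⊤
  · rw [h1.1, h1.2, ENNReal.inv_zero]
  by_cases h2 : x.val φ = ⊤ ∧ x.val φ⁻¹ = 0
  · rw [h2.1, h2.2, ENNReal.inv_top]
  · have := x.val_mul φ φ⁻¹ h1 h2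
    rw [hm, val_one, mul_comm] at this
    exact ENNReal.eq_inv_of_mul_eq_one_left this.symm

/-- The value `|z - a|` at a point. -/
def absSub (x : P1 K) (a : K) : ℝ≥0∞ := x.val (RatFunc.X - RatFunc.C a)

theorem continuous_absSub (a : K) : Continuous fun x : P1 K => x.absSub a := continuous_val _

theorem absSub_eq_of_lt (x : P1 K) {a b : K} (h : ‖a - b‖ₑ < x.absSub a) :
    x.absSub b = x.absSub a := by
  have e : RatFunc.X - RatFunc.C b = RatFunc.C (a - b) + (RatFunc.X - RatFunc.C a) := by
    rw [map_sub]; ring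
  rw [absSub, e, val_add_eq_right, absSub]
  rwa [x.val_C]

theorem absSub_eq_of_gt (x : P1 K) {a b : K} (h : x.absSub a < ‖a - b‖ₑ) :
    x.absSub b = ‖a - b‖ₑ := by
  have e : RatFunc.X - RatFunc.C b = (RatFunc.X - RatFunc.C a) + RatFunc.C (a - b) := by
    rw [map_sub]; ring
  rw [absSub, e, val_add_eq_right, x.val_C]
  rwa [x.val_C]

theorem absSub_le (x : P1 K) (a b : K) : x.absSub b ≤ max (x.absSub a) ‖a - b‖ₑ := by
  have e : RatFunc.X - RatFunc.C b = (RatFunc.X - RatFunc.C a) + RatFunc.C (a - b) := by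
    rw [map_sub]; ring
  rw [absSub, e, ← x.val_C (a - b)]
  exact x.val_add_le _ _

theorem absSub_eq_top_iff (x : P1 K) (a b : K) : x.absSub a = ⊤ ↔ x.absSub b = ⊤ := by
  have key : ∀ a b, x.absSub a = ⊤ → x.absSub b = ⊤ := fun a b h => by
    rw [x.absSub_eq_of_lt (a := a) (by rw [h]; exact enorm_lt_top), h]
  exact ⟨key a b, key b a⟩

theorem absSub_zero (x : P1 K) : x.absSub 0 = x.val RatFunc.X := by
  rw [absSub, map_zero, sub_zero]

theorem val_polynomial_ne_top (x : P1 K) (hx : x.val RatFunc.X ≠ ⊤) (p : K[X]) :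
    x.val (algebraMap K[X] (RatFunc K) p) ≠ ⊤ := by
  induction p using Polynomial.induction_on' with
  | add p q hp hq =>
    rw [map_add]
    exact ((x.val_add_le _ _).trans_lt (max_lt hp.lt_top hq.lt_top)).ne
  | monomial n c =>
    have hn : ∀ n : ℕ, x.val (RatFunc.X ^ n) ≠ ⊤ := by
      intro n
      induction n with
      | zero => rw [pow_zero, val_one]; exact ENNReal.one_ne_top
      | succ n ih =>
        rw [pow_succ, x.val_mul _ _ (fun H => hx H.2) (fun H => ih H.1)]
        exact ENNReal.mul_ne_top ih hx
    rw [RatFunc.algebraMap_monomial]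
    by_cases hc : c = 0
    · simp [hc, val_zero]
    · rw [val_C_mul x hc]
      exact ENNReal.mul_ne_top enorm_ne_top (hn n)

theorem val_polynomial_mul (x : P1 K) (hx : x.val RatFunc.X ≠ ⊤) (p q : K[X]) :
    x.val (algebraMap K[X] (RatFunc K) (p * q)) =
      x.val (algebraMap K[X] (RatFunc K) p) * x.val (algebraMap K[X] (RatFunc K) q) := by
  rw [map_mul]
  exact x.val_mul _ _ (fun H => val_polynomial_ne_top x hx q H.2)
    (fun H => val_polynomial_ne_top x hx p H.1)

/-- A point where `z` is finite, as a point of the affine line. -/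
def toA1 (x : P1 K) (hx : x.val RatFunc.X ≠ ⊤) : A1 K where
  val p := (x.val (algebraMap K[X] (RatFunc K) p)).toNNReal
  val_C c := by rw [RatFunc.algebraMap_C, x.val_C, enorm_eq_nnnorm, ENNReal.toNNReal_coe]
  val_add_le p q := by
    rw [map_add]
    rcases le_max_iff.mp (x.val_add_le (algebraMap K[X] (RatFunc K) p)
      (algebraMap K[X] (RatFunc K) q)) with h | h
    · exact le_max_of_le_left (ENNReal.toNNReal_mono (val_polynomial_ne_top x hx p) h)
    · exact le_max_of_le_right (ENNReal.toNNReal_mono (val_polynomial_ne_top x hx q) h)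
  val_mul p q := by rw [val_polynomial_mul x hx, ENNReal.toNNReal_mul]

theorem coe_toA1_val (x : P1 K) (hx : x.val RatFunc.X ≠ ⊤) (p : K[X]) :
    ((x.toA1 hx).val p : ℝ≥0∞) = x.val (algebraMap K[X] (RatFunc K) p) :=
  ENNReal.coe_toNNReal (val_polynomial_ne_top x hx p)

theorem ofA1_toA1 (x : P1 K) (hx : x.val RatFunc.X ≠ ⊤) : ofA1 (x.toA1 hx) = x := by
  apply ext_val
  intro φ
  change (x.toA1 hx).ratVal φ = _
  rw [A1.ratVal, coe_toA1_val, coe_toA1_val]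
  have hc := (x.toA1 hx).not_both_zero (RatFunc.isCoprime_num_denom φ)
  conv_rhs => rw [← RatFunc.num_div_denom φ, div_eq_mul_inv]
  have hd : algebraMap K[X] (RatFunc K) φ.denom ≠ 0 := RatFunc.algebraMap_ne_zero φ.denom_ne_zero
  rw [x.val_mul, val_inv x hd, div_eq_mul_inv]
  · rintro ⟨h1, h2⟩
    rw [val_inv x hd, ENNReal.inv_eq_top] at h2
    apply hc
    constructor
    · rw [← ENNReal.coe_eq_zero, coe_toA1_val, h1]
    · rw [← ENNReal.coe_eq_zero, coe_toA1_val, h2]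
  · exact fun H => val_polynomial_ne_top x hx _ H.1

theorem ofA1_val_algebraMap (p : A1 K) (f : K[X]) :
    (ofA1 p).val (algebraMap K[X] (RatFunc K) f) = p.val f := by
  change p.ratVal _ = _
  have := p.ratVal_div f 1 one_ne_zero (by simp [p.val_one])
  rw [map_one, div_one] at this
  rw [this, p.val_one]; simp

theorem ofA1_absSub (p : A1 K) (a : K) :
    (ofA1 p).absSub a = p.val (Polynomial.X - Polynomial.C a) := by
  rw [← ofA1_val_algebraMap, map_sub, RatFunc.algebraMap_X, RatFunc.algebraMap_C]; rfl

theorem map_val {h : RatFunc K} (hd : 0 < degree h) (x : P1 K) (φ : RatFunc K) :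
    (map h x).val φ = x.val (comp φ h) := by
  rw [map, dif_pos hd]

theorem map_comp {f g : RatFunc K} (hf : 0 < degree f) (hg : 0 < degree g) (x : P1 K) :
    map (comp f g) x = map f (map g x) := by
  apply ext_val
  intro φ
  rw [map_val (degree_comp_pos hf hg), map_val hf, map_val hg, comp_assoc hg]

theorem map_X (x : P1 K) : map RatFunc.X x = x := by
  apply ext_val
  intro φ
  rw [map_val (by rw [degree_X]; exact one_pos)]
  congr 1
  conv_lhs => rw [comp, RatFunc.eval]
  have : ∀ p : K[X], p.eval₂ RatFunc.C (RatFunc.X : RatFunc K) = algebraMap K[X] (RatFunc K) p :=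
    fun p => by
      rw [← RatFunc.aeval_X_left_eq_algebraMap, Polynomial.aeval_def, RatFunc.algebraMap_eq_C]
  rw [this, this, RatFunc.num_div_denom]

theorem continuous_map (h : RatFunc K) : Continuous (map h : P1 K → P1 K) := by
  by_cases hd : 0 < degree h
  · rw [isInducing_val.continuous_iff, continuous_pi_iff]
    intro φ
    exact (continuous_val (comp φ h)).congr fun x => (map_val hd x φ).symm
  · have : (map h : P1 K → P1 K) = id := funext fun x => by rw [map, dif_neg hd]; rfl
    rw [this]
    exact continuous_id

theorem map_absSub {h : RatFunc K} (hd : 0 < degree h) (x : P1 K) (a : K) :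
    (map h x).absSub a = x.val (h - RatFunc.C a) := by
  rw [absSub, map_val hd, comp_sub hd, comp_X, comp_C]

theorem degree_X_inv_pos : 0 < degree (RatFunc.X : RatFunc K)⁻¹ := by
  rw [degree_X_inv]; exact one_pos

theorem comp_X_inv_X_inv : comp (RatFunc.X⁻¹ : RatFunc K) RatFunc.X⁻¹ = RatFunc.X := by
  rw [comp_inv degree_X_inv_pos, comp_X, inv_inv]

theorem map_X_inv_X_inv (x : P1 K) : map RatFunc.X⁻¹ (map RatFunc.X⁻¹ x) = x := by
  rw [← map_comp degree_X_inv_pos degree_X_inv_pos, comp_X_inv_X_inv, map_X]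

theorem map_X_inv_val_X (x : P1 K) : (map RatFunc.X⁻¹ x).val RatFunc.X = (x.val RatFunc.X)⁻¹ := by
  rw [map_val degree_X_inv_pos, comp_X, val_inv x RatFunc.X_ne_zero]

/-- Where z is finite, polynomials split into linear factors. Where z = ∞, pass to the coordinate 1
/ z, whose value 0 fixes all distances to constants. -/
theorem ext_absSub [IsAlgClosed K] {x y : P1 K} (h : ∀ a, x.absSub a = y.absSub a) : x = y := by
  have fin : ∀ {x y : P1 K}, (∀ a, x.absSub a = y.absSub a) → x.val RatFunc.X ≠ ⊤ → x = y := by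
    intro x y h hx
    have hy : y.val RatFunc.X ≠ ⊤ := by rwa [← absSub_zero, ← h, absSub_zero]
    rw [← ofA1_toA1 x hx, ← ofA1_toA1 y hy]
    congr 1
    apply A1.ext_linear
    intro a
    rw [← ENNReal.coe_inj, coe_toA1_val, coe_toA1_val, map_sub, RatFunc.algebraMap_X,
      RatFunc.algebraMap_C]
    exact h a
  by_cases hx : x.val RatFunc.X = ⊤
  · have hy : y.val RatFunc.X = ⊤ := by rwa [← absSub_zero, ← h, absSub_zero]
    have key : ∀ x : P1 K, x.val RatFunc.X = ⊤ → (map RatFunc.X⁻¹ x).val RatFunc.X = 0 :=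
      fun x hx => by rw [map_X_inv_val_X, hx, ENNReal.inv_top]
    have h2 : ∀ (x : P1 K), x.val RatFunc.X = 0 → ∀ a, x.absSub a = ‖a‖ₑ := by
      intro x hx a
      by_cases ha : a = 0
      · rw [ha, absSub_zero, hx, enorm_zero]
      · rw [x.absSub_eq_of_gt (a := 0), zero_sub, enorm_neg]
        rw [absSub_zero, hx, zero_sub, enorm_neg]
        exact enorm_pos.mpr ha
    rw [← map_X_inv_X_inv x, ← map_X_inv_X_inv y]
    congr 1
    apply fin
    · intro a
      rw [h2 _ (key x hx), h2 _ (key y hy)]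
    · rw [key x hx]; exact ENNReal.zero_ne_top
  · exact fin h hx

section Ultrametric

variable [IsUltrametricDist K]

theorem classical_coe_absSub (a b : K) :
    (classical (a : OnePoint K)).absSub b = ‖a - b‖ₑ := by
  change (ofA1 (affPoint a)).absSub b = _
  rw [ofA1_absSub, affPoint, enorm_eq_nnnorm]
  simp

theorem classical_infty_absSub (b : K) :
    (classical (OnePoint.infty : OnePoint K)).absSub b = ⊤ := by
  rw [absSub_eq_top_iff _ b 0, absSub_zero]
  change (map RatFunc.X⁻¹ (ofA1 (affPoint (0 : K)))).val RatFunc.X = ⊤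
  rw [map_X_inv_val_X, ← absSub_zero]
  have := classical_coe_absSub (0 : K) 0
  rw [sub_self, enorm_zero] at this
  rw [ENNReal.inv_eq_top]
  exact this

theorem injective_classical : Function.Injective (classical : OnePoint K → P1 K) := by
  intro a b hab
  have h := fun c => congrArg (fun x => P1.absSub x c) hab
  induction a using OnePoint.rec with
  | infty =>
    induction b using OnePoint.rec with
    | infty => rfl
    | coe b =>
      have := h 0
      simp only [classical_infty_absSub, classical_coe_absSub] at this
      exact absurd this.symm enorm_ne_top
  | coe a =>
    induction b using OnePoint.rec with
    | infty =>
      have := h 0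
      simp only [classical_infty_absSub, classical_coe_absSub] at this
      exact absurd this enorm_ne_top
    | coe b =>
      have := h b
      simp only [classical_coe_absSub, sub_self, enorm_zero] at this
      rw [enorm_eq_zero, sub_eq_zero] at this
      rw [this]

theorem eq_classical_infty [IsAlgClosed K] {x : P1 K} {a : K} (h : x.absSub a = ⊤) :
    x = classical (OnePoint.infty : OnePoint K) :=
  ext_absSub fun b => by rw [classical_infty_absSub, absSub_eq_top_iff x b a, h]

theorem eq_classical_coe [IsAlgClosed K] {x : P1 K} {a : K} (h : x.absSub a = 0) :
    x = classical (a : OnePoint K) := by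
  apply ext_absSub
  intro b
  rw [classical_coe_absSub]
  by_cases hb : a = b
  · rw [← hb, h, sub_self, enorm_zero]
  · exact x.absSub_eq_of_gt (by rw [h]; exact enorm_pos.mpr (sub_ne_zero.mpr hb))

theorem map_ofA1_affPoint [IsAlgClosed K] {h : RatFunc K} (hd : 0 < degree h) (a : K) :
    map h (ofA1 (affPoint a)) = classical (evalFin h a) := by
  have key : ∀ c, (map h (ofA1 (affPoint a))).absSub c =
      (‖(h.num - Polynomial.C c * h.denom).eval a‖₊ : ℝ≥0∞) / (‖h.denom.eval a‖₊ : ℝ≥0∞) := by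
    intro c
    rw [map_absSub hd]
    have e : h - RatFunc.C c =
        algebraMap K[X] (RatFunc K) (h.num - Polynomial.C c * h.denom) /
          algebraMap K[X] (RatFunc K) h.denom := by
      conv_lhs => rw [← RatFunc.num_div_denom h]
      have := RatFunc.algebraMap_ne_zero h.denom_ne_zero
      rw [map_sub, map_mul, RatFunc.algebraMap_C]
      field_simp
    rw [e]
    refine (affPoint a).ratVal_div _ _ h.denom_ne_zero ?_
    rintro ⟨h1, h2⟩
    have h2' : h.denom.eval a = 0 := by simpa [affPoint] using h2
    have h1' : (h.num - Polynomial.C c * h.denom).eval a = 0 := nnnorm_eq_zero.mp h1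
    rw [Polynomial.eval_sub, Polynomial.eval_mul, h2', mul_zero, sub_zero] at h1'
    exact not_both_root h a ⟨h1', h2'⟩
  by_cases h0 : h.denom.eval a = 0
  · have : evalFin h a = (OnePoint.infty : OnePoint K) := by simp [evalFin, h0]
    rw [this]
    apply eq_classical_infty (a := 0)
    rw [key, h0, nnnorm_zero, ENNReal.coe_zero, ENNReal.div_zero]
    rw [Polynomial.eval_sub, Polynomial.eval_mul, h0, mul_zero, sub_zero]
    have := fun h1 => not_both_root h a ⟨h1, h0⟩
    simpa using this
  · have : evalFin h a = ((h.num.eval a / h.denom.eval a : K) : OnePoint K) := by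
      simp [evalFin, h0]
    rw [this]
    apply eq_classical_coe
    rw [key]
    simp [h0]

theorem map_classical [IsAlgClosed K] {h : RatFunc K} (hd : 0 < degree h) (a : OnePoint K) :
    map h (classical a) = classical (eval h a) := by
  induction a using OnePoint.rec with
  | infty =>
    change map h (map RatFunc.X⁻¹ (ofA1 (affPoint 0))) = classical (evalFin (comp h RatFunc.X⁻¹) 0)
    rw [← map_comp hd degree_X_inv_pos, map_ofA1_affPoint (degree_comp_pos hd degree_X_inv_pos)]
  | coe a => exact map_ofA1_affPoint hd a

end Ultrametric

end P1

end Berk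

/-! ### Density of classical points and local connectedness -/

namespace Berk

open RatMap

variable {K : Type*} [NontriviallyNormedField K]

/-- The absolute values of an algebraically closed valued field are dense. -/
theorem exists_enorm_between [IsAlgClosed K] {u v : ℝ≥0∞} (huv : u < v) :
    ∃ e : K, u < ‖e‖ₑ ∧ ‖e‖ₑ < v := by
  obtain ⟨v', hv1, hv2⟩ := ENNReal.lt_iff_exists_nnreal_btwn.mp huv
  obtain ⟨u', hu1, hu2⟩ := ENNReal.lt_iff_exists_nnreal_btwn.mp hv1
  have h12 : u' < v' := by exact_mod_cast hu2
  have hupos : ∃ w : ℝ≥0, 0 < w ∧ u' ≤ w ∧ w < v' := by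
    obtain ⟨w, hw1, hw2⟩ := exists_between h12
    exact ⟨w, (zero_le).trans_lt hw1, hw1.le, hw2⟩
  obtain ⟨w, hw0, hw1, hw2⟩ := hupos
  obtain ⟨c, hc⟩ := NormedField.exists_one_lt_norm K
  have hr : (1 : ℝ) < (v' : ℝ) / w := by
    rw [one_lt_div (by exact_mod_cast hw0)]; exact_mod_cast hw2
  obtain ⟨n, hn⟩ := pow_unbounded_of_one_lt ‖c‖ hr
  have hn0 : 0 < n := by
    rcases Nat.eq_zero_or_pos n with h | h
    · rw [h, pow_zero] at hn; exact absurd hn (not_lt.mpr hc.le)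
    · exact h
  -- The root satisfies 1 < ‖b‖ < v' / w, so the powers of ‖b‖ cannot jump over the interval (w,
  -- v').
  obtain ⟨b, hb⟩ := IsAlgClosed.exists_pow_nat_eq c hn0
  have hb' : ‖b‖ ^ n = ‖c‖ := by rw [← norm_pow, hb]
  have hb1 : 1 < ‖b‖ := by
    by_contra! H
    have := pow_le_one₀ (n := n) (norm_nonneg b) H
    rw [hb'] at this
    exact absurd hc (not_lt.mpr this)
  have hb2 : ‖b‖ < (v' : ℝ) / w := by
    rw [← hb'] at hn
    exact lt_of_pow_lt_pow_left₀ n (by positivity) hn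
  obtain ⟨m, hm1, hm2⟩ := exists_mem_Ico_zpow (show (0 : ℝ) < w by exact_mod_cast hw0) hb1
  refine ⟨b ^ (m + 1), ?_, ?_⟩
  · refine hu1.trans_le ?_
    rw [enorm_eq_nnnorm, ENNReal.coe_le_coe, ← NNReal.coe_le_coe, coe_nnnorm, norm_zpow]
    exact (show (u' : ℝ) ≤ w by exact_mod_cast hw1).trans hm2.le
  · refine lt_of_lt_of_le ?_ hv2.le
    rw [enorm_eq_nnnorm, ENNReal.coe_lt_coe, ← NNReal.coe_lt_coe, coe_nnnorm, norm_zpow,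
      zpow_add_one₀ (by positivity)]
    calc ‖b‖ ^ m * ‖b‖ ≤ w * ‖b‖ := by gcongr
      _ < w * ((v' : ℝ) / w) := by
        have : (0 : ℝ) < w := by exact_mod_cast hw0
        gcongr
      _ = v' := by
        have : (w : ℝ) ≠ 0 := by exact_mod_cast hw0.ne'
        field_simp

namespace P1

theorem enorm_sub_le (x : P1 K) (a b : K) : ‖a - b‖ₑ ≤ max (x.absSub a) (x.absSub b) := by
  by_contra! H
  have h := x.absSub_eq_of_gt (lt_of_le_of_lt (le_max_left _ _) H)
  exact absurd (lt_of_le_of_lt (le_max_right _ _) H) (by rw [h]; exact lt_irrefl _)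

/-- A continuous injection from a compact space to a Hausdorff one is an embedding. Open discs |z -
a| < r and the sets |z - a| > r therefore form a subbasis. -/
theorem isInducing_absSub [IsAlgClosed K] :
    IsInducing (fun (x : P1 K) (a : K) => x.absSub a) := by
  refine (Continuous.isClosedEmbedding ?_ ?_).isInducing
  · exact continuous_pi fun a => continuous_absSub a
  · exact fun x y h => ext_absSub fun a => congrFun h a

variable (K) in
/-- The sets `{|z - a| < r}` and `{|z - a| > r}`. -/
def subbasis : Set (Set (P1 K)) :=
  ⋃ a : K, preimage (fun x : P1 K => x.absSub a) '' {s | ∃ r, s = Ioi r ∨ s = Iio r}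

theorem eq_generateFrom_subbasis [IsAlgClosed K] :
    (inferInstance : TopologicalSpace (P1 K)) = TopologicalSpace.generateFrom (subbasis K) := by
  rw [(isInducing_absSub (K := K)).eq_induced, subbasis, generateFrom_iUnion,
    Pi.topologicalSpace, induced_iInf]
  refine iInf_congr fun a => ?_
  rw [induced_compose, OrderTopology.topology_eq_generate_intervals (α := ℝ≥0∞)]
  exact induced_generateFrom_eq

theorem mem_subbasis_gt (a : K) (r : ℝ≥0∞) : {x : P1 K | r < x.absSub a} ∈ subbasis K :=
  mem_iUnion.mpr ⟨a, _, ⟨r, Or.inl rfl⟩, rfl⟩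

theorem mem_subbasis_lt (a : K) (r : ℝ≥0∞) : {x : P1 K | x.absSub a < r} ∈ subbasis K :=
  mem_iUnion.mpr ⟨a, _, ⟨r, Or.inr rfl⟩, rfl⟩

/-- The last clause puts in `I` every `w` between `u` and `max u v`, the form of convexity needed in
`disc_mem_sInter`. -/
theorem exists_of_mem_subbasis {s : Set (P1 K)} (hs : s ∈ subbasis K) :
    ∃ a : K, ∃ I : Set ℝ≥0∞, IsOpen I ∧ I.OrdConnected ∧ (∀ x, x ∈ s ↔ x.absSub a ∈ I) ∧
      ∀ u v w, u ∈ I → v ∈ I → u ≤ w → (w ≤ u ∨ w ≤ v) → w ∈ I := by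
  obtain ⟨a, I, ⟨r, rfl | rfl⟩, rfl⟩ := mem_iUnion.mp hs
  · refine ⟨a, Ioi r, isOpen_Ioi, ordConnected_Ioi, fun x => Iff.rfl, ?_⟩
    intro u v w hu hv h1 h2
    exact lt_of_lt_of_le hu h1
  · refine ⟨a, Iio r, isOpen_Iio, ordConnected_Iio, fun x => Iff.rfl, ?_⟩
    rintro u v w hu hv h1 (h2 | h2)
    · exact lt_of_le_of_lt h2 hu
    · exact lt_of_le_of_lt h2 hv

variable [IsUltrametricDist K]

theorem enorm_sub_le_max (a b c : K) : ‖a - c‖ₑ ≤ max ‖a - b‖ₑ ‖b - c‖ₑ := by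
  have := (classical (a : OnePoint K)).absSub_le b c
  rwa [classical_coe_absSub, classical_coe_absSub] at this

/-- Let a₁ be the centre nearest to x among those of the finitely many conditions, and ρ = |x - a₁|.
Then |x - a| = max(ρ, |a₁ - a|) for each centre a. A classical point at distance t from a₁, with t
slightly below ρ and different from every |a₁ - a|, satisfies the same formula with t for ρ, hence
the same open conditions. -/
theorem exists_classical_mem [IsAlgClosed K] {f : Set (Set (P1 K))} (hf : f.Finite)
    (hfs : f ⊆ subbasis K) {x : P1 K} (hx : x ∈ ⋂₀ f) :
    ∃ c : K, classical (c : OnePoint K) ∈ ⋂₀ f := by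
  classical
  have H := fun s (hs : s ∈ f) => exists_of_mem_subbasis (hfs hs)
  choose! ctr I hI _ hmem _ using H
  set A : Finset K := hf.toFinset.image ctr with hA
  have hA' : ∀ s ∈ f, ctr s ∈ A := fun s hs =>
    Finset.mem_image_of_mem _ (hf.mem_toFinset.mpr hs)
  rcases A.eq_empty_or_nonempty with h0 | hne
  · refine ⟨0, fun s hs => ?_⟩
    have := hA' s hs
    rw [h0] at this
    simp at this
  obtain ⟨a₁, ha₁, hmin⟩ := A.exists_min_image (fun a => x.absSub a) hne
  set ρ := x.absSub a₁ with hρ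
  rcases eq_zero_or_pos ρ with h0 | hpos
  · exact ⟨a₁, by rw [← eq_classical_coe h0]; exact hx⟩
  have hval : ∀ a ∈ A, x.absSub a = max ρ ‖a₁ - a‖ₑ := by
    intro a ha
    apply le_antisymm (x.absSub_le a₁ a)
    refine max_le (hmin a ha) ((x.enorm_sub_le a₁ a).trans (max_le (hmin a ha) le_rfl))
  have ev : ∀ᶠ t in 𝓝[<] ρ, ∀ s ∈ f, max t ‖a₁ - ctr s‖ₑ ∈ I s ∧ t ≠ ‖a₁ - ctr s‖ₑ := by
    rw [hf.eventually_all]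
    intro s hs
    refine Eventually.and ?_ ?_
    · have hc : Tendsto (fun t => max t ‖a₁ - ctr s‖ₑ) (𝓝[<] ρ) (𝓝 (max ρ ‖a₁ - ctr s‖ₑ)) :=
        ((continuous_id.max continuous_const).tendsto ρ).mono_left nhdsWithin_le_nhds
      apply hc
      apply (hI s hs).mem_nhds
      rw [← hval _ (hA' s hs), ← hmem s hs]
      exact hx s hs
    · rcases lt_or_ge ‖a₁ - ctr s‖ₑ ρ with h | h
      · filter_upwards [Ioo_mem_nhdsLT h] with t ht using ht.1.ne'
      · filter_upwards [self_mem_nhdsWithin] with t ht using (lt_of_lt_of_le ht h).ne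
  obtain ⟨l, hl, hlI⟩ := (mem_nhdsLT_iff_exists_Ioo_subset' hpos).mp ev
  obtain ⟨e, he1, he2⟩ := exists_enorm_between (K := K) hl
  refine ⟨a₁ + e, fun s hs => ?_⟩
  obtain ⟨h1, h2⟩ := hlI ⟨he1, he2⟩ s hs
  rw [hmem s hs]
  have h3 : (classical ((a₁ + e : K) : OnePoint K)).absSub a₁ = ‖e‖ₑ := by
    rw [classical_coe_absSub, add_sub_cancel_left]
  rcases lt_or_gt_of_ne h2 with h | h
  · rw [absSub_eq_of_gt _ (a := a₁) (by rw [h3]; exact h)]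
    rwa [max_eq_right h.le] at h1
  · rw [absSub_eq_of_lt _ (a := a₁) (by rw [h3]; exact h), h3]
    rwa [max_eq_left h.le] at h1

variable (K) in
omit [IsUltrametricDist K] in
theorem isTopologicalBasis [IsAlgClosed K] : TopologicalSpace.IsTopologicalBasis
    ((fun f => ⋂₀ f) '' {f : Set (Set (P1 K)) | f.Finite ∧ f ⊆ subbasis K}) :=
  TopologicalSpace.isTopologicalBasis_of_subbasis eq_generateFrom_subbasis

theorem exists_classical_mem_of_isOpen [IsAlgClosed K] {U : Set (P1 K)} (hU : IsOpen U)
    (hne : U.Nonempty) : ∃ c : K, classical (c : OnePoint K) ∈ U := by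
  obtain ⟨x, hx⟩ := hne
  obtain ⟨_, ⟨f, ⟨hf, hfs⟩, rfl⟩, hxf, hfU⟩ := (isTopologicalBasis K).exists_subset_of_mem_open hx hU
  obtain ⟨c, hc⟩ := exists_classical_mem hf hfs hxf
  exact ⟨c, hfU hc⟩

variable (K) in
theorem denseRange_classical [IsAlgClosed K] : DenseRange (classical : OnePoint K → P1 K) := by
  rw [DenseRange, dense_iff_inter_open]
  intro U hU hne
  obtain ⟨c, hc⟩ := exists_classical_mem_of_isOpen hU hne
  exact ⟨_, hc, mem_range_self _⟩

/-- The Gauss norm on the disc with centre `c` and radius `t`. -/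
def discA1 (c : K) (t : ℝ≥0) (ht : 0 < t) : A1 K where
  val p := ⟨(Polynomial.taylor c p).gaussNorm (NormedField.toAbsoluteValue K) t,
    Polynomial.gaussNorm_nonneg _ _ t.coe_nonneg⟩
  val_C a := by
    apply NNReal.eq
    rw [Polynomial.taylor_C]
    exact Polynomial.gaussNorm_C (NormedField.toAbsoluteValue K) _ a
  val_add_le p q := by
    rw [map_add]
    exact Polynomial.isNonarchimedean_gaussNorm (NormedField.toAbsoluteValue K)
      (IsUltrametricDist.isNonarchimedean_norm) t.coe_nonneg _ _
  val_mul p q := by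
    apply NNReal.eq
    rw [Polynomial.taylor_mul]
    exact Polynomial.gaussNorm_mul (v := NormedField.toAbsoluteValue K)
      (IsUltrametricDist.isNonarchimedean_norm) (by exact_mod_cast ht) _ _

theorem gaussNorm_X_add_C (b : K) (t : ℝ≥0) :
    (Polynomial.X + Polynomial.C b).gaussNorm (NormedField.toAbsoluteValue K) t
      = max (t : ℝ) ‖b‖ := by
  apply le_antisymm
  · have := Polynomial.isNonarchimedean_gaussNorm (NormedField.toAbsoluteValue K)
      (IsUltrametricDist.isNonarchimedean_norm) t.coe_nonneg Polynomial.X (Polynomial.C b)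
    refine this.trans (max_le_max ?_ ?_)
    · rw [← Polynomial.monomial_one_one_eq_X, Polynomial.gaussNorm_monomial]
      simp
    · rw [Polynomial.gaussNorm_C]; rfl
  · refine max_le ?_ ?_
    · have := Polynomial.le_gaussNorm (NormedField.toAbsoluteValue K) (Polynomial.X + Polynomial.C b)
        t.coe_nonneg 1
      simpa using this
    · have := Polynomial.le_gaussNorm (NormedField.toAbsoluteValue K) (Polynomial.X + Polynomial.C b)
        t.coe_nonneg 0
      rw [pow_zero, mul_one, Polynomial.coeff_add, Polynomial.coeff_X_zero, zero_add,
        Polynomial.coeff_C_zero] at this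
      exact this

/-- The supremum point of the closed disc with centre `c` and radius `t`. -/
def disc (c : K) (t : ℝ≥0) : P1 K :=
  if ht : 0 < t then ofA1 (discA1 c t ht) else classical (c : OnePoint K)

theorem disc_absSub (c : K) (t : ℝ≥0) (a : K) : (disc c t).absSub a = max (t : ℝ≥0∞) ‖c - a‖ₑ := by
  by_cases ht : 0 < t
  · rw [disc, dif_pos ht, ofA1_absSub, enorm_eq_nnnorm, ← ENNReal.coe_max, ENNReal.coe_inj]
    apply NNReal.eq
    rw [NNReal.coe_max, coe_nnnorm, ← gaussNorm_X_add_C]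
    change (Polynomial.taylor c _).gaussNorm _ _ = _
    congr 1
    rw [map_sub, Polynomial.taylor_X, Polynomial.taylor_C, map_sub]
    ring
  · rw [disc, dif_neg ht, classical_coe_absSub]
    have : t = 0 := by simpa using ht
    rw [this]; simp

theorem disc_zero (c : K) : disc c 0 = classical (c : OnePoint K) := by simp [disc]

theorem disc_eq_disc [IsAlgClosed K] {c c' : K} {t : ℝ≥0} (h : ‖c - c'‖ₑ ≤ t) :
    disc c t = disc c' t := by
  apply ext_absSub
  intro a
  rw [disc_absSub, disc_absSub]
  apply le_antisymm
  · refine max_le (le_max_left _ _) ((enorm_sub_le_max c c' a).trans ?_)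
    exact max_le_max h le_rfl
  · refine max_le (le_max_left _ _) ((enorm_sub_le_max c' c a).trans ?_)
    refine max_le_max ?_ le_rfl
    rwa [← enorm_neg, neg_sub]

theorem continuous_disc [IsAlgClosed K] (c : K) : Continuous (disc c) := by
  rw [isInducing_absSub.continuous_iff, continuous_pi_iff]
  intro a
  have : Continuous fun t : ℝ≥0 => max (t : ℝ≥0∞) ‖c - a‖ₑ :=
    ENNReal.continuous_coe.max continuous_const
  exact this.congr fun t => (disc_absSub c t a).symm

theorem disc_mem_sInter {f : Set (Set (P1 K))} (hfs : f ⊆ subbasis K) {c c' : K}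
    (hc : classical (c : OnePoint K) ∈ ⋂₀ f) (hc' : classical (c' : OnePoint K) ∈ ⋂₀ f)
    {t : ℝ≥0} (ht : (t : ℝ≥0∞) ≤ ‖c - c'‖ₑ) : disc c t ∈ ⋂₀ f := by
  intro s hs
  obtain ⟨a, I, _, _, hmem, hI⟩ := exists_of_mem_subbasis (hfs hs)
  rw [hmem, disc_absSub]
  have h1 := (hmem _).mp (hc s hs)
  have h2 := (hmem _).mp (hc' s hs)
  rw [classical_coe_absSub] at h1 h2
  refine hI _ _ _ h1 h2 (le_max_right _ _) ?_
  have h3 := enorm_sub_le_max c a c'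
  have h4 : ‖a - c'‖ₑ = ‖c' - a‖ₑ := by rw [← enorm_neg, neg_sub]
  rw [h4] at h3
  rcases le_max_iff.mp (ht.trans h3) with h | h
  · exact Or.inl (max_le h le_rfl)
  · rcases le_total ‖c - a‖ₑ ‖c' - a‖ₑ with h5 | h5
    · exact Or.inr (max_le h h5)
    · exact Or.inl (max_le (h.trans h5) le_rfl)

/-- Two classical points c, c' of the set are joined inside it by growing discs about each until
both reach radius |c - c'|, where they coincide. These segments form a connected set Z containing
the classical points with finite coordinate in the set, so Z is dense in it, and adding limit points
preserves connectedness. -/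
theorem isPreconnected_sInter [IsAlgClosed K] {f : Set (Set (P1 K))} (hf : f.Finite)
    (hfs : f ⊆ subbasis K) : IsPreconnected (⋂₀ f) := by
  set Z : Set (P1 K) := {x | x ∈ ⋂₀ f ∧ ∃ c : K, classical (c : OnePoint K) ∈ ⋂₀ f ∧ ∃ c' : K,
    classical (c' : OnePoint K) ∈ ⋂₀ f ∧ ∃ t : ℝ≥0, (t : ℝ≥0∞) ≤ ‖c - c'‖ₑ ∧ x = disc c t} with hZ
  have seg : ∀ c c' : K, classical (c : OnePoint K) ∈ ⋂₀ f → classical (c' : OnePoint K) ∈ ⋂₀ f →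
      disc c '' (Icc 0 ‖c - c'‖₊) ⊆ Z := by
    rintro c c' hc hc' _ ⟨t, ht, rfl⟩
    have ht' : (t : ℝ≥0∞) ≤ ‖c - c'‖ₑ := by
      rw [enorm_eq_nnnorm]; exact_mod_cast ht.2
    exact ⟨disc_mem_sInter hfs hc hc' ht', c, hc, c', hc', t, ht', rfl⟩
  have segc : ∀ (c : K) (t : ℝ≥0), IsPreconnected (disc c '' (Icc 0 t)) := fun c t =>
    isPreconnected_Icc.image _ (continuous_disc c).continuousOn
  have join : ∀ c c' : K, classical (c : OnePoint K) ∈ ⋂₀ f → classical (c' : OnePoint K) ∈ ⋂₀ f →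
      ∃ T ⊆ Z, classical (c : OnePoint K) ∈ T ∧ classical (c' : OnePoint K) ∈ T ∧
        IsPreconnected T := by
    intro c c' hc hc'
    refine ⟨disc c '' (Icc 0 ‖c - c'‖₊) ∪ disc c' '' (Icc 0 ‖c' - c‖₊),
      union_subset (seg c c' hc hc') (seg c' c hc' hc), Or.inl ⟨0, ⟨le_rfl, zero_le⟩, disc_zero c⟩,
      Or.inr ⟨0, ⟨le_rfl, zero_le⟩, disc_zero c'⟩, ?_⟩
    refine IsPreconnected.union (disc c ‖c - c'‖₊) ⟨_, ⟨zero_le, le_rfl⟩, rfl⟩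
      ⟨_, ⟨zero_le, le_rfl⟩, ?_⟩ (segc _ _) (segc _ _)
    rw [← nnnorm_neg (c' - c), neg_sub]
    exact (disc_eq_disc (by rw [enorm_eq_nnnorm])).symm
  have toC : ∀ x ∈ Z, ∃ c : K, classical (c : OnePoint K) ∈ ⋂₀ f ∧
      ∃ T ⊆ Z, x ∈ T ∧ classical (c : OnePoint K) ∈ T ∧ IsPreconnected T := by
    rintro x ⟨_, c, hc, c', hc', t, ht, rfl⟩
    refine ⟨c, hc, _, seg c c' hc hc', ⟨t, ⟨zero_le, ?_⟩, rfl⟩,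
      ⟨0, ⟨le_rfl, zero_le⟩, disc_zero c⟩, segc _ _⟩
    rw [enorm_eq_nnnorm] at ht
    exact_mod_cast ht
  have hZc : IsPreconnected Z := by
    apply isPreconnected_of_forall_pair
    intro x hx y hy
    obtain ⟨c, hc, T, hT, hxT, hcT, hTc⟩ := toC x hx
    obtain ⟨c', hc', T', hT', hyT', hcT', hTc'⟩ := toC y hy
    obtain ⟨S, hS, hcS, hcS', hSc⟩ := join c c' hc hc'
    refine ⟨T ∪ S ∪ T', union_subset (union_subset hT hS) hT', Or.inl (Or.inl hxT), Or.inr hyT', ?_⟩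
    exact (hTc.union _ hcT hcS hSc).union _ (Or.inr hcS') hcT' hTc'
  refine hZc.subset_closure (fun x hx => hx.1) fun x hx => ?_
  rw [(isTopologicalBasis K).mem_closure_iff]
  rintro _ ⟨g, ⟨hg, hgs⟩, rfl⟩ hxg
  obtain ⟨c, hc⟩ := exists_classical_mem (hf.union hg) (union_subset hfs hgs) (x := x) (by
    rw [sInter_union]; exact ⟨hx, hxg⟩)
  rw [sInter_union] at hc
  exact ⟨_, hc.2, hc.1, c, hc.1, c, hc.1, 0, by simp, (disc_zero c).symm⟩

instance [IsAlgClosed K] : LocallyConnectedSpace (P1 K) := by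
  refine locallyConnectedSpace_of_connected_bases (fun _ s => s)
    (fun x s => s ∈ ((fun f => ⋂₀ f) '' {f : Set (Set (P1 K)) | f.Finite ∧ f ⊆ subbasis K}) ∧ x ∈ s)
    (fun x => (isTopologicalBasis K).nhds_hasBasis) ?_
  rintro x _ ⟨⟨f, ⟨hf, hfs⟩, rfl⟩, _⟩
  exact isPreconnected_sInter hf hfs

instance [IsAlgClosed K] : PreconnectedSpace (P1 K) := by
  refine ⟨?_⟩
  have := isPreconnected_sInter (K := K) finite_empty (empty_subset _)
  rwa [sInter_empty] at this

theorem isPreconnected_absSub_lt [IsAlgClosed K] (a : K) (r : ℝ≥0∞) :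
    IsPreconnected {x : P1 K | x.absSub a < r} := by
  have := isPreconnected_sInter (finite_singleton _)
    (singleton_subset_iff.mpr (mem_subbasis_lt a r))
  rwa [sInter_singleton] at this

theorem isPreconnected_lt_absSub [IsAlgClosed K] (a : K) (r : ℝ≥0∞) :
    IsPreconnected {x : P1 K | r < x.absSub a} := by
  have := isPreconnected_sInter (finite_singleton _)
    (singleton_subset_iff.mpr (mem_subbasis_gt a r))
  rwa [sInter_singleton] at this

end P1

end Berk

/-! ### Normalized linear forms and the relation defining a fibre -/

namespace Berk

open RatMap

variable {K : Type*} [NontriviallyNormedField K]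

namespace P1

/-- The value at a point of the linear form with root `α / β`, in the coordinate `(z : 1)` at finite
points and `(1 : 0)` at infinity. -/
def lin (α β : K) (x : P1 K) : ℝ≥0 :=
  if x.val RatFunc.X = ⊤ then ‖β‖₊
  else (x.val (RatFunc.C α - RatFunc.C β * RatFunc.X)).toNNReal

/-- The normalizing factor for linear forms. -/
def weight (x : P1 K) : ℝ≥0 :=
  if x.val RatFunc.X = ⊤ then 1 else (max 1 (x.val RatFunc.X).toNNReal)⁻¹

/-- The value at a point of the linear form with root `α / β`, in normalized coordinates. -/
def nlin (α β : K) (x : P1 K) : ℝ≥0 :=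
  (min (x.val (RatFunc.C α - RatFunc.C β * RatFunc.X))
    (x.val (RatFunc.C α * RatFunc.X⁻¹ - RatFunc.C β))).toNNReal

theorem val_linear_ne_top (x : P1 K) (hx : x.val RatFunc.X ≠ ⊤) (α β : K) :
    x.val (RatFunc.C α - RatFunc.C β * RatFunc.X) ≠ ⊤ := by
  have := x.val_polynomial_ne_top hx (Polynomial.C α - Polynomial.C β * Polynomial.X)
  rwa [map_sub, map_mul, RatFunc.algebraMap_C, RatFunc.algebraMap_C, RatFunc.algebraMap_X] at this

theorem val_inv_linear_of_top (x : P1 K) (hx : x.val RatFunc.X = ⊤) (α β : K) :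
    x.val (RatFunc.C α * RatFunc.X⁻¹ - RatFunc.C β) = ‖β‖ₑ := by
  have h1 : x.val (RatFunc.C α * RatFunc.X⁻¹) = 0 := by
    by_cases hα : α = 0
    · rw [hα, map_zero, zero_mul, val_zero]
    · rw [val_C_mul x hα, val_inv x RatFunc.X_ne_zero, hx, ENNReal.inv_top, mul_zero]
  by_cases hβ : β = 0
  · rw [hβ, map_zero, sub_zero, h1, enorm_zero]
  · rw [sub_eq_add_neg, val_add_eq_right, val_neg, x.val_C]
    rw [h1, val_neg, x.val_C]
    exact enorm_pos.mpr hβ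

theorem nlin_ne_top (α β : K) (x : P1 K) :
    min (x.val (RatFunc.C α - RatFunc.C β * RatFunc.X))
    (x.val (RatFunc.C α * RatFunc.X⁻¹ - RatFunc.C β)) ≠ ⊤ := by
  by_cases hx : x.val RatFunc.X = ⊤
  · rw [val_inv_linear_of_top x hx]
    exact ((min_le_right _ _).trans_lt enorm_lt_top).ne
  · exact ((min_le_left _ _).trans_lt (val_linear_ne_top x hx α β).lt_top).ne

/-- The minimum of the values in the charts z and 1 / z is finite everywhere, including at infinity,
which is why `nlin` is used instead of the discontinuous `lin`. -/
theorem continuous_nlin (α β : K) : Continuous (nlin α β : P1 K → ℝ≥0) := by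
  rw [continuous_iff_continuousAt]
  intro x
  exact (ENNReal.tendsto_toNNReal (nlin_ne_top α β x)).comp
    ((continuous_val _).min (continuous_val _)).continuousAt

/-- The factor 1 / max(1, |z|) does not depend on the form, so normalization affects only the
proportionality constants in products of forms. -/
theorem nlin_eq (α β : K) (x : P1 K) : nlin α β x = weight x * lin α β x := by
  by_cases hx : x.val RatFunc.X = ⊤
  · rw [nlin, weight, lin, if_pos hx, if_pos hx, val_inv_linear_of_top x hx, one_mul,
      min_eq_right, enorm_eq_nnnorm, ENNReal.toNNReal_coe]
    by_cases hβ : β = 0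
    · rw [hβ, enorm_zero]; exact zero_le
    · have : x.val (RatFunc.C α) < x.val (-(RatFunc.C β * RatFunc.X)) := by
        rw [val_neg, val_C_mul x hβ, hx, x.val_C, ENNReal.mul_top (by simpa using hβ)]
        exact enorm_lt_top
      rw [sub_eq_add_neg, val_add_eq_right x this, val_neg, val_C_mul x hβ, hx,
        ENNReal.mul_top (by simpa using hβ)]
      exact le_top
  · rw [nlin, weight, lin, if_neg hx, if_neg hx]
    set u := RatFunc.C α - RatFunc.C β * RatFunc.X with hu
    have hutop : x.val u ≠ ⊤ := val_linear_ne_top x hx α β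
    have e : RatFunc.C α * RatFunc.X⁻¹ - RatFunc.C β = u * RatFunc.X⁻¹ := by
      rw [hu, sub_mul, mul_assoc, mul_inv_cancel₀ RatFunc.X_ne_zero, mul_one]
    by_cases h0 : x.val RatFunc.X = 0
    · rw [h0, ENNReal.toNNReal_zero, max_eq_left zero_le_one, inv_one, one_mul, min_eq_left]
      by_cases hv : x.val u = 0
      · rw [hv]; exact zero_le
      · rw [e, x.val_mul, val_inv x RatFunc.X_ne_zero, h0, ENNReal.inv_zero, ENNReal.mul_top hv]
        · exact le_top
        · exact fun H => hv H.1
        · exact fun H => hutop H.1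
    · have hv : x.val (u * RatFunc.X⁻¹) = x.val u * (x.val RatFunc.X)⁻¹ := by
        rw [x.val_mul, val_inv x RatFunc.X_ne_zero]
        · rw [val_inv x RatFunc.X_ne_zero, ENNReal.inv_eq_top]; exact fun H => h0 H.2
        · exact fun H => hutop H.1
      rw [e, hv]
      obtain ⟨v, hv'⟩ : ∃ v : ℝ≥0, (v : ℝ≥0∞) = x.val RatFunc.X := ⟨_, ENNReal.coe_toNNReal hx⟩
      obtain ⟨w, hw'⟩ : ∃ w : ℝ≥0, (w : ℝ≥0∞) = x.val u := ⟨_, ENNReal.coe_toNNReal hutop⟩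
      have hv0 : v ≠ 0 := by
        rintro rfl
        exact h0 (by rw [← hv', ENNReal.coe_zero])
      rw [← hv', ← hw']
      rw [← ENNReal.coe_inv hv0, ← ENNReal.coe_mul, ← ENNReal.coe_min, ENNReal.toNNReal_coe,
        ENNReal.toNNReal_coe, ENNReal.toNNReal_coe]
      rcases le_total v 1 with h | h
      · rw [max_eq_left h, inv_one, one_mul, min_eq_left]
        exact le_mul_of_one_le_right zero_le ((one_le_inv₀ (pos_iff_ne_zero.mpr hv0)).mpr h)
      · rw [max_eq_right h, min_eq_right, mul_comm]
        exact mul_le_of_le_one_right zero_le (inv_le_one_of_one_le₀ h)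

theorem weight_pos (x : P1 K) : 0 < weight x := by
  rw [weight]
  split_ifs
  · exact one_pos
  · exact inv_pos.mpr (lt_of_lt_of_le one_pos (le_max_left _ _))

theorem nlin_smul (c α β : K) (x : P1 K) : nlin (c * α) (c * β) x = ‖c‖₊ * nlin α β x := by
  rw [nlin_eq, nlin_eq, lin, lin]
  split_ifs with hx
  · rw [nnnorm_mul]; ring
  · by_cases hc : c = 0
    · simp [hc, val_zero]
    · have : RatFunc.C (c * α) - RatFunc.C (c * β) * RatFunc.X =
          RatFunc.C c * (RatFunc.C α - RatFunc.C β * RatFunc.X) := by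
        rw [map_mul, map_mul]; ring
      rw [this, val_C_mul x hc, ENNReal.toNNReal_mul, enorm_eq_nnnorm, ENNReal.toNNReal_coe]
      ring

theorem lin_one (a : K) (x : P1 K) (hx : x.val RatFunc.X ≠ ⊤) :
    lin a 1 x = (x.absSub a).toNNReal := by
  rw [lin, if_neg hx, map_one, one_mul, val_sub_comm]; rfl

theorem lin_one_of_top (a : K) (x : P1 K) (hx : x.val RatFunc.X = ⊤) : lin a 1 x = 1 := by
  rw [lin, if_pos hx, nnnorm_one]

theorem val_X_eq_top_iff (x : P1 K) (a : K) : x.val RatFunc.X = ⊤ ↔ x.absSub a = ⊤ := by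
  rw [← absSub_zero]; exact absSub_eq_top_iff x 0 a

theorem nlin_one_of_eq {a b : K} {x : P1 K} (h : x.absSub a = x.absSub b) :
    nlin a 1 x = nlin b 1 x := by
  rw [nlin_eq, nlin_eq]
  by_cases hx : x.val RatFunc.X = ⊤
  · rw [lin_one_of_top _ _ hx, lin_one_of_top _ _ hx]
  · rw [lin_one _ _ hx, lin_one _ _ hx, h]

theorem nlin_one_eq_zero_iff {a : K} {x : P1 K} : nlin a 1 x = 0 ↔ x.absSub a = 0 := by
  rw [nlin_eq, mul_eq_zero, or_iff_right (weight_pos x).ne']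
  by_cases hx : x.val RatFunc.X = ⊤
  · rw [lin_one_of_top _ _ hx, (val_X_eq_top_iff x a).mp hx]; simp
  · rw [lin_one _ _ hx, ENNReal.toNNReal_eq_zero_iff,
      or_iff_left ((val_X_eq_top_iff x a).not.mp hx)]

theorem finite_nlin_one_zero (x : P1 K) : {a : K | nlin a 1 x = 0}.Finite := by
  apply Set.Subsingleton.finite
  intro a ha b hb
  rw [mem_ofPred_eq, nlin_one_eq_zero_iff] at ha hb
  by_contra hne
  have := x.enorm_sub_le a b
  rw [ha, hb, max_self] at this
  exact hne (by simpa [sub_eq_zero] using this)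

/-- Eliminating z between the two forms leaves their determinant, a constant whose absolute value
must be 0. -/
theorem det_eq_zero_of_nlin {α β α' β' : K} {x : P1 K} (h : nlin α β x = 0)
    (h' : nlin α' β' x = 0) : α * β' - α' * β = 0 := by
  rw [nlin_eq, mul_eq_zero, or_iff_right (weight_pos x).ne', lin] at h h'
  by_cases hx : x.val RatFunc.X = ⊤
  · rw [if_pos hx, nnnorm_eq_zero] at h h'
    rw [h, h']; ring
  · rw [if_neg hx, ENNReal.toNNReal_eq_zero_iff, or_iff_left (val_linear_ne_top x hx _ _)] at h h'
    have hm : ∀ (c : K) (φ : RatFunc K), x.val φ = 0 → x.val (RatFunc.C c * φ) = 0 := by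
      intro c φ hφ
      by_cases hc : c = 0
      · rw [hc, map_zero, zero_mul, val_zero]
      · rw [val_C_mul x hc, hφ, mul_zero]
    have := x.val_add_le (RatFunc.C β' * (RatFunc.C α - RatFunc.C β * RatFunc.X))
      (RatFunc.C (-β) * (RatFunc.C α' - RatFunc.C β' * RatFunc.X))
    rw [hm _ _ h, hm _ _ h', max_self] at this
    have e : RatFunc.C β' * (RatFunc.C α - RatFunc.C β * RatFunc.X) +
        RatFunc.C (-β) * (RatFunc.C α' - RatFunc.C β' * RatFunc.X) =
        RatFunc.C (α * β' - α' * β) := by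
      simp only [map_sub, map_mul, map_neg]; ring
    rw [e, x.val_C] at this
    simpa using this

/-- The value at `y` of the linear form with root `h(a)`. -/
abbrev imageForm (h : RatFunc K) (a : K) (y : P1 K) : ℝ≥0 :=
  nlin (h.num.eval a) (h.denom.eval a) y

theorem finite_imageForm_zero {h : RatFunc K} (hd : 0 < degree h) (y : P1 K) :
    {a : K | imageForm h a y = 0}.Finite := by
  rcases Set.eq_empty_or_nonempty {a : K | imageForm h a y = 0} with h0 | ⟨a₀, ha₀⟩
  · rw [h0]; exact finite_empty
  -- The roots of q are the solutions of h(a) = h(a₀); any other zero a of the form satisfies this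
  -- by `det_eq_zero_of_nlin`.
  set q : K[X] := Polynomial.C (h.denom.eval a₀) * h.num - Polynomial.C (h.num.eval a₀) * h.denom
    with hq
  have hq0 : q ≠ 0 := by
    by_cases hQ : h.denom.eval a₀ = 0
    · have hP : h.num.eval a₀ ≠ 0 := fun hP => not_both_root h a₀ ⟨hP, hQ⟩
      rw [hq, hQ, map_zero, zero_mul, zero_sub, neg_ne_zero]
      exact mul_ne_zero (by simpa using hP) h.denom_ne_zero
    · have : q = Polynomial.C (h.denom.eval a₀) *
          fiberPoly h ((h.num.eval a₀ / h.denom.eval a₀ : K) : OnePoint K) := by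
        change q = Polynomial.C (h.denom.eval a₀) * (h.num - Polynomial.C _ * h.denom)
        rw [mul_sub, ← mul_assoc, ← Polynomial.C_mul, mul_div_cancel₀ _ hQ]
      rw [this]
      exact mul_ne_zero (by simpa using hQ) (fiberPoly_ne_zero hd _)
  refine (q.rootSet_finite K).subset fun a ha => ?_
  rw [Polynomial.mem_rootSet]
  refine ⟨hq0, ?_⟩
  have := det_eq_zero_of_nlin ha ha₀
  simp only [hq, map_sub, map_mul, Polynomial.aeval_C, Algebra.algebraMap_self, RingHom.id_apply,
    Polynomial.coe_aeval_eq_eval]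
  rw [mul_comm]
  exact this

/-- The relation between a point and its fibre under a rational function. -/
def FiberRel (h : RatFunc K) (y : P1 K) {ι : Type*} [Fintype ι] (M : ι → P1 K) : Prop :=
  ∀ a a' : K, (∏ i, nlin a 1 (M i)) * imageForm h a' y = (∏ i, nlin a' 1 (M i)) * imageForm h a y

/-- `FiberRel` is cross-multiplied proportionality, a form that survives limits. The positive
constant is recovered by evaluating at some a' outside the finite zero sets of both sides. -/
theorem fiberRel_iff {h : RatFunc K} (hd : 0 < degree h) {y : P1 K} {ι : Type*} [Fintype ι]
    {M : ι → P1 K} :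
    FiberRel h y M ↔ ∃ κ : ℝ≥0, 0 < κ ∧ ∀ a, ∏ i, nlin a 1 (M i) = κ * imageForm h a y := by
  constructor
  · intro H
    have hfin : ({a : K | imageForm h a y = 0} ∪ ⋃ i, {a : K | nlin a 1 (M i) = 0}).Finite :=
      (finite_imageForm_zero hd y).union (finite_iUnion fun i => finite_nlin_one_zero (M i))
    have : Infinite K := NontriviallyNormedField.infinite K
    obtain ⟨a', ha'⟩ := hfin.infinite_compl.nonempty
    rw [mem_compl_iff, mem_union, not_or, mem_iUnion, not_exists] at ha'
    have h1 : imageForm h a' y ≠ 0 := ha'.1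
    have h2 : ∏ i, nlin a' 1 (M i) ≠ 0 := Finset.prod_ne_zero_iff.mpr fun i _ => ha'.2 i
    refine ⟨(∏ i, nlin a' 1 (M i)) / imageForm h a' y, pos_iff_ne_zero.mpr (div_ne_zero h2 h1),
      fun a => ?_⟩
    rw [div_mul_eq_mul_div, eq_div_iff h1]
    exact H a a'
  · rintro ⟨κ, _, H⟩ a a'
    rw [H, H]; ring

end P1

end Berk

/-! ### Finite families of points are determined by their counts in discs -/

namespace Berk

open RatMap

variable {K : Type*} [NontriviallyNormedField K]

namespace P1

open Classical in
/-- The number of indices `i` for which `M i` lies in `s`. -/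
def countIn {ι X : Type*} [Fintype ι] (M : ι → X) (s : Set X) : ℕ :=
  (Finset.univ.filter fun i => M i ∈ s).card

section Count

variable {ι κ X : Type*} [Fintype ι] [Fintype κ]

theorem countIn_mono (M : ι → X) {s t : Set X} (h : s ⊆ t) : countIn M s ≤ countIn M t := by
  classical
  exact Finset.card_le_card fun i hi => by
    rw [Finset.mem_filter] at hi ⊢
    exact ⟨hi.1, h hi.2⟩

theorem countIn_add_compl (M : ι → X) (s : Set X) :
    countIn M s + countIn M sᶜ = Fintype.card ι := by
  classical
  rw [countIn, countIn]
  convert! Finset.card_filter_add_card_filter_not (s := Finset.univ) (fun i => M i ∈ s)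

open Classical in
theorem countIn_eq_sum (M : ι → X) (s : Set X) {U : Finset X} (hU : ∀ i, M i ∈ U) :
    countIn M s = ∑ x ∈ U.filter (· ∈ s), countIn M {x} := by
  rw [countIn, Finset.card_eq_sum_card_fiberwise (f := M) (t := U.filter (· ∈ s))]
  · refine Finset.sum_congr rfl fun x hx => ?_
    rw [countIn, Finset.filter_filter]
    congr 1
    ext i
    have := (Finset.mem_filter.mp hx).2
    simp only [Finset.mem_filter, mem_singleton_iff]
    constructor
    · rintro ⟨h1, h2, h3⟩; exact ⟨h1, h3⟩
    · rintro ⟨h1, rfl⟩; exact ⟨h1, this, rfl⟩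
  · intro i hi
    have := (Finset.mem_filter.mp (Finset.mem_coe.mp hi)).2
    exact Finset.mem_coe.mpr (Finset.mem_filter.mpr ⟨hU i, this⟩)

theorem countIn_congr {M : ι → X} {N : κ → X} (s : Set X)
    (h : ∀ x, countIn M {x} = countIn N {x}) : countIn M s = countIn N s := by
  classical
  set U := Finset.univ.image M ∪ Finset.univ.image N
  rw [countIn_eq_sum M s (U := U), countIn_eq_sum N s (U := U)]
  · exact Finset.sum_congr rfl fun x _ => h x
  · exact fun i => Finset.mem_union_right _ (Finset.mem_image_of_mem _ (Finset.mem_univ i))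
  · exact fun i => Finset.mem_union_left _ (Finset.mem_image_of_mem _ (Finset.mem_univ i))

theorem countIn_pos (M : ι → X) {s : Set X} : 0 < countIn M s ↔ ∃ i, M i ∈ s := by
  classical
  rw [countIn, Finset.card_pos]
  exact ⟨fun ⟨i, hi⟩ => ⟨i, (Finset.mem_filter.mp hi).2⟩,
    fun ⟨i, hi⟩ => ⟨i, Finset.mem_filter.mpr ⟨Finset.mem_univ i, hi⟩⟩⟩

/-- The number of points in a closed set is upper semicontinuous in the tuple; every limit argument
on fibres rests on this and on compactness. -/
theorem isClosed_le_countIn [TopologicalSpace X] {T : Set X} (hT : IsClosed T) (n : ℕ) :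
    IsClosed {M : ι → X | n ≤ countIn M T} := by
  classical
  have : {M : ι → X | n ≤ countIn M T} =
      ⋃ I ∈ {I : Finset ι | n ≤ I.card}, ⋂ i ∈ I, {M : ι → X | M i ∈ T} := by
    ext M
    simp only [mem_ofPred_eq, mem_iUnion, mem_iInter, exists_prop]
    constructor
    · intro h
      exact ⟨_, h, fun i hi => (Finset.mem_filter.mp hi).2⟩
    · rintro ⟨I, hI, h⟩
      exact hI.trans (Finset.card_le_card fun i hi =>
        Finset.mem_filter.mpr ⟨Finset.mem_univ i, h i hi⟩)
  rw [this]
  refine Set.Finite.isClosed_biUnion (Set.toFinite _) fun I _ => ?_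
  exact isClosed_biInter fun i _ => hT.preimage (continuous_apply i)

end Count

theorem eq_of_pow_eq {A B s t : ℝ≥0} (hA : 0 < A) (hB : 0 < B) (hs : 0 < s) (hst : s < t) {m n : ℕ}
    (h1 : A * s ^ m = B * s ^ n) (h2 : A * t ^ m = B * t ^ n) : m = n := by
  have aux : ∀ {A B : ℝ≥0}, 0 < A → 0 < B → ∀ {m n : ℕ}, A * s ^ m = B * s ^ n →
      A * t ^ m = B * t ^ n → ¬ m < n := by
    intro A B hA hB m n h1 h2 hmn
    obtain ⟨k, rfl⟩ := Nat.exists_eq_add_of_lt hmn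
    have ht : 0 < t := hs.trans hst
    have e1 : A = B * s ^ (k + 1) := by
      have : A * s ^ m = B * s ^ (k + 1) * s ^ m := by rw [h1]; ring
      exact mul_right_cancel₀ (pow_pos hs m).ne' this
    have e2 : A = B * t ^ (k + 1) := by
      have : A * t ^ m = B * t ^ (k + 1) * t ^ m := by rw [h2]; ring
      exact mul_right_cancel₀ (pow_pos ht m).ne' this
    have e3 : s ^ (k + 1) = t ^ (k + 1) := mul_left_cancel₀ hB.ne' (e1.symm.trans e2)
    exact absurd e3 (pow_lt_pow_left₀ hst zero_le (Nat.succ_ne_zero k)).ne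
  exact le_antisymm (not_lt.mp (aux hB hA h1.symm h2.symm)) (not_lt.mp (aux hA hB h1 h2))

/-- On an annulus ρ < |e| < r about a containing no point of M, a point inside contributes a
constant times |e| and a point outside a constant. The exponent of |e| is therefore the number of
points inside. -/
theorem prod_nlin_of_gap {ι : Type*} [Fintype ι] (M : ι → P1 K) {a : K} {r ρ : ℝ≥0∞} (hr : 0 < r)
    (hM : ∀ i, (M i).absSub a < r → (M i).absSub a ≤ ρ) :
    ∃ C : ℝ≥0, 0 < C ∧ ∀ e : K, ρ < ‖e‖ₑ → ‖e‖ₑ < r →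
      ∏ i, nlin (a + e) 1 (M i) = C * ‖e‖₊ ^ countIn M {x | x.absSub a < r} := by
  classical
  refine ⟨∏ i, if (M i).absSub a < r then weight (M i) else nlin a 1 (M i),
    Finset.prod_pos fun i _ => ?_, fun e he1 he2 => ?_⟩
  · split_ifs with h
    · exact weight_pos _
    · rw [pos_iff_ne_zero, Ne, nlin_one_eq_zero_iff]
      exact fun h' => h (by rw [h']; exact hr)
  · have hp : ‖e‖₊ ^ countIn M {x | x.absSub a < r} =
        ∏ i, if (M i).absSub a < r then ‖e‖₊ else 1 := by
      rw [Finset.prod_ite, Finset.prod_const, Finset.prod_const_one, mul_one, countIn]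
      congr!
    rw [hp, ← Finset.prod_mul_distrib]
    refine Finset.prod_congr rfl fun i _ => ?_
    split_ifs with hi
    · have h3 : (M i).absSub (a + e) = ‖e‖ₑ := by
        rw [(M i).absSub_eq_of_gt (a := a)]
        · rw [sub_add_cancel_left, enorm_neg]
        · rw [sub_add_cancel_left, enorm_neg]
          exact lt_of_le_of_lt (hM i hi) he1
      have hx : (M i).val RatFunc.X ≠ ⊤ := by
        rw [Ne, val_X_eq_top_iff _ (a + e), h3]; exact enorm_ne_top
      rw [nlin_eq, lin_one _ _ hx, h3, enorm_eq_nnnorm, ENNReal.toNNReal_coe]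
    · rw [mul_one]
      apply nlin_one_of_eq
      rw [(M i).absSub_eq_of_lt (a := a)]
      rw [sub_add_cancel_left, enorm_neg]
      exact lt_of_lt_of_le he2 (not_lt.mp hi)

/-- The number of points in a disc is determined by the products of the normalized linear forms. -/
theorem countIn_disc_eq [IsAlgClosed K] {ι κ : Type*} [Fintype ι] [Fintype κ] {M : ι → P1 K}
    {N : κ → P1 K} {E : Set K} (hE : E.Finite) {c c' : ℝ≥0} (hc : 0 < c) (hc' : 0 < c')
    (H : ∀ a, a ∉ E → c * ∏ i, nlin a 1 (M i) = c' * ∏ j, nlin a 1 (N j)) (a : K) (r : ℝ≥0∞) :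
    countIn M {x | x.absSub a < r} = countIn N {x | x.absSub a < r} := by
  classical
  rcases eq_zero_or_pos r with h0 | hr
  · simp [countIn, h0]
  -- ρ is the largest radius below r at which a point of M, of N or of the exceptional set E occurs.
  -- Two values of |e| in the free annulus determine the exponent.
  set V : Finset ℝ≥0∞ := (Finset.univ.image (fun i => (M i).absSub a) ∪
    Finset.univ.image (fun j => (N j).absSub a) ∪ hE.toFinset.image (fun e => ‖e - a‖ₑ)).filter
      (· < r) with hV
  set ρ := V.sup id with hρ
  have hρr : ρ < r := (Finset.sup_lt_iff hr).mpr fun v hv => (Finset.mem_filter.mp hv).2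
  have hle : ∀ v ∈ V, v ≤ ρ := fun v hv => Finset.le_sup (f := id) hv
  obtain ⟨e₁, h11, h12⟩ := exists_enorm_between (K := K) hρr
  obtain ⟨e₂, h21, h22⟩ := exists_enorm_between (K := K) h12
  obtain ⟨C, hC, hMC⟩ := prod_nlin_of_gap M hr fun i hi => hle _ (Finset.mem_filter.mpr
    ⟨Finset.mem_union_left _ (Finset.mem_union_left _
      (Finset.mem_image_of_mem _ (Finset.mem_univ i))), hi⟩)
  obtain ⟨C', hC', hNC⟩ := prod_nlin_of_gap N hr fun i hi => hle _ (Finset.mem_filter.mpr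
    ⟨Finset.mem_union_left _ (Finset.mem_union_right _
      (Finset.mem_image_of_mem (fun j => (N j).absSub a) (Finset.mem_univ i))), hi⟩)
  have hEe : ∀ e : K, ρ < ‖e‖ₑ → ‖e‖ₑ < r → a + e ∉ E := by
    intro e h1 h2 he
    refine absurd (hle ‖e‖ₑ (Finset.mem_filter.mpr ⟨Finset.mem_union_right _
      (Finset.mem_image.mpr ⟨a + e, hE.mem_toFinset.mpr he, ?_⟩), h2⟩)) (not_le.mpr h1)
    rw [add_sub_cancel_left]
  have key : ∀ e : K, ρ < ‖e‖ₑ → ‖e‖ₑ < r →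
      (c * C) * ‖e‖₊ ^ countIn M {x | x.absSub a < r} =
      (c' * C') * ‖e‖₊ ^ countIn N {x | x.absSub a < r} := by
    intro e h1 h2
    have := H (a + e) (hEe e h1 h2)
    rwa [hMC e h1 h2, hNC e h1 h2, ← mul_assoc, ← mul_assoc] at this
  have he : (0 : ℝ≥0) < ‖e₁‖₊ := by
    have : 0 < ‖e₁‖ₑ := lt_of_le_of_lt zero_le h11
    rwa [enorm_pos, ← nnnorm_pos] at this
  exact eq_of_pow_eq (mul_pos hc hC) (mul_pos hc' hC') he
    (by rwa [enorm_eq_nnnorm, enorm_eq_nnnorm, ENNReal.coe_lt_coe] at h21)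
    (key e₁ h11 h12) (key e₂ (h11.trans h21) h22)

/-- Finite families of points are determined by the number of points in every disc. -/
theorem countIn_singleton_eq [IsAlgClosed K] {ι κ : Type*} [Fintype ι] [Fintype κ] {M : ι → P1 K}
    {N : κ → P1 K} (H : ∀ (a : K) (r : ℝ≥0∞),
      countIn M {x | x.absSub a < r} = countIn N {x | x.absSub a < r})
    {x : P1 K} (hx : x.absSub 0 < ⊤) : countIn M {x} = countIn N {x} := by
  classical
  by_contra hne
  set U := Finset.univ.image M ∪ Finset.univ.image N
  have hUM : ∀ i, M i ∈ U :=
    fun i => Finset.mem_union_left _ (Finset.mem_image_of_mem _ (Finset.mem_univ i))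
  have hUN : ∀ i, N i ∈ U :=
    fun i => Finset.mem_union_right _ (Finset.mem_image_of_mem _ (Finset.mem_univ i))
  set S := U.filter fun x => countIn M {x} ≠ countIn N {x} with hS
  have hxS : x ∈ S := by
    refine Finset.mem_filter.mpr ⟨?_, hne⟩
    by_contra hxU
    apply hne
    have h1 : countIn M {x} = 0 := by
      rw [← Nat.le_zero, ← not_lt, countIn_pos]
      rintro ⟨i, hi⟩
      exact hxU (by rw [← mem_singleton_iff.mp hi]; exact hUM i)
    have h2 : countIn N {x} = 0 := by
      rw [← Nat.le_zero, ← not_lt, countIn_pos]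
      rintro ⟨i, hi⟩
      exact hxU (by rw [← mem_singleton_iff.mp hi]; exact hUN i)
    rw [h1, h2]
  -- T gives the points with differing multiplicities in a disc. A disc for which T is nonempty of
  -- least size is chosen; the disc of radius ⊤ about 0 shows that one exists.
  let T : K × ℝ≥0∞ → Finset (P1 K) := fun p => S.filter fun x => x.absSub p.1 < p.2
  have hex : ∃ n, ∃ p, (T p).Nonempty ∧ (T p).card = n :=
    ⟨_, (0, ⊤), ⟨x, Finset.mem_filter.mpr ⟨hxS, hx⟩⟩, rfl⟩
  obtain ⟨⟨a, r⟩, hT, hTn⟩ := Nat.find_spec hex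
  have hmin : ∀ p, (T p).Nonempty → (T (a, r)).card ≤ (T p).card := by
    intro p hp
    rw [hTn]
    exact Nat.find_min' hex ⟨p, hp, rfl⟩
  -- If b separated two such points, the disc about b of radius |x₂ - b| would contain x₁ but not
  -- x₂, with strictly fewer of them. So only one is left, and the equal counts in the chosen disc
  -- give the contradiction.
  have sep : ∀ x₁ ∈ T (a, r), ∀ x₂ ∈ T (a, r), ∀ b, ¬ x₁.absSub b < x₂.absSub b := by
    intro x₁ h₁ x₂ h₂ b hb
    have h1 := Finset.mem_filter.mp h₁
    have h2 := Finset.mem_filter.mp h₂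
    have hab := x₁.enorm_sub_le a b
    have hba : ‖b - a‖ₑ = ‖a - b‖ₑ := by rw [← enorm_neg, neg_sub]
    have hss : T (b, x₂.absSub b) ⊂ T (a, r) := by
      refine Finset.ssubset_iff_subset_ne.mpr ⟨fun y hy => ?_, fun heq => ?_⟩
      · have hy' := Finset.mem_filter.mp hy
        refine Finset.mem_filter.mpr ⟨hy'.1, ?_⟩
        rcases le_or_gt (x₂.absSub b) r with h | h
        · refine lt_of_le_of_lt (y.absSub_le b a) (max_lt (hy'.2.trans_le h) ?_)
          rw [hba]
          exact lt_of_le_of_lt hab (max_lt h1.2 (hb.trans_le h))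
        · have := lt_of_le_of_lt (x₂.absSub_le a b)
            (max_lt (h2.2.trans h) (lt_of_le_of_lt hab (max_lt (h1.2.trans h) hb)))
          exact absurd this (lt_irrefl _)
      · have : x₂ ∈ T (b, x₂.absSub b) := by rw [heq]; exact h₂
        exact absurd (Finset.mem_filter.mp this).2 (lt_irrefl _)
    exact absurd (Finset.card_lt_card hss) (not_lt.mpr (hmin _
      ⟨x₁, Finset.mem_filter.mpr ⟨h1.1, hb⟩⟩))
  obtain ⟨x₀, hx₀⟩ := hT
  have huniq : ∀ y ∈ T (a, r), y = x₀ := fun y hy => ext_absSub fun b =>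
    le_antisymm (not_lt.mp (sep x₀ hx₀ y hy b)) (not_lt.mp (sep y hy x₀ hx₀ b))
  have hx₀' := Finset.mem_filter.mp hx₀
  have hx₀S := Finset.mem_filter.mp hx₀'.1
  have hcount := H a r
  obtain ⟨W, hW⟩ : ∃ W : Set (P1 K), W = {x : P1 K | x.absSub a < r} := ⟨_, rfl⟩
  rw [← hW] at hcount
  have hmem : x₀ ∈ U.filter (· ∈ W) :=
    Finset.mem_filter.mpr ⟨hx₀S.1, by rw [hW]; exact hx₀'.2⟩
  rw [countIn_eq_sum M _ hUM, countIn_eq_sum N _ hUN, ← Finset.add_sum_erase _ _ hmem,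
    ← Finset.add_sum_erase _ _ hmem] at hcount
  have hrest : ∑ y ∈ (U.filter (· ∈ W)).erase x₀, countIn M {y} =
      ∑ y ∈ (U.filter (· ∈ W)).erase x₀, countIn N {y} := by
    refine Finset.sum_congr rfl fun y hy => ?_
    have hy1 := Finset.mem_erase.mp hy
    have hy2 := Finset.mem_filter.mp hy1.2
    by_contra hyne
    exact hy1.1 (huniq y (Finset.mem_filter.mpr
      ⟨Finset.mem_filter.mpr ⟨hy2.1, hyne⟩, by have := hy2.2; rw [hW] at this; exact this⟩))
  rw [hrest] at hcount
  exact hx₀S.2 (Nat.add_right_cancel hcount)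

/-- Infinity lies in no disc |z - a| < r; its multiplicity is what remains of the total cardinality.
-/
theorem countIn_eq_of_card [IsAlgClosed K] [IsUltrametricDist K] {ι κ : Type*} [Fintype ι]
    [Fintype κ] {M : ι → P1 K} {N : κ → P1 K} (H : ∀ (a : K) (r : ℝ≥0∞),
      countIn M {x | x.absSub a < r} = countIn N {x | x.absSub a < r})
    (hcard : Fintype.card ι = Fintype.card κ) (s : Set (P1 K)) : countIn M s = countIn N s := by
  refine countIn_congr s fun x => ?_
  by_cases hx : x.absSub 0 < ⊤
  · exact countIn_singleton_eq H hx
  · have hs : ({x} : Set (P1 K)) = {x | x.absSub 0 < ⊤}ᶜ := by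
      ext y
      rw [mem_singleton_iff, mem_compl_iff, mem_ofPred_eq, not_lt_top_iff]
      rw [not_lt_top_iff] at hx
      exact ⟨fun h => by rw [h, hx], fun h => by
        rw [eq_classical_infty h, eq_classical_infty hx]⟩
    have h1 := countIn_add_compl M {x | x.absSub 0 < ⊤}
    have h2 := countIn_add_compl N {x | x.absSub 0 < ⊤}
    rw [hs]
    have := H 0 ⊤
    omega

end P1

end Berk

/-! ### Fibres with multiplicity over arbitrary points; local degrees -/

namespace Berk

open RatMap

variable {K : Type*} [NontriviallyNormedField K] [IsUltrametricDist K]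

namespace P1

theorem nlin_classical_one (a : K) (t : OnePoint K) :
    nlin a 1 (classical t) = weight (classical t) * ‖linAt a t‖₊ := by
  rw [nlin_eq]
  congr 1
  induction t using OnePoint.rec with
  | infty =>
    have h := classical_infty_absSub (0 : K)
    rw [← val_X_eq_top_iff] at h
    rw [lin_one_of_top _ _ h]
    exact nnnorm_one.symm
  | coe t =>
    have h := classical_coe_absSub t a
    have h' : (classical (t : OnePoint K)).val RatFunc.X ≠ ⊤ := by
      rw [Ne, val_X_eq_top_iff _ a, h]; exact enorm_ne_top
    rw [lin_one _ _ h', h, enorm_eq_nnnorm, ENNReal.toNNReal_coe, ← nnnorm_neg, neg_sub]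
    rfl

theorem imageForm_classical (h : RatFunc K) (a : K) (b : OnePoint K) :
    imageForm h a (classical b) = weight (classical b) * ‖(fiberPoly h b).eval a‖₊ := by
  rw [imageForm, nlin_eq, lin]
  congr 1
  induction b using OnePoint.rec with
  | infty =>
    have h := classical_infty_absSub (0 : K)
    rw [← val_X_eq_top_iff] at h
    rw [if_pos h]
    rfl
  | coe b =>
    have h' : (classical (b : OnePoint K)).val RatFunc.X ≠ ⊤ := by
      rw [Ne, val_X_eq_top_iff _ 0, classical_coe_absSub]; exact enorm_ne_top
    rw [if_neg h', ← RatFunc.algebraMap_C, ← RatFunc.algebraMap_C, ← RatFunc.algebraMap_X, ← map_mul,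
      ← map_sub]
    change ((ofA1 (affPoint b)).val _).toNNReal = _
    rw [ofA1_val_algebraMap, ENNReal.toNNReal_coe, affPoint]
    change ‖_‖₊ = ‖Polynomial.eval a (h.num - Polynomial.C b * h.denom)‖₊
    congr 1
    simp only [Polynomial.eval_sub, Polynomial.eval_mul, Polynomial.eval_C, Polynomial.eval_X]
    ring

/-- `M` enumerates the fibre of `h` over `y`, with multiplicities. -/
structure IsFiber (h : RatFunc K) (y : P1 K) {ι : Type*} [Fintype ι] (M : ι → P1 K) : Prop where
  rel : FiberRel h y M
  map_eq : ∀ i, map h (M i) = y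
  card : Fintype.card ι = degree h

variable [IsAlgClosed K]

open Classical in
theorem exists_classical_isFiber {h : RatFunc K} (hd : 0 < degree h) (b : OnePoint K) :
    ∃ t : Fin (degree h) → OnePoint K, IsFiber h (classical b) (fun i => classical (t i)) ∧
      (∀ x, countIn t {x} = if eval h x = b then degAt h x else 0) ∧
      Finset.univ.val.map t = (fiberPoly h b).roots.map (OnePoint.some : K → OnePoint K) +
        Multiset.replicate (degree h - (fiberPoly h b).natDegree) OnePoint.infty := by
  obtain ⟨t, c, hc, h1, h2, h3⟩ := exists_classical_fiber hd b
  have h2' : ∀ x, countIn t {x} = if eval h x = b then degAt h x else 0 := by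
    intro x
    rw [← h2, countIn]
    simp
  refine ⟨t, ⟨?_, fun i => ?_, Fintype.card_fin _⟩, h2', h3⟩
  · rw [fiberRel_iff hd]
    have hw := weight_pos (classical b)
    refine ⟨(∏ i, weight (classical (t i))) * ‖c‖₊⁻¹ * (weight (classical b))⁻¹, ?_, fun a => ?_⟩
    · have : 0 < ∏ i, weight (classical (t i)) := Finset.prod_pos fun i _ => weight_pos _
      have hc' : 0 < ‖c‖₊ := nnnorm_pos.mpr hc
      positivity
    · rw [imageForm_classical, h1, nnnorm_mul, nnnorm_prod]
      simp only [nlin_classical_one, Finset.prod_mul_distrib]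
      have hc' : ‖c‖₊ ≠ 0 := (nnnorm_pos.mpr hc).ne'
      field_simp
  · rw [map_classical hd]
    congr 1
    by_contra hne
    have := h2' (t i)
    rw [if_neg hne] at this
    exact absurd ((countIn_pos t).mpr ⟨i, mem_singleton (t i)⟩) (by omega)

omit [IsUltrametricDist K] [IsAlgClosed K] in
theorem continuous_imageForm (h : RatFunc K) (a : K) : Continuous (imageForm h a : P1 K → ℝ≥0) :=
  continuous_nlin _ _

omit [IsUltrametricDist K] [IsAlgClosed K] in
theorem isClosed_isFiber (h : RatFunc K) :
    IsClosed {p : P1 K × (Fin (degree h) → P1 K) | IsFiber h p.1 p.2} := by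
  have : {p : P1 K × (Fin (degree h) → P1 K) | IsFiber h p.1 p.2} =
      (⋂ a : K, ⋂ a' : K, {p | (∏ i, nlin a 1 (p.2 i)) * imageForm h a' p.1 =
        (∏ i, nlin a' 1 (p.2 i)) * imageForm h a p.1}) ∩ ⋂ i, {p | map h (p.2 i) = p.1} := by
    ext p
    simp only [mem_inter_iff, mem_iInter, mem_ofPred_eq]
    exact ⟨fun H => ⟨H.rel, H.map_eq⟩, fun H => ⟨H.1, H.2, Fintype.card_fin _⟩⟩
  rw [this]
  have hc : ∀ (a : K) (i : Fin (degree h)),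
      Continuous fun p : P1 K × (Fin (degree h) → P1 K) => nlin a 1 (p.2 i) := fun a i =>
    (continuous_nlin a 1).comp ((continuous_apply i).comp continuous_snd)
  have hi : ∀ a, Continuous fun p : P1 K × (Fin (degree h) → P1 K) => imageForm h a p.1 :=
    fun a => (continuous_imageForm h a).comp continuous_fst
  refine (isClosed_iInter fun a => isClosed_iInter fun a' => ?_).inter (isClosed_iInter fun i => ?_)
  · exact isClosed_eq ((continuous_finsetProd _ fun i _ => hc a i).mul (hi a'))
      ((continuous_finsetProd _ fun i _ => hc a' i).mul (hi a))
  · exact isClosed_eq ((continuous_map h).comp ((continuous_apply i).comp continuous_snd))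
      continuous_fst

/-- A closed relation with compact target that is solvable at all classical points is solvable
everywhere. -/
theorem forall_exists_of_classical {Y : Type*} [TopologicalSpace Y] [CompactSpace Y]
    {C : Set (P1 K × Y)} (hC : IsClosed C) (H : ∀ b : OnePoint K, ∃ m, (classical b, m) ∈ C)
    (y : P1 K) : ∃ m, (y, m) ∈ C := by
  have hcl : IsClosed (Prod.fst '' C) := isClosedMap_fst_of_compactSpace C hC
  have huniv : Prod.fst '' C = univ := by
    rw [← hcl.closure_eq]
    refine Dense.closure_eq ((denseRange_classical K).mono ?_)
    rintro _ ⟨b, rfl⟩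
    obtain ⟨m, hm⟩ := H b
    exact ⟨_, hm, rfl⟩
  have : y ∈ Prod.fst '' C := by rw [huniv]; exact mem_univ y
  obtain ⟨⟨_, m⟩, hm, rfl⟩ := this
  exact ⟨m, hm⟩

/-- Limit of the classical fibres: the relation is closed, tuples range over a compact space, and
classical points are dense. -/
theorem exists_isFiber {h : RatFunc K} (hd : 0 < degree h) (y : P1 K) :
    ∃ M : Fin (degree h) → P1 K, IsFiber h y M :=
  forall_exists_of_classical (isClosed_isFiber h) (fun b => by
    obtain ⟨t, ht, _⟩ := exists_classical_isFiber hd b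
    exact ⟨_, ht⟩) y

section Unique

variable {h : RatFunc K} {y : P1 K} {ι κ : Type*} [Fintype ι] [Fintype κ] {M : ι → P1 K}
  {N : κ → P1 K}

omit [IsUltrametricDist K] in
theorem countIn_disc_eq_of_rel (hd : 0 < degree h) (hM : FiberRel h y M) {E : Set K}
    (hE : E.Finite) {c : ℝ≥0} (hc : 0 < c) (hN : ∀ a, a ∉ E → ∏ i, nlin a 1 (N i) = c * imageForm h a y)
    (a : K) (r : ℝ≥0∞) :
    countIn M {x | x.absSub a < r} = countIn N {x | x.absSub a < r} := by
  obtain ⟨κ, hκ, hMκ⟩ := (fiberRel_iff hd).mp hM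
  refine countIn_disc_eq hE hc hκ (fun a ha => ?_) a r
  rw [hMκ, hN a ha]
  ring

theorem IsFiber.countIn_eq (hd : 0 < degree h) (hM : IsFiber h y M) (hN : IsFiber h y N)
    (s : Set (P1 K)) : countIn M s = countIn N s := by
  obtain ⟨c, hc, hNc⟩ := (fiberRel_iff hd).mp hN.rel
  exact countIn_eq_of_card (countIn_disc_eq_of_rel hd hM.rel finite_empty hc fun a _ => hNc a)
    (hM.card.trans hN.card.symm) s

/-- For classical x the multiplicity of x in its fibre is a positive local degree. The existence of
a fibre tuple containing x is a closed condition on x, so it extends to all x, and uniqueness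
transfers it to the given M. -/
theorem IsFiber.exists_eq (hd : 0 < degree h) {x : P1 K} (hM : IsFiber h (map h x) M) :
    ∃ i, M i = x := by
  have hC : IsClosed {p : P1 K × (Fin (degree h) → P1 K) |
      IsFiber h (map h p.1) p.2 ∧ ∃ i, p.2 i = p.1} := by
    refine IsClosed.inter ?_ ?_
    · exact (isClosed_isFiber h).preimage
        (((continuous_map h).comp continuous_fst).prodMk continuous_snd)
    · have : {p : P1 K × (Fin (degree h) → P1 K) | ∃ i, p.2 i = p.1} =
          ⋃ i, {p | p.2 i = p.1} := by ext p; simp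
      change IsClosed {p : P1 K × (Fin (degree h) → P1 K) | ∃ i, p.2 i = p.1}
      rw [this]
      exact isClosed_iUnion_of_finite fun i =>
        isClosed_eq ((continuous_apply i).comp continuous_snd) continuous_fst
  obtain ⟨N, hN, i, hi⟩ := forall_exists_of_classical hC (fun a => by
    obtain ⟨t, ht, hcount, _⟩ := exists_classical_isFiber hd (eval h a)
    have := hcount a
    rw [if_pos rfl] at this
    obtain ⟨i, hi⟩ := (countIn_pos t).mp (by rw [this]; exact degAt_pos hd a)
    refine ⟨fun i => classical (t i), ?_, i, congrArg classical (mem_singleton_iff.mp hi)⟩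
    simp only
    rw [map_classical hd]
    exact ht) x
  have hpos : 0 < countIn N {x} := (countIn_pos N).mpr ⟨i, hi⟩
  rw [← hM.countIn_eq hd hN] at hpos
  exact (countIn_pos M).mp hpos

end Unique

omit [IsAlgClosed K] in
open Classical in
theorem classicalCount_eq {h : RatFunc K} (hd : 0 < degree h) {b : OnePoint K}
    {t : Fin (degree h) → OnePoint K}
    (ht : ∀ x, countIn t {x} = if eval h x = b then degAt h x else 0) (W : Set (P1 K)) :
    classicalCount h W b = countIn (fun i => classical (t i)) W := by
  have e1 : countIn (fun i => classical (t i)) W = countIn t (classical ⁻¹' W) := rfl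
  have hU : ∀ i, t i ∈ Finset.univ.image t := fun i =>
    Finset.mem_image_of_mem _ (Finset.mem_univ i)
  have hset : {a : OnePoint K | eval h a = b ∧ classical a ∈ W} =
      ↑((Finset.univ.image t).filter (· ∈ classical ⁻¹' W)) := by
    ext a
    rw [Finset.coe_filter]
    simp only [mem_ofPred_eq]
    refine and_congr_left fun _ => ?_
    have h1 := ht a
    constructor
    · intro hb
      rw [if_pos hb] at h1
      obtain ⟨i, hi⟩ := (countIn_pos t).mp (by rw [h1]; exact degAt_pos hd a)
      rw [← mem_singleton_iff.mp hi]
      exact hU i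
    · intro ha
      obtain ⟨i, _, rfl⟩ := Finset.mem_image.mp ha
      by_contra hne
      rw [if_neg hne] at h1
      exact absurd ((countIn_pos t).mpr ⟨i, mem_singleton (t i)⟩) (by omega)
  rw [e1, countIn_eq_sum t _ hU, classicalCount, hset, finsum_mem_coe_finset]
  refine Finset.sum_congr rfl fun a ha => ?_
  have ha' : a ∈ (↑((Finset.univ.image t).filter (· ∈ classical ⁻¹' W)) : Set (OnePoint K)) := ha
  rw [← hset] at ha'
  rw [ht, if_pos ha'.1]

/-- Let m be the multiplicity of x. For the upper bound, take an open O around x whose closure meets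
the fibre only in x: the points y having more than m fibre points in the closure form a closed set
missing h(x), and O is shrunk by its preimage. For the lower bound, if W is admissible for the local
degree, classical fibres have at least `degree h - localDegree h x` points in the closed complement
of W, and this persists for the fibre through x. -/
theorem localDegree_eq {h : RatFunc K} (hd : 0 < degree h) {x : P1 K} {ι : Type*} [Fintype ι]
    {M : ι → P1 K} (hM : IsFiber h (map h x) M) : localDegree h x = countIn M {x} := by
  classical
  have hmem : countIn M {x} ∈ {m : ℕ | ∃ W : Set (P1 K), IsOpen W ∧ x ∈ W ∧
      ∀ b : OnePoint K, classicalCount h W b ≤ m} := by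
    obtain ⟨O, hO, hxO, hOM⟩ : ∃ O : Set (P1 K), IsOpen O ∧ x ∈ O ∧ ∀ i, M i ≠ x → M i ∉ closure O := by
      have hfin : (⋂ i ∈ {i | M i ≠ x}, {M i}ᶜ : Set (P1 K)) ∈ 𝓝 x := by
        refine (biInter_mem (toFinite _)).mpr fun i hi => ?_
        exact isClosed_singleton.isOpen_compl.mem_nhds (Ne.symm hi)
      obtain ⟨C, hC, hCcl, hCs⟩ := exists_mem_nhds_isClosed_subset hfin
      refine ⟨interior C, isOpen_interior, mem_interior_iff_mem_nhds.mpr hC, fun i hi hcl => ?_⟩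
      have h1 : M i ∈ C := (closure_minimal interior_subset hCcl) hcl
      have h2 := hCs h1
      simp only [mem_iInter] at h2
      exact h2 i hi rfl
    have hclosed : IsClosed (Prod.fst '' {p : P1 K × (Fin (degree h) → P1 K) |
        IsFiber h p.1 p.2 ∧ countIn M {x} + 1 ≤ countIn p.2 (closure O)}) := by
      apply isClosedMap_fst_of_compactSpace
      exact (isClosed_isFiber h).inter
        ((isClosed_le_countIn isClosed_closure _).preimage continuous_snd)
    have hnot : map h x ∉ Prod.fst '' {p : P1 K × (Fin (degree h) → P1 K) |
        IsFiber h p.1 p.2 ∧ countIn M {x} + 1 ≤ countIn p.2 (closure O)} := by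
      rintro ⟨⟨y, N⟩, ⟨hN, hle⟩, hy⟩
      simp only at hy hN hle
      rw [hy] at hN
      rw [hN.countIn_eq hd hM] at hle
      have : countIn M (closure O) ≤ countIn M {x} := by
        rw [countIn, countIn]
        refine Finset.card_le_card fun i hi => ?_
        rw [Finset.mem_filter] at hi ⊢
        refine ⟨hi.1, ?_⟩
        by_contra hne
        exact hOM i hne hi.2
      omega
    refine ⟨O ∩ map h ⁻¹' _, hO.inter (hclosed.isOpen_compl.preimage (continuous_map h)),
      ⟨hxO, hnot⟩, fun b => ?_⟩
    obtain ⟨t, ht, hcount, _⟩ := exists_classical_isFiber hd b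
    rw [classicalCount_eq hd hcount]
    by_contra! hlt
    obtain ⟨i, hi⟩ := (countIn_pos _).mp (lt_of_le_of_lt (Nat.zero_le _) hlt)
    have h1 := hi.2
    rw [mem_preimage, ht.map_eq i] at h1
    refine h1 ⟨(classical b, _), ⟨ht, ?_⟩, rfl⟩
    exact hlt.trans_le (countIn_mono _ (inter_subset_left.trans subset_closure))
  apply le_antisymm (Nat.sInf_le hmem)
  obtain ⟨W, hW, hxW, hle⟩ := Nat.sInf_mem ⟨_, hmem⟩
  obtain ⟨N, hN, hcount⟩ := forall_exists_of_classical
    (C := {p : P1 K × (Fin (degree h) → P1 K) |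
      IsFiber h p.1 p.2 ∧ degree h - localDegree h x ≤ countIn p.2 Wᶜ})
    ((isClosed_isFiber h).inter
      ((isClosed_le_countIn hW.isClosed_compl _).preimage continuous_snd)) (fun b => by
    obtain ⟨t, ht, hcount, _⟩ := exists_classical_isFiber hd b
    refine ⟨_, ht, ?_⟩
    have h1 := hle b
    rw [classicalCount_eq hd hcount] at h1
    have h2 := countIn_add_compl (fun i => classical (t i)) W
    rw [ht.card] at h2
    change countIn _ W ≤ localDegree h x at h1
    change degree h - localDegree h x ≤ countIn (fun i => classical (t i)) Wᶜ
    omega) (map h x)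
  have h1 := countIn_add_compl N W
  rw [hN.card] at h1
  have h2 : countIn N {x} ≤ countIn N W := countIn_mono N (singleton_subset_iff.mpr hxW)
  have hN' : IsFiber h (map h x) N := hN
  rw [hM.countIn_eq hd hN']
  change _ ≤ localDegree h x
  have h3 : degree h - localDegree h x ≤ countIn N Wᶜ := hcount
  omega

theorem localDegree_pos {h : RatFunc K} (hd : 0 < degree h) (x : P1 K) : 0 < localDegree h x := by
  obtain ⟨M, hM⟩ := exists_isFiber hd (map h x)
  rw [localDegree_eq hd hM, countIn_pos]
  exact hM.exists_eq hd

/-- The weights are multiplicities in the fibre tuple, and every preimage occurs in the tuple. From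
here on, pullbacks of Dirac measures are counts. -/
theorem pullbackDirac_apply {h : RatFunc K} (hd : 0 < degree h) {y : P1 K} {ι : Type*} [Fintype ι]
    {M : ι → P1 K} (hM : IsFiber h y M) {s : Set (P1 K)} (hs : MeasurableSet s) :
    pullbackDirac h y s = countIn M s := by
  classical
  set U := Finset.univ.image M with hU
  have hMU : ∀ i, M i ∈ U := fun i => Finset.mem_image_of_mem _ (Finset.mem_univ i)
  rw [countIn_eq_sum M s hMU, pullbackDirac, Measure.sum_apply _ hs]
  have h1 : ∀ x : (map h ⁻¹' {y} : Set (P1 K)),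
      ((localDegree h x : ℝ≥0∞) • Measure.dirac (x : P1 K)) s =
        (fun z : P1 K => if z ∈ s then (countIn M {z} : ℝ≥0∞) else 0) x := by
    rintro ⟨x, hx⟩
    have hx' : map h x = y := hx
    subst hx'
    rw [Measure.smul_apply, Measure.dirac_apply' _ hs, localDegree_eq hd hM, smul_eq_mul]
    simp only [indicator_apply, Pi.one_apply, mul_ite, mul_one, mul_zero]
  rw [tsum_congr h1, tsum_subtype (map h ⁻¹' {y})
    (fun z : P1 K => if z ∈ s then (countIn M {z} : ℝ≥0∞) else 0), tsum_eq_sum (s := U)]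
  · rw [Finset.sum_filter, Nat.cast_sum]
    refine Finset.sum_congr rfl fun x hx => ?_
    obtain ⟨i, _, rfl⟩ := Finset.mem_image.mp hx
    rw [indicator_of_mem (show M i ∈ map h ⁻¹' {y} from hM.map_eq i)]
    split_ifs <;> simp
  · intro x hx
    rw [indicator_apply]
    split_ifs with h1 h2
    · have h1' : map h x = y := h1
      subst h1'
      obtain ⟨i, hi⟩ := hM.exists_eq hd
      exact absurd (hi ▸ hMU i) hx
    · rfl
    · rfl

end P1

end Berk

/-! ### Fibres of compositions, Möbius maps and constancy of fibre counts -/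

namespace Berk

open RatMap

variable {K : Type*} [NontriviallyNormedField K] [IsUltrametricDist K]

namespace P1

section Composition

variable [IsAlgClosed K]

omit [IsUltrametricDist K] in
-- Multiplying the relations for the fibres of g over the M_i gives the values at the M_i of forms
-- with root g(a). The relation for f at g(a) turns this product into the form with root f(g(a)) at
-- y. Poles a of g are left out, which is why `countIn_disc_eq` allows a finite exceptional set.
theorem countIn_disc_comp {f g : RatFunc K} (hf : 0 < degree f) (hg : 0 < degree g) {y : P1 K}
    {ι κ τ : Type*} [Fintype ι] [Fintype κ] [Fintype τ] {M : ι → P1 K} (hM : IsFiber f y M)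
    {N : ι → κ → P1 K} (hN : ∀ i, IsFiber g (M i) (N i)) {L : τ → P1 K}
    (hL : IsFiber (comp f g) y L) (a : K) (r : ℝ≥0∞) :
    countIn L {x | x.absSub a < r} =
      countIn (fun p : ι × κ => N p.1 p.2) {x | x.absSub a < r} := by
  obtain ⟨c, hc, hMc⟩ := (fiberRel_iff hf).mp hM.rel
  choose k hk hNk using fun i => (fiberRel_iff hg).mp (hN i).rel
  obtain ⟨u, hu, hev⟩ := eval_num_denom_comp f hg
  have hu' : 0 < ‖u‖₊ := nnnorm_pos.mpr hu
  have hE : {a : K | g.denom.eval a = 0}.Finite := by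
    refine (g.denom.rootSet_finite K).subset fun a ha => ?_
    rw [Polynomial.mem_rootSet]
    exact ⟨g.denom_ne_zero, by simpa using ha⟩
  refine countIn_disc_eq_of_rel (degree_comp_pos hf hg) hL.rel hE
    (c := (∏ i, k i) * c * ‖u‖₊⁻¹) ?_ (fun a ha => ?_) a r
  · have : 0 < ∏ i, k i := Finset.prod_pos fun i _ => hk i
    positivity
  · have ha' : g.denom.eval a ≠ 0 := ha
    obtain ⟨h1, h2⟩ := hev a ha'
    have e1 : ∀ x, imageForm g a x = ‖g.denom.eval a‖₊ * nlin (g.num.eval a / g.denom.eval a) 1 x := by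
      intro x
      rw [← nlin_smul, mul_one, mul_div_cancel₀ _ ha']
    rw [Fintype.prod_prod_type]
    simp only [hNk, e1, Finset.prod_mul_distrib, hMc]
    rw [imageForm, imageForm, h1, h2, nlin_smul, nnnorm_mul, nnnorm_pow, Finset.prod_const,
      Finset.card_univ, hM.card]
    field_simp

theorem countIn_lt_top {h : RatFunc K} {y : P1 K} {ι : Type*} [Fintype ι] {M : ι → P1 K}
    (hM : ∀ i, map h (M i) = y) (hy : map h (classical (OnePoint.infty : OnePoint K)) ≠ y) :
    countIn M {x | x.absSub 0 < ⊤} = Fintype.card ι := by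
  have h1 := countIn_add_compl M {x | x.absSub 0 < ⊤}
  have h2 : countIn M {x | x.absSub 0 < ⊤}ᶜ = 0 := by
    rw [← Nat.le_zero, ← not_lt, countIn_pos]
    rintro ⟨i, hi⟩
    rw [mem_compl_iff, mem_ofPred_eq, not_lt_top_iff] at hi
    exact hy (by rw [← eq_classical_infty hi, hM i])
  omega

theorem degree_comp {f g : RatFunc K} (hf : 0 < degree f) (hg : 0 < degree g) :
    degree (comp f g) = degree f * degree g := by
  -- One of 0 and 1 is not the image of infinity. Over it every fibre point is finite, so the disc
  -- of radius ⊤ counts the whole fibre and the counts are degrees.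
  obtain ⟨b, hb⟩ : ∃ b : K, map (comp f g) (classical (OnePoint.infty : OnePoint K)) ≠
      classical (b : OnePoint K) := by
    by_contra! H
    have := injective_classical ((H 0).symm.trans (H 1))
    rw [OnePoint.coe_eq_coe] at this
    exact zero_ne_one this
  obtain ⟨M, hM⟩ := exists_isFiber hf (classical (b : OnePoint K))
  choose N hN using fun i => exists_isFiber hg (M i)
  obtain ⟨L, hL⟩ := exists_isFiber (degree_comp_pos hf hg) (classical (b : OnePoint K))
  have key := countIn_disc_comp hf hg hM hN hL 0 ⊤
  rw [countIn_lt_top hL.map_eq hb, countIn_lt_top (h := comp f g) (y := classical (b : OnePoint K)) _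
    hb] at key
  · simpa using key
  · rintro ⟨i, j⟩
    rw [map_comp hf hg, (hN i).map_eq, hM.map_eq]

theorem pullbackDirac_comp {f g : RatFunc K} (hf : 0 < degree f) (hg : 0 < degree g) {y : P1 K}
    {ι : Type*} [Fintype ι] {M : ι → P1 K} (hM : IsFiber f y M) {s : Set (P1 K)}
    (hs : MeasurableSet s) :
    pullbackDirac (comp f g) y s = ∑ i, pullbackDirac g (M i) s := by
  classical
  choose N hN using fun i => exists_isFiber hg (M i)
  obtain ⟨L, hL⟩ := exists_isFiber (degree_comp_pos hf hg) y
  rw [pullbackDirac_apply (degree_comp_pos hf hg) hL hs]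
  simp only [fun i => pullbackDirac_apply hg (hN i) hs]
  rw [countIn_eq_of_card (countIn_disc_comp hf hg hM hN hL)
    (by simp [degree_comp hf hg, hM.card]) s, ← Nat.cast_sum, Nat.cast_inj]
  simp only [countIn, Finset.card_filter]
  rw [Fintype.sum_prod_type]

theorem bijective_map {A : RatFunc K} (hA : degree A = 1) :
    Function.Bijective (map A : P1 K → P1 K) := by
  have hA' : 0 < degree A := by omega
  refine ⟨fun x y hxy => ?_, fun y => ?_⟩
  · obtain ⟨M, hM⟩ := exists_isFiber hA' (map A x)
    obtain ⟨i, hi⟩ := hM.exists_eq hA'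
    have hM' : IsFiber A (map A y) M := by rwa [← hxy]
    obtain ⟨j, hj⟩ := hM'.exists_eq hA'
    have : i = j := by
      apply Fin.ext
      have := i.2
      have := j.2
      omega
    rw [← hi, ← hj, this]
  · obtain ⟨M, hM⟩ := exists_isFiber hA' y
    exact ⟨M ⟨0, hA'⟩, hM.map_eq _⟩

/-- The action of a Möbius transformation, as a homeomorphism. -/
def mapHomeo (A : RatFunc K) (hA : degree A = 1) : P1 K ≃ₜ P1 K :=
  (Equiv.ofBijective (map A) (bijective_map hA)).toHomeomorphOfIsInducing
    ((continuous_map A).isClosedEmbedding (bijective_map hA).1).isInducing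

theorem mapHomeo_apply (A : RatFunc K) (hA : degree A = 1) (x : P1 K) :
    mapHomeo A hA x = map A x := rfl

theorem pullbackDirac_conj {h A B : RatFunc K} (hd : 0 < degree h) (hA : degree A = 1)
    (hB : degree B = 1) (y : P1 K) {v : Set (P1 K)} (hv : IsOpen v) :
    pullbackDirac (comp A (comp h B)) (map A y) (map B ⁻¹' v) = pullbackDirac h y v := by
  classical
  have hA' : 0 < degree A := by omega
  have hB' : 0 < degree B := by omega
  have hs : MeasurableSet (map B ⁻¹' v) := (hv.preimage (continuous_map B)).measurableSet
  obtain ⟨L, hL⟩ := exists_isFiber hA' (map A y)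
  have hLy : ∀ i, L i = y := fun i => (bijective_map hA).1 (hL.map_eq i)
  rw [pullbackDirac_comp hA' (degree_comp_pos hd hB') hL hs]
  simp only [hLy]
  rw [Finset.sum_const, Finset.card_univ, Fintype.card_fin, hA, one_smul]
  obtain ⟨M, hM⟩ := exists_isFiber hd y
  rw [pullbackDirac_comp hd hB' hM hs, pullbackDirac_apply hd hM hv.measurableSet]
  have hB1 : ∀ z, pullbackDirac B z (map B ⁻¹' v) = if z ∈ v then 1 else 0 := by
    intro z
    obtain ⟨N, hN⟩ := exists_isFiber hB' z
    rw [pullbackDirac_apply hB' hN hs, countIn]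
    simp only [mem_preimage, hN.map_eq]
    split_ifs with hz
    · simp [hz, hB]
    · simp [hz]
  simp only [hB1]
  rw [countIn, Finset.sum_boole]

/-- The counts in the closure of v and in the complement of v are both upper semicontinuous. Fibres
over w avoid x₀, so the first is the count in v and both counts sum to the degree. Hence the count
in v is locally constant on the connected set w. -/
theorem pullbackDirac_const {h : RatFunc K} (hd : 0 < degree h) {v w : Set (P1 K)} {x₀ : P1 K}
    (hv : IsOpen v) (hvc : closure v ⊆ insert x₀ v) (hw : IsPreconnected w)
    (hwx : map h x₀ ∉ w) {y y' : P1 K} (hy : y ∈ w) (hy' : y' ∈ w) :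
    pullbackDirac h y v = pullbackDirac h y' v := by
  classical
  choose M hM using fun y => exists_isFiber hd y
  have hcl : ∀ (T : Set (P1 K)), IsClosed T → ∀ k,
      IsClosed {y | k ≤ countIn (M y) T} := by
    intro T hT k
    have : {y | k ≤ countIn (M y) T} = Prod.fst '' {p : P1 K × (Fin (degree h) → P1 K) |
        IsFiber h p.1 p.2 ∧ k ≤ countIn p.2 T} := by
      ext y
      constructor
      · intro hk
        exact ⟨(y, M y), ⟨hM y, hk⟩, rfl⟩
      · rintro ⟨⟨y, N⟩, ⟨hN, hk⟩, rfl⟩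
        change k ≤ countIn (M y) T
        rw [(hM y).countIn_eq hd hN]
        exact hk
    rw [this]
    apply isClosedMap_fst_of_compactSpace
    exact (isClosed_isFiber h).inter ((isClosed_le_countIn hT _).preimage continuous_snd)
  have hcont : ContinuousOn (fun y => countIn (M y) v) w := by
    intro y hy
    rw [ContinuousWithinAt, nhds_discrete, tendsto_pure]
    have heq : ∀ y ∈ w, countIn (M y) (closure v) = countIn (M y) v := by
      intro y hy
      refine le_antisymm ?_ (countIn_mono _ subset_closure)
      rw [countIn, countIn]
      refine Finset.card_le_card fun i hi => ?_
      rw [Finset.mem_filter] at hi ⊢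
      refine ⟨hi.1, (hvc hi.2).resolve_left fun hx => ?_⟩
      have := (hM y).map_eq i
      rw [hx] at this
      exact hwx (this ▸ hy)
    have h1 : ∀ᶠ z in 𝓝[w] y, ¬ countIn (M y) v + 1 ≤ countIn (M z) (closure v) := by
      apply mem_nhdsWithin_of_mem_nhds
      apply (hcl _ isClosed_closure (countIn (M y) v + 1)).isOpen_compl.mem_nhds
      rw [mem_compl_iff, mem_ofPred_eq, heq y hy]
      omega
    have h2 : ∀ᶠ z in 𝓝[w] y, ¬ countIn (M y) vᶜ + 1 ≤ countIn (M z) vᶜ := by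
      apply mem_nhdsWithin_of_mem_nhds
      apply (hcl _ hv.isClosed_compl (countIn (M y) vᶜ + 1)).isOpen_compl.mem_nhds
      rw [mem_compl_iff, mem_ofPred_eq]
      omega
    filter_upwards [h1, h2, self_mem_nhdsWithin] with z hz1 hz2 hz3
    rw [heq z hz3] at hz1
    have e1 := countIn_add_compl (M y) v
    have e2 := countIn_add_compl (M z) v
    omega
  rw [pullbackDirac_apply hd (hM y) hv.measurableSet, pullbackDirac_apply hd (hM y') hv.measurableSet]
  congr 1
  exact hw.constant hcont hy hy'

end Composition

/-! ### Residue classes and the directions at the Gauss point -/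

section Reduction

theorem mem_intRing {a : K} : a ∈ IntRing K ↔ ‖a‖ ≤ 1 := by
  rw [Valuation.mem_valuationSubring_iff, NormedField.valuation_apply]
  exact Iff.rfl

theorem mem_intRing_enorm {a : K} : a ∈ IntRing K ↔ ‖a‖ₑ ≤ 1 := by
  rw [mem_intRing, enorm_eq_nnnorm, ← ENNReal.coe_one, ENNReal.coe_le_coe]
  exact Iff.rfl

theorem residue_eq_zero_iff {a : IntRing K} :
    IsLocalRing.residue (IntRing K) a = 0 ↔ ‖(a : K)‖ₑ < 1 := by
  rw [IsLocalRing.residue_eq_zero_iff, IsLocalRing.mem_maximalIdeal, mem_nonunits_iff]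
  have ha : ‖(a : K)‖ₑ ≤ 1 := mem_intRing_enorm.mp a.2
  constructor
  · intro hu
    refine lt_of_le_of_ne ha fun h1 => hu ?_
    have h0 : (a : K) ≠ 0 := by
      intro h0
      rw [h0, enorm_zero] at h1
      exact zero_ne_one h1
    have hinv : (a : K)⁻¹ ∈ IntRing K := by
      rw [mem_intRing_enorm, enorm_inv h0, h1, inv_one]
    exact IsUnit.of_mul_eq_one ⟨(a : K)⁻¹, hinv⟩ (Subtype.ext (mul_inv_cancel₀ h0))
  · rintro h hu
    obtain ⟨b, hb⟩ := hu.exists_right_inv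
    have hb' : (a : K) * (b : K) = 1 := congrArg Subtype.val hb
    have h2 := congrArg (fun z : K => ‖z‖ₑ) hb'
    simp only [enorm_mul, enorm_one] at h2
    have h3 : ‖(b : K)‖ₑ ≤ 1 := mem_intRing_enorm.mp b.2
    have : ‖(a : K)‖ₑ * ‖(b : K)‖ₑ ≤ ‖(a : K)‖ₑ * 1 := by gcongr
    rw [h2, mul_one] at this
    exact absurd h (not_lt.mpr this)

theorem residue_eq_iff {a b : IntRing K} :
    IsLocalRing.residue (IntRing K) a = IsLocalRing.residue (IntRing K) b ↔
      ‖(a : K) - b‖ₑ < 1 := by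
  rw [← sub_eq_zero, ← map_sub, residue_eq_zero_iff]
  rfl

theorem gauss_absSub (a : K) : (gauss : P1 K).absSub a = max 1 ‖a‖ₑ := by
  rw [gauss, ofA1_absSub, enorm_eq_nnnorm, ← ENNReal.coe_one, ← ENNReal.coe_max, ENNReal.coe_inj]
  apply NNReal.eq
  have := gaussNorm_X_add_C (-a) 1
  rw [map_neg, ← sub_eq_add_neg, norm_neg] at this
  exact this

theorem eq_gauss_iff [IsAlgClosed K] {x : P1 K} :
    x = gauss ↔ x.absSub 0 ≤ 1 ∧ ∀ a : IntRing K, 1 ≤ x.absSub a := by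
  constructor
  · rintro rfl
    simp only [gauss_absSub]
    exact ⟨by simp, fun a => le_max_left _ _⟩
  · rintro ⟨h0, h1⟩
    apply ext_absSub
    intro a
    rw [gauss_absSub]
    rcases le_or_gt ‖a‖ₑ 1 with h | h
    · rw [max_eq_left h]
      refine le_antisymm ((x.absSub_le 0 a).trans (max_le h0 ?_)) (h1 ⟨a, mem_intRing_enorm.mpr h⟩)
      rwa [zero_sub, enorm_neg]
    · rw [max_eq_right h.le, x.absSub_eq_of_gt (a := 0), zero_sub, enorm_neg]
      rw [zero_sub, enorm_neg]
      exact lt_of_le_of_lt h0 h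

variable (K) in
/-- The residue map of the valuation ring. -/
abbrev res : IntRing K →+* ResField K := IsLocalRing.residue (IntRing K)

/-- The direction at the Gauss point given by a point of the projective line over the residue
field. -/
def redDir : OnePoint (ResField K) → Set (P1 K)
  | ∞ => {x | 1 < x.absSub 0}
  | OnePoint.some e => {x | ∃ a : IntRing K, res K a = e ∧ x.absSub a < 1}

theorem redDir_infty : redDir (OnePoint.infty : OnePoint (ResField K)) = {x : P1 K | 1 < x.absSub 0} :=
  rfl

theorem redDir_coe (a : IntRing K) :
    redDir (res K a : OnePoint (ResField K)) = {x : P1 K | x.absSub a < 1} := by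
  ext x
  constructor
  · rintro ⟨b, hb, hx⟩
    refine lt_of_le_of_lt (x.absSub_le b a) (max_lt hx (residue_eq_iff.mp hb))
  · intro hx
    exact ⟨a, rfl, hx⟩

theorem exists_residue (e : ResField K) : ∃ a : IntRing K, res K a = e :=
  IsLocalRing.residue_surjective e

theorem isOpen_redDir (e : OnePoint (ResField K)) : IsOpen (redDir e : Set (P1 K)) := by
  induction e using OnePoint.rec with
  | infty => exact isOpen_lt continuous_const (continuous_absSub 0)
  | coe e =>
    obtain ⟨a, rfl⟩ := exists_residue e
    rw [redDir_coe]
    exact isOpen_lt (continuous_absSub _) continuous_const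

theorem isPreconnected_redDir [IsAlgClosed K] (e : OnePoint (ResField K)) :
    IsPreconnected (redDir e : Set (P1 K)) := by
  induction e using OnePoint.rec with
  | infty => exact isPreconnected_lt_absSub 0 1
  | coe e =>
    obtain ⟨a, rfl⟩ := exists_residue e
    rw [redDir_coe]
    exact isPreconnected_absSub_lt _ _

open Classical in
theorem classical_mem_redDir {a : OnePoint K} {e : OnePoint (ResField K)} :
    classical a ∈ redDir e ↔ redPt a = e := by
  induction a using OnePoint.rec with
  | infty =>
    change _ ↔ (OnePoint.infty : OnePoint (ResField K)) = e
    induction e using OnePoint.rec with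
    | infty => rw [redDir_infty, mem_ofPred_eq, classical_infty_absSub]; simp
    | coe e =>
      obtain ⟨b, rfl⟩ := exists_residue e
      rw [redDir_coe, mem_ofPred_eq, classical_infty_absSub]
      simp
  | coe a =>
    change _ ↔ (if ha : a ∈ IntRing K then
      ((res K ⟨a, ha⟩ : ResField K) : OnePoint (ResField K)) else OnePoint.infty) = e
    induction e using OnePoint.rec with
    | infty =>
      rw [redDir_infty, mem_ofPred_eq, classical_coe_absSub, sub_zero, ← not_le, ← mem_intRing_enorm]
      split_ifs with h <;> simp [h]
    | coe e =>
      obtain ⟨b, rfl⟩ := exists_residue e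
      rw [redDir_coe, mem_ofPred_eq, classical_coe_absSub]
      split_ifs with h
      · rw [OnePoint.coe_eq_coe, residue_eq_iff]
      · simp only [OnePoint.infty_ne_coe, iff_false, not_lt]
        rw [mem_intRing_enorm, not_le] at h
        by_contra! H
        have h2 := enorm_sub_le_max a b 0
        rw [sub_zero, sub_zero] at h2
        exact absurd (h2.trans (max_le H.le (mem_intRing_enorm.mp b.2))) (not_le.mpr h)

theorem redDir_disjoint {x : P1 K} {e e' : OnePoint (ResField K)} (h : x ∈ redDir e)
    (h' : x ∈ redDir e') : e = e' := by
  have aux : ∀ (a : IntRing K), x ∈ redDir (res K a : OnePoint (ResField K)) → ¬ 1 < x.absSub 0 := by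
    intro a ha
    rw [redDir_coe] at ha
    rw [not_lt]
    refine (x.absSub_le a 0).trans (max_le (le_of_lt ha) ?_)
    rw [sub_zero]
    exact mem_intRing_enorm.mp a.2
  induction e using OnePoint.rec with
  | infty =>
    induction e' using OnePoint.rec with
    | infty => rfl
    | coe e' =>
      obtain ⟨a, rfl⟩ := exists_residue e'
      exact absurd h (aux a h')
  | coe e =>
    obtain ⟨a, rfl⟩ := exists_residue e
    induction e' using OnePoint.rec with
    | infty => exact absurd h' (aux a h)
    | coe e' =>
      obtain ⟨b, rfl⟩ := exists_residue e'
      rw [redDir_coe] at h h'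
      rw [OnePoint.coe_eq_coe, residue_eq_iff]
      exact lt_of_le_of_lt (x.enorm_sub_le a b) (max_lt h h')

variable [IsAlgClosed K]

omit [IsAlgClosed K] in
theorem gauss_notMem_redDir (e : OnePoint (ResField K)) : (gauss : P1 K) ∉ redDir e := by
  induction e using OnePoint.rec with
  | infty => rw [redDir_infty, mem_ofPred_eq, gauss_absSub]; simp
  | coe e =>
    obtain ⟨a, rfl⟩ := exists_residue e
    rw [redDir_coe, mem_ofPred_eq, gauss_absSub, not_lt]
    exact le_max_left _ _

theorem exists_mem_redDir {x : P1 K} (hx : x ≠ gauss) : ∃ e : OnePoint (ResField K), x ∈ redDir e := by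
  rw [Ne, eq_gauss_iff, not_and_or, not_le, not_forall] at hx
  rcases hx with h | ⟨a, ha⟩
  · exact ⟨OnePoint.infty, h⟩
  · exact ⟨(res K a : OnePoint (ResField K)), by rw [redDir_coe]; exact not_le.mp ha⟩

/-- The residue classes are open, pairwise disjoint and cover everything but the Gauss point, which
is the only possible extra limit point. -/
theorem closure_redDir (e : OnePoint (ResField K)) :
    closure (redDir e : Set (P1 K)) ⊆ insert gauss (redDir e) := by
  intro x hx
  by_cases hg : x = gauss
  · exact Or.inl hg
  · obtain ⟨e', he'⟩ := exists_mem_redDir hg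
    obtain ⟨z, hz1, hz2⟩ := mem_closure_iff.mp hx _ (isOpen_redDir e') he'
    rw [← redDir_disjoint hz1 hz2]
    exact Or.inr he'

omit [IsAlgClosed K] in
theorem redDir_nonempty (e : OnePoint (ResField K)) :
    ∃ a : OnePoint K, classical a ∈ redDir e := by
  induction e using OnePoint.rec with
  | infty =>
    exact ⟨OnePoint.infty, classical_mem_redDir.mpr rfl⟩
  | coe e =>
    obtain ⟨a, rfl⟩ := exists_residue e
    refine ⟨((a : K) : OnePoint K), ?_⟩
    rw [redDir_coe, mem_ofPred_eq, classical_coe_absSub, sub_self, enorm_zero]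
    exact zero_lt_one

theorem connectedComponentIn_eq_redDir {x : P1 K} {e : OnePoint (ResField K)} (hx : x ∈ redDir e) :
    connectedComponentIn {(gauss : P1 K)}ᶜ x = redDir e := by
  have hsub : (redDir e : Set (P1 K)) ⊆ {gauss}ᶜ := fun y hy h =>
    gauss_notMem_redDir e (mem_singleton_iff.mp h ▸ hy)
  apply Subset.antisymm
  · have hpre : IsPreconnected (connectedComponentIn {(gauss : P1 K)}ᶜ x) :=
      isPreconnected_connectedComponentIn
    refine hpre.subset_left_of_subset_union (isOpen_redDir e)
      (v := ⋃ e' ∈ {e' | e' ≠ e}, redDir e') (isOpen_biUnion fun e' _ => isOpen_redDir e') ?_ ?_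
      ⟨x, mem_connectedComponentIn (hsub hx), hx⟩
    · rw [Set.disjoint_left]
      intro y hy hy'
      obtain ⟨e', he', hy'⟩ := mem_iUnion₂.mp hy'
      exact he' (redDir_disjoint hy' hy)
    · intro y hy
      obtain ⟨e', he'⟩ := exists_mem_redDir (connectedComponentIn_subset _ _ hy)
      by_cases h : e' = e
      · exact Or.inl (h ▸ he')
      · exact Or.inr (mem_iUnion₂.mpr ⟨e', h, he'⟩)
  · exact (isPreconnected_redDir e).subset_connectedComponentIn hx hsub

theorem mem_directions_gauss {v : Set (P1 K)} :
    v ∈ directions (gauss : P1 K) ↔ ∃ e : OnePoint (ResField K), v = redDir e := by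
  constructor
  · rintro ⟨y, hy, rfl⟩
    obtain ⟨e, he⟩ := exists_mem_redDir hy
    exact ⟨e, connectedComponentIn_eq_redDir he⟩
  · rintro ⟨e, rfl⟩
    obtain ⟨a, ha⟩ := redDir_nonempty e
    exact ⟨_, fun h => gauss_notMem_redDir e (h ▸ ha), (connectedComponentIn_eq_redDir ha).symm⟩

/-- Otherwise the class would be clopen, nonempty and proper in a connected space. It makes the
filter defining tangent images nontrivial. -/
theorem gauss_mem_closure_redDir (e : OnePoint (ResField K)) :
    (gauss : P1 K) ∈ closure (redDir e : Set (P1 K)) := by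
  by_contra hg
  have hcl : IsClosed (redDir e : Set (P1 K)) := by
    rw [← closure_subset_iff_isClosed]
    intro x hx
    rcases closure_redDir e hx with h | h
    · exact absurd (h ▸ hx) hg
    · exact h
  have hclopen : IsClopen (redDir e : Set (P1 K)) := ⟨hcl, isOpen_redDir e⟩
  rcases isClopen_iff.mp hclopen with h | h
  · obtain ⟨a, ha⟩ := redDir_nonempty e
    rw [h] at ha
    exact ha
  · exact gauss_notMem_redDir e (by rw [h]; exact mem_univ _)

end Reduction

end P1

end Berk

/-! ### Roots in residue discs and reduction of polynomials -/

namespace Berk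

open RatMap

namespace P1

variable {K : Type*} [NontriviallyNormedField K]

theorem val_prod_X_sub_C (x : P1 K) (hx : x.val RatFunc.X ≠ ⊤) (s : Multiset K) :
    x.val (algebraMap K[X] (RatFunc K)
      (s.map fun t => Polynomial.X - Polynomial.C t).prod) = (s.map x.absSub).prod := by
  induction s using Multiset.induction with
  | empty => simpa using x.val_C 1
  | cons a s ih =>
    rw [Multiset.map_cons, Multiset.prod_cons, x.val_polynomial_mul hx, ih, Multiset.map_cons,
      Multiset.prod_cons, map_sub, RatFunc.algebraMap_X, RatFunc.algebraMap_C, absSub]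

theorem val_polynomial_eq_prod_roots [IsAlgClosed K] (x : P1 K) (hx : x.val RatFunc.X ≠ ⊤)
    (p : K[X]) :
    x.val (algebraMap K[X] (RatFunc K) p) = ‖p.leadingCoeff‖ₑ * (p.roots.map x.absSub).prod := by
  conv_lhs => rw [(IsAlgClosed.splits p).eq_prod_roots]
  rw [x.val_polynomial_mul hx, x.val_prod_X_sub_C hx, RatFunc.algebraMap_C, x.val_C]

open Classical in
/-- The number of roots of `p`, counted with multiplicity, in the open unit disc around `a`. -/
def rootsIn (p : K[X]) (a : K) : ℕ := p.roots.countP fun t => ‖t - a‖ₑ < 1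

theorem rootsIn_mul {p q : K[X]} (h : p * q ≠ 0) (a : K) :
    rootsIn (p * q) a = rootsIn p a + rootsIn q a := by
  rw [rootsIn, Polynomial.roots_mul h, Multiset.countP_add]
  rfl

variable [IsUltrametricDist K]

theorem gauss_val_X_ne_top : (gauss : P1 K).val RatFunc.X ≠ ⊤ := by
  have := gauss_absSub (0 : K)
  rw [absSub_zero] at this
  rw [this]
  simp

theorem enorm_coeff_le_gauss_val (p : K[X]) (i : ℕ) :
    ‖p.coeff i‖ₑ ≤ (gauss : P1 K).val (algebraMap K[X] (RatFunc K) p) := by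
  rw [gauss, ofA1_val_algebraMap, enorm_eq_nnnorm, ENNReal.coe_le_coe, ← NNReal.coe_le_coe]
  have := Polynomial.le_gaussNorm (NormedField.toAbsoluteValue K) p zero_le_one i
  rw [one_pow, mul_one] at this
  exact this

theorem exists_gauss_val_eq (p : K[X]) :
    ∃ i, (gauss : P1 K).val (algebraMap K[X] (RatFunc K) p) = ‖p.coeff i‖ₑ := by
  obtain ⟨i, hi⟩ := Polynomial.exists_eq_gaussNorm (NormedField.toAbsoluteValue K) 1 p
  refine ⟨i, ?_⟩
  rw [gauss, ofA1_val_algebraMap, enorm_eq_nnnorm, ENNReal.coe_inj]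
  apply NNReal.eq
  rw [one_pow, mul_one] at hi
  exact hi

theorem gauss_val_lt_one {P : (IntRing K)[X]} (hP : P.map (res K) = 0) :
    (gauss : P1 K).val (algebraMap K[X] (RatFunc K) (P.map (IntRing K).subtype)) < 1 := by
  obtain ⟨i, hi⟩ := exists_gauss_val_eq (P.map (IntRing K).subtype)
  rw [hi, Polynomial.coeff_map]
  apply residue_eq_zero_iff.mp
  have := congrArg (fun p => Polynomial.coeff p i) hP
  simpa using this

theorem gauss_val_eq_one {P : (IntRing K)[X]} (hP : P.map (res K) ≠ 0) :
    (gauss : P1 K).val (algebraMap K[X] (RatFunc K) (P.map (IntRing K).subtype)) = 1 := by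
  apply le_antisymm
  · obtain ⟨i, hi⟩ := exists_gauss_val_eq (P.map (IntRing K).subtype)
    rw [hi, Polynomial.coeff_map]
    exact mem_intRing_enorm.mp (P.coeff i).2
  · obtain ⟨i, hi⟩ : ∃ i, (P.map (res K)).coeff i ≠ 0 := by
      by_contra! h
      exact hP (Polynomial.ext fun i => by rw [h i, Polynomial.coeff_zero])
    refine le_trans ?_ (enorm_coeff_le_gauss_val _ i)
    rw [Polynomial.coeff_map] at hi ⊢
    exact not_lt.mp fun h => hi (residue_eq_zero_iff.mpr h)

theorem map_subtype_ne_zero {P : (IntRing K)[X]} (hP : P.map (res K) ≠ 0) :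
    P.map (IntRing K).subtype ≠ 0 := by
  intro h
  rw [Polynomial.map_eq_zero_iff (Subtype.val_injective)] at h
  rw [h, Polynomial.map_zero] at hP
  exact hP rfl

/-- A nonzero polynomial over `K` is a multiple of an integral one with nonzero reduction. -/
theorem exists_integral_multiple {p : K[X]} (hp : p ≠ 0) :
    ∃ (c : K) (P : (IntRing K)[X]), c ≠ 0 ∧ p = Polynomial.C c * P.map (IntRing K).subtype ∧
      P.map (res K) ≠ 0 := by
  obtain ⟨i, hi⟩ := exists_gauss_val_eq p
  have hle := enorm_coeff_le_gauss_val p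
  rw [hi] at hle
  have hc : p.coeff i ≠ 0 := by
    intro h0
    apply hp
    ext j
    have := hle j
    rw [h0, enorm_zero, nonpos_iff_eq_zero, enorm_eq_zero] at this
    rw [this, Polynomial.coeff_zero]
  have hlift : Polynomial.C (p.coeff i)⁻¹ * p ∈ Polynomial.lifts (IntRing K).subtype := by
    rw [Polynomial.lifts_iff_coeff_lifts]
    intro j
    rw [Polynomial.coeff_C_mul]
    refine ⟨⟨(p.coeff i)⁻¹ * p.coeff j, mem_intRing_enorm.mpr ?_⟩, rfl⟩
    rw [enorm_mul, enorm_inv hc, mul_comm, ← div_eq_mul_inv]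
    exact ENNReal.div_le_of_le_mul (by rw [one_mul]; exact hle j)
  obtain ⟨P, hP⟩ := (Polynomial.mem_lifts _).mp hlift
  refine ⟨p.coeff i, P, hc, ?_, fun h0 => ?_⟩
  · rw [hP, ← mul_assoc, ← Polynomial.C_mul, mul_inv_cancel₀ hc, Polynomial.C_1, one_mul]
  · have h1 := congrArg (fun q => Polynomial.coeff q i) hP
    have h2 := congrArg (fun q => Polynomial.coeff q i) h0
    simp only [Polynomial.coeff_map, Polynomial.coeff_C_mul, inv_mul_cancel₀ hc,
      Polynomial.coeff_zero] at h1 h2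
    have : ‖((P.coeff i : IntRing K) : K)‖ₑ < 1 := residue_eq_zero_iff.mp h2
    have h3 : ((P.coeff i : IntRing K) : K) = 1 := h1
    rw [h3, enorm_one] at this
    exact lt_irrefl _ this

variable [IsAlgClosed K]

/-- For t outside the valuation ring, |a - t| = |t| is also the value of |z - t| at the Gauss point.
So |P(a)| equals the Gauss norm, which is 1. -/
theorem rootMultiplicity_map_res_eq_zero {P : (IntRing K)[X]} (hP : P.map (res K) ≠ 0)
    (hroots : ∀ t ∈ (P.map (IntRing K).subtype).roots, t ∉ IntRing K) (a : IntRing K) :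
    (P.map (res K)).rootMultiplicity (res K a) = 0 := by
  apply Polynomial.rootMultiplicity_eq_zero
  rw [Polynomial.IsRoot.def, Polynomial.eval_map_apply, residue_eq_zero_iff, not_lt]
  have h1 := gauss_val_eq_one hP
  rw [val_polynomial_eq_prod_roots _ gauss_val_X_ne_top] at h1
  have h2 : (classical ((a : K) : OnePoint K)).val
      (algebraMap K[X] (RatFunc K) (P.map (IntRing K).subtype)) = ‖((P.eval a : IntRing K) : K)‖ₑ := by
    change (ofA1 (affPoint (a : K))).val _ = _
    rw [ofA1_val_algebraMap]
    change ((‖Polynomial.eval ((IntRing K).subtype a) (P.map (IntRing K).subtype)‖₊ : ℝ≥0) : ℝ≥0∞) = _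
    rw [Polynomial.eval_map_apply, enorm_eq_nnnorm]
    rfl
  have hx : (classical ((a : K) : OnePoint K)).val RatFunc.X ≠ ⊤ := by
    rw [← absSub_zero, classical_coe_absSub]
    exact enorm_ne_top
  rw [← h2, val_polynomial_eq_prod_roots _ hx, ← h1]
  refine le_of_eq ?_
  congr 2
  refine Multiset.map_congr rfl fun t ht => ?_
  have hta : ‖(a : K)‖ₑ < ‖t‖ₑ := by
    have := hroots t ht
    rw [mem_intRing_enorm, not_le] at this
    exact lt_of_le_of_lt (mem_intRing_enorm.mp a.2) this
  have ht1 : 1 ≤ ‖t‖ₑ := by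
    have := hroots t ht
    rw [mem_intRing_enorm, not_le] at this
    exact this.le
  rw [gauss_absSub, max_eq_right ht1]
  have := (classical ((a : K) : OnePoint K)).absSub_eq_of_gt (a := 0) (b := t) (by
    rw [classical_coe_absSub, sub_zero, zero_sub, enorm_neg]
    exact hta)
  rw [this, zero_sub, enorm_neg]

/-- Integral roots t are split off one at a time; X - t adds one to either side exactly when t and a
have the same residue. Nothing is left to count once no root is integral. -/
theorem rootsIn_map_subtype {P : (IntRing K)[X]} (hP : P.map (res K) ≠ 0) (a : IntRing K) :
    rootsIn (P.map (IntRing K).subtype) a = (P.map (res K)).rootMultiplicity (res K a) := by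
  classical
  induction hn : P.natDegree using Nat.strong_induction_on generalizing P with
  | _ n ih =>
    by_cases hroots : ∀ t ∈ (P.map (IntRing K).subtype).roots, t ∉ IntRing K
    · rw [rootMultiplicity_map_res_eq_zero hP hroots, rootsIn, Multiset.countP_eq_zero]
      intro t ht h
      apply hroots t ht
      rw [mem_intRing_enorm]
      have := enorm_sub_le_max t a 0
      rw [sub_zero, sub_zero] at this
      exact this.trans (max_le h.le (mem_intRing_enorm.mp a.2))
    · push Not at hroots
      obtain ⟨t, ht, htO⟩ := hroots
      have hroot : P.IsRoot ⟨t, htO⟩ := by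
        have h1 := Polynomial.isRoot_of_mem_roots ht
        rw [Polynomial.IsRoot.def] at h1 ⊢
        apply Subtype.val_injective
        have h2 := Polynomial.eval_map_apply (p := P) (IntRing K).subtype (⟨t, htO⟩ : IntRing K)
        exact h2.symm.trans h1
      obtain ⟨P', rfl⟩ := Polynomial.dvd_iff_isRoot.mpr hroot
      have hne := map_subtype_ne_zero hP
      have hP0 : P' ≠ 0 := by rintro rfl; simp at hP
      rw [Polynomial.map_mul] at hP hne
      have hP' : P'.map (res K) ≠ 0 := right_ne_zero_of_mul hP
      rw [Polynomial.map_mul, Polynomial.map_mul, rootsIn_mul hne, Polynomial.rootMultiplicity_mul hP,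
        ih P'.natDegree (by
          rw [← hn, Polynomial.natDegree_mul (Polynomial.X_sub_C_ne_zero _) hP0,
            Polynomial.natDegree_X_sub_C]
          lia) hP' rfl]
      congr 1
      rw [Polynomial.map_sub, Polynomial.map_X, Polynomial.map_C, Polynomial.map_sub,
        Polynomial.map_X, Polynomial.map_C, Polynomial.rootMultiplicity_X_sub_C, rootsIn]
      change Multiset.countP _ (Polynomial.X - Polynomial.C t).roots = _
      rw [Polynomial.roots_X_sub_C, ← Multiset.cons_zero, Multiset.countP_cons,
        Multiset.countP_zero, zero_add]
      congr 1
      rw [eq_comm, residue_eq_iff, ← enorm_neg, neg_sub]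

theorem pullbackDirac_classical_redDir {h : RatFunc K} (hd : 0 < degree h) (b : OnePoint K)
    (a : IntRing K) :
    pullbackDirac h (classical b) (redDir (res K a : OnePoint (ResField K))) =
      (rootsIn (fiberPoly h b) a : ℕ) := by
  classical
  obtain ⟨t, hfib, -, ht⟩ := exists_classical_isFiber hd b
  rw [pullbackDirac_apply hd hfib (isOpen_redDir _).measurableSet, Nat.cast_inj]
  have h1 : countIn (fun i => classical (t i)) (redDir (res K a : OnePoint (ResField K))) =
      (Multiset.map t Finset.univ.val).countP
        fun s => classical s ∈ redDir (res K a : OnePoint (ResField K)) := by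
    rw [Multiset.countP_map]
    rfl
  rw [h1, ht, Multiset.countP_add]
  have h2 : (Multiset.replicate (degree h - (fiberPoly h b).natDegree) OnePoint.infty).countP
      (fun s => classical s ∈ redDir (res K a : OnePoint (ResField K))) = 0 := by
    rw [Multiset.countP_eq_zero]
    intro s hs
    rw [Multiset.eq_of_mem_replicate hs, redDir_coe, mem_ofPred_eq, classical_infty_absSub]
    simp
  rw [h2, add_zero, Multiset.countP_map, rootsIn, Multiset.countP_eq_card_filter]
  congr 1
  refine Multiset.filter_congr fun s _ => ?_
  rw [redDir_coe, mem_ofPred_eq, classical_coe_absSub]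

end P1

end Berk

/-! ### Common factors of unreduced fractions -/

namespace RatMap

variable {F : Type*} [Field F]

theorem exists_common_factor {P Q : F[X]} (hQ : Q ≠ 0) :
    ∃ H : F[X], H ≠ 0 ∧
      P = H * (algebraMap F[X] (RatFunc F) P / algebraMap F[X] (RatFunc F) Q).num ∧
      Q = H * (algebraMap F[X] (RatFunc F) P / algebraMap F[X] (RatFunc F) Q).denom := by
  set φ := algebraMap F[X] (RatFunc F) P / algebraMap F[X] (RatFunc F) Q with hφ
  have key : φ.num * Q = P * φ.denom := by
    have h := RatFunc.num_div_denom φ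
    conv_rhs at h => rw [hφ]
    rw [div_eq_div_iff (RatFunc.algebraMap_ne_zero φ.denom_ne_zero)
      (RatFunc.algebraMap_ne_zero hQ)] at h
    apply RatFunc.algebraMap_injective F
    rw [map_mul, map_mul]
    exact h
  obtain ⟨H, hH⟩ : φ.denom ∣ Q :=
    (RatFunc.isCoprime_num_denom φ).symm.dvd_of_dvd_mul_left ⟨P, by rw [key, mul_comm]⟩
  refine ⟨H, ?_, ?_, by rw [hH, mul_comm]⟩
  · rintro rfl
    exact hQ (by rw [hH, mul_zero])
  · apply mul_right_cancel₀ φ.denom_ne_zero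
    rw [← key]
    nth_rewrite 1 [hH]
    ring

theorem comp_X_right (φ : RatFunc F) : comp φ RatFunc.X = φ := by
  have h : ∀ p : F[X], p.eval₂ RatFunc.C (RatFunc.X : RatFunc F) = algebraMap F[X] (RatFunc F) p :=
    fun p => by
      rw [← RatFunc.aeval_X_left_eq_algebraMap, Polynomial.aeval_def, RatFunc.algebraMap_eq_C]
  rw [comp, RatFunc.eval, h, h, RatFunc.num_div_denom]

theorem sub_C_mul_denom (g : RatFunc F) (c : F) :
    (g - RatFunc.C c) * algebraMap F[X] (RatFunc F) (fiberPoly g OnePoint.infty) =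
      algebraMap F[X] (RatFunc F) (fiberPoly g c) := by
  change (g - RatFunc.C c) * algebraMap F[X] (RatFunc F) g.denom =
    algebraMap F[X] (RatFunc F) (g.num - Polynomial.C c * g.denom)
  rw [map_sub, map_mul, RatFunc.algebraMap_C, sub_mul, sub_left_inj]
  nth_rewrite 1 [← RatFunc.num_div_denom g]
  exact div_mul_cancel₀ _ (RatFunc.algebraMap_ne_zero g.denom_ne_zero)

end RatMap

/-! ### Behaviour near the Gauss point in one direction -/

namespace Berk

open RatMap

namespace P1

variable {K : Type*} [NontriviallyNormedField K] [IsUltrametricDist K]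

/-- Reversing coefficients in one common degree commutes with reducing them. -/
theorem IsReduction.comp_X_inv {g : RatFunc K} {φ : RatFunc (ResField K)}
    (h : IsReduction g φ) : IsReduction (comp g RatFunc.X⁻¹) (comp φ RatFunc.X⁻¹) := by
  obtain ⟨P, Q, hQ, rfl, rfl⟩ := h
  set d := max P.natDegree Q.natDegree
  refine ⟨P.reflect d, Q.reflect d, ?_, ?_, ?_⟩
  · rw [← Polynomial.reflect_map, Ne, Polynomial.reflect_eq_zero_iff]
    exact hQ
  · rw [comp_div_X_inv (d := d), Polynomial.reflect_map, Polynomial.reflect_map]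
    · exact Polynomial.natDegree_map_le.trans (le_max_left _ _)
    · exact Polynomial.natDegree_map_le.trans (le_max_right _ _)
  · rw [comp_div_X_inv (d := d), Polynomial.reflect_map, Polynomial.reflect_map]
    · exact Polynomial.natDegree_map_le.trans (le_max_left _ _)
    · exact Polynomial.natDegree_map_le.trans (le_max_right _ _)

section Local

variable [IsAlgClosed K]

omit [IsAlgClosed K] in
-- For y close to the Gauss point in the disc about a, a root t in the disc has |y - t| = |y - a|,
-- because |y - a| exceeds |t - a|. For a root outside, |y - t| = |a - t| is constant.
theorem eventually_prod_absSub (a : IntRing K) (s : Multiset K)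
    [DecidablePred fun t : K => ‖t - (a : K)‖ₑ < 1] :
    ∀ᶠ y in 𝓝[redDir (res K a : OnePoint (ResField K))] (gauss : P1 K),
      (s.map y.absSub).prod = (s.map (gauss : P1 K).absSub).prod *
        y.absSub (a : K) ^ s.countP (fun t : K => ‖t - (a : K)‖ₑ < 1) := by
  have haO := mem_intRing_enorm.mp a.2
  have hga : (gauss : P1 K).absSub (a : K) = 1 := by rw [gauss_absSub, max_eq_left haO]
  induction s using Multiset.induction with
  | empty => simp
  | cons t s ih =>
    by_cases ht : ‖t - a‖ₑ < 1
    · have hev : ∀ᶠ y in 𝓝[redDir (res K a : OnePoint (ResField K))] (gauss : P1 K),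
          ‖t - a‖ₑ < y.absSub (a : K) :=
        (tendsto_order.mp ((continuous_absSub (a : K)).tendsto (gauss : P1 K))).1 _
          (by rwa [hga]) |>.filter_mono nhdsWithin_le_nhds
      filter_upwards [ih, hev] with y hy hty
      have hgt : (gauss : P1 K).absSub t = 1 := by
        rw [gauss_absSub, max_eq_left]
        have := enorm_sub_le_max t a 0
        rw [sub_zero, sub_zero] at this
        exact this.trans (max_le ht.le haO)
      rw [Multiset.map_cons, Multiset.prod_cons, hy, Multiset.map_cons, Multiset.prod_cons, hgt,
        one_mul, Multiset.countP_cons_of_pos (p := fun t : K => ‖t - (a : K)‖ₑ < 1) _ ht,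
        y.absSub_eq_of_lt (a := (a : K)) (b := t) (by rwa [← enorm_neg, neg_sub]), pow_succ]
      ring
    · filter_upwards [ih, self_mem_nhdsWithin] with y hy hyD
      rw [redDir_coe, mem_ofPred_eq] at hyD
      have ht' : 1 ≤ ‖(a : K) - t‖ₑ := by rwa [not_lt, ← enorm_neg, neg_sub] at ht
      have hgt : (gauss : P1 K).absSub t = ‖(a : K) - t‖ₑ := by
        apply le_antisymm
        · refine ((gauss : P1 K).absSub_le a t).trans (max_le ?_ le_rfl)
          rwa [hga]
        · refine ((gauss : P1 K).enorm_sub_le a t).trans (max_le ?_ le_rfl)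
          rw [hga, gauss_absSub]
          exact le_max_left _ _
      rw [Multiset.map_cons, Multiset.prod_cons, hy, Multiset.map_cons, Multiset.prod_cons, hgt,
        Multiset.countP_cons_of_neg (p := fun t : K => ‖t - (a : K)‖ₑ < 1) _ ht,
        y.absSub_eq_of_gt (a := (a : K)) (b := t) (lt_of_lt_of_le hyD ht')]
      ring

theorem eventually_val_polynomial (a : IntRing K) (p : K[X]) :
    ∀ᶠ y in 𝓝[redDir (res K a : OnePoint (ResField K))] (gauss : P1 K),
      y.val (algebraMap K[X] (RatFunc K) p) =
        (gauss : P1 K).val (algebraMap K[X] (RatFunc K) p) * y.absSub (a : K) ^ rootsIn p a := by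
  classical
  filter_upwards [eventually_prod_absSub a p.roots, self_mem_nhdsWithin] with y hy hyD
  rw [redDir_coe, mem_ofPred_eq] at hyD
  have hyX : y.val RatFunc.X ≠ ⊤ := by
    rw [← absSub_zero, Ne, y.absSub_eq_top_iff 0 (a : K)]
    exact ne_top_of_lt hyD
  rw [val_polynomial_eq_prod_roots y hyX, val_polynomial_eq_prod_roots _ gauss_val_X_ne_top, hy,
    mul_assoc, rootsIn]

theorem lt_of_mul_eq {z κ ρ : ℝ≥0∞} {m n : ℕ} (hκ : κ ≠ 0) (hκ' : κ ≠ ⊤) (hρ : ρ ≠ 0) (hρ1 : ρ < 1)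
    (h : z * (κ * ρ ^ m) = κ * ρ ^ n) : (m < n → z < 1) ∧ (n < m → 1 < z) := by
  have aux : ∀ {i j : ℕ}, i < j → κ * ρ ^ j < κ * ρ ^ i := by
    intro i j hij
    refine ENNReal.mul_lt_mul_right hκ hκ' ?_
    obtain ⟨k, rfl⟩ := Nat.exists_eq_add_of_lt hij
    have h1 : ρ ^ (k + 1) < 1 := pow_lt_one' hρ1 (Nat.succ_ne_zero k)
    have h2 : ρ ^ i ≠ 0 := pow_ne_zero i hρ
    have h3 : ρ ^ i ≠ ⊤ := ENNReal.pow_ne_top (ne_top_of_lt hρ1)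
    calc ρ ^ (i + k + 1) = ρ ^ i * ρ ^ (k + 1) := by rw [← pow_add, add_assoc]
      _ < ρ ^ i * 1 := ENNReal.mul_lt_mul_right h2 h3 h1
      _ = ρ ^ i := mul_one _
  constructor
  · intro hmn
    by_contra! hz
    have h1 := aux hmn
    rw [← h] at h1
    refine absurd h1 (not_lt.mpr ?_)
    calc κ * ρ ^ m = 1 * (κ * ρ ^ m) := (one_mul _).symm
      _ ≤ z * (κ * ρ ^ m) := by gcongr
  · intro hnm
    by_contra! hz
    have h1 := aux hnm
    rw [← h] at h1
    refine absurd h1 (not_lt.mpr ?_)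
    calc z * (κ * ρ ^ m) ≤ 1 * (κ * ρ ^ m) := by gcongr
      _ = κ * ρ ^ m := one_mul _

/-- Near the Gauss point |g(y) - c| is |y - a| raised to the number of zeros of g - c in the disc
minus the number of poles. As |y - a| < 1, the sign of this exponent tells on which side of 1 the
value lies. -/
theorem eventually_absSub_map {g : RatFunc K} (hd : 0 < degree g)
    (hG : map g (gauss : P1 K) = gauss) (a c : IntRing K) :
    ∀ᶠ y in 𝓝[redDir (res K a : OnePoint (ResField K))] (gauss : P1 K),
      (rootsIn (fiberPoly g OnePoint.infty) a < rootsIn (fiberPoly g (c : K)) a →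
        (map g y).absSub c < 1) ∧
      (rootsIn (fiberPoly g (c : K)) a < rootsIn (fiberPoly g OnePoint.infty) a →
        1 < (map g y).absSub c) := by
  have hρ : ∀ᶠ y in 𝓝[redDir (res K a : OnePoint (ResField K))] (gauss : P1 K),
      0 < y.absSub (a : K) :=
    (tendsto_order.mp ((continuous_absSub (a : K)).tendsto (gauss : P1 K))).1 _
      (by rw [gauss_absSub]; exact lt_max_of_lt_left one_pos) |>.filter_mono nhdsWithin_le_nhds
  set κ := (gauss : P1 K).val (algebraMap K[X] (RatFunc K) (fiberPoly g OnePoint.infty)) with hκdef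
  have hκ' : κ ≠ ⊤ := val_polynomial_ne_top _ gauss_val_X_ne_top _
  have hκ : κ ≠ 0 := by
    intro h0
    have := enorm_coeff_le_gauss_val (K := K) (fiberPoly g OnePoint.infty)
    apply fiberPoly_ne_zero hd (OnePoint.infty : OnePoint K)
    ext i
    have hi := this i
    rw [← hκdef, h0, nonpos_iff_eq_zero, enorm_eq_zero] at hi
    rw [hi, Polynomial.coeff_zero]
  have hGc : (gauss : P1 K).val (g - RatFunc.C (c : K)) = 1 := by
    rw [← map_absSub hd, hG, gauss_absSub, max_eq_left (mem_intRing_enorm.mp c.2)]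
  have hκc : (gauss : P1 K).val (algebraMap K[X] (RatFunc K) (fiberPoly g (c : K))) = κ := by
    rw [← sub_C_mul_denom, val_mul, hGc, one_mul]
    · rw [hGc]
      exact fun h => one_ne_zero h.1
    · rw [hGc]
      exact fun h => ENNReal.one_ne_top h.1
  filter_upwards [hρ, eventually_val_polynomial a (fiberPoly g OnePoint.infty),
    eventually_val_polynomial a (fiberPoly g (c : K)), self_mem_nhdsWithin] with y hy0 h1 h2 hyD
  rw [redDir_coe, mem_ofPred_eq] at hyD
  rw [map_absSub hd]
  apply lt_of_mul_eq hκ hκ' hy0.ne' hyD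
  have hw : y.val (algebraMap K[X] (RatFunc K) (fiberPoly g OnePoint.infty)) ≠ 0 := by
    rw [h1]
    exact mul_ne_zero hκ (pow_ne_zero _ hy0.ne')
  have hw' : y.val (algebraMap K[X] (RatFunc K) (fiberPoly g OnePoint.infty)) ≠ ⊤ := by
    rw [h1]
    exact ENNReal.mul_ne_top hκ' (ENNReal.pow_ne_top (ne_top_of_lt hyD))
  rw [hκc, ← sub_C_mul_denom, val_mul] at h2
  · rw [← h2, h1]
  · exact fun h => hw' h.2
  · exact fun h => hw h.2

omit [IsAlgClosed K] in
-- A zero reduction would make |g - c| < 1 at the Gauss point, whereas it is 1 because g fixes that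
-- point. In particular the reduction of g is not constant.
theorem map_sub_C_mul_ne_zero {P Q : (IntRing K)[X]} (hQ : Q.map (res K) ≠ 0) {g : RatFunc K}
    (hd : 0 < degree g) (hg : g = algebraMap K[X] (RatFunc K) (P.map (IntRing K).subtype) /
      algebraMap K[X] (RatFunc K) (Q.map (IntRing K).subtype))
    (hG : map g (gauss : P1 K) = gauss) (c : IntRing K) :
    (P - Polynomial.C c * Q).map (res K) ≠ 0 := by
  intro h0
  have h1 := gauss_val_lt_one h0
  have hQ1 := gauss_val_eq_one hQ
  have hGc : (gauss : P1 K).val (g - RatFunc.C (c : K)) = 1 := by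
    rw [← map_absSub hd, hG, gauss_absSub, max_eq_left (mem_intRing_enorm.mp c.2)]
  have h2 : algebraMap K[X] (RatFunc K) ((P - Polynomial.C c * Q).map (IntRing K).subtype) =
      (g - RatFunc.C (c : K)) * algebraMap K[X] (RatFunc K) (Q.map (IntRing K).subtype) := by
    rw [Polynomial.map_sub, Polynomial.map_mul, Polynomial.map_C, map_sub, map_mul,
      RatFunc.algebraMap_C, sub_mul, hg,
      div_mul_cancel₀ _ (RatFunc.algebraMap_ne_zero (map_subtype_ne_zero hQ))]
    rfl
  rw [h2, val_mul, hGc, hQ1, one_mul] at h1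
  · exact lt_irrefl _ h1
  · rw [hGc]
    exact fun h => one_ne_zero h.1
  · rw [hGc]
    exact fun h => ENNReal.one_ne_top h.1

/-- Write g = P / Q integrally. Over K the pair P, Q may have a common factor T, and its reduction a
common factor H. Here i and j count the roots of T in the disc and of H at the residue point; they
do not depend on c. The surplus will be j - i. -/
theorem exists_rootsIn_fiberPoly {g : RatFunc K} {φ : RatFunc (ResField K)} (hd : 0 < degree g)
    (hred : IsReduction g φ) (hG : map g (gauss : P1 K) = gauss) (a : IntRing K) :
    0 < degree φ ∧ ∃ i j : ℕ,
      (i + rootsIn (fiberPoly g OnePoint.infty) a =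
        j + (fiberPoly φ OnePoint.infty).rootMultiplicity (res K a)) ∧
      ∀ c : IntRing K, i + rootsIn (fiberPoly g (c : K)) a =
        j + (fiberPoly φ (res K c)).rootMultiplicity (res K a) := by
  obtain ⟨P, Q, hQ, hg, hφ⟩ := hred
  have hsub := map_sub_C_mul_ne_zero hQ hd hg hG
  have hQ' := map_subtype_ne_zero hQ
  obtain ⟨T, hT, hTP, hTQ⟩ := exists_common_factor (P := P.map (IntRing K).subtype) hQ'
  obtain ⟨H, hH, hHP, hHQ⟩ := exists_common_factor (P := P.map (res K)) hQ
  rw [← hg] at hTP hTQ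
  rw [← hφ] at hHP hHQ
  have hT' : ∀ c : IntRing K, (P - Polynomial.C c * Q).map (IntRing K).subtype =
      T * fiberPoly g (c : K) := by
    intro c
    change _ = T * (g.num - Polynomial.C (c : K) * g.denom)
    rw [Polynomial.map_sub, Polynomial.map_mul, Polynomial.map_C, mul_sub, ← hTP, mul_left_comm,
      ← hTQ]
    rfl
  have hH' : ∀ c : IntRing K, (P - Polynomial.C c * Q).map (res K) =
      H * fiberPoly φ (res K c) := by
    intro c
    change _ = H * (φ.num - Polynomial.C (res K c) * φ.denom)
    rw [Polynomial.map_sub, Polynomial.map_mul, Polynomial.map_C, mul_sub, ← hHP, mul_left_comm,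
      ← hHQ]
  refine ⟨?_, rootsIn T a, H.rootMultiplicity (res K a), ?_, ?_⟩
  · rw [degree_pos_iff]
    rintro ⟨e, he⟩
    obtain ⟨c, rfl⟩ := exists_residue e
    apply hsub c
    rw [hH' c]
    change H * (φ.num - Polynomial.C (res K c) * φ.denom) = 0
    rw [he]
    simp
  · change _ + rootsIn g.denom a = _ + φ.denom.rootMultiplicity _
    rw [← rootsIn_mul (mul_ne_zero hT g.denom_ne_zero), ← hTQ,
      ← Polynomial.rootMultiplicity_mul (mul_ne_zero hH φ.denom_ne_zero), ← hHQ,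
      rootsIn_map_subtype hQ]
  · intro c
    have h1 := map_subtype_ne_zero (hsub c)
    have h2 := hsub c
    rw [← rootsIn_mul (by rwa [← hT' c]), ← hT' c, rootsIn_map_subtype (hsub c), hH' c,
      Polynomial.rootMultiplicity_mul (by rwa [← hH' c])]

open Classical in
/-- In the direction `v` at the Gauss point, `h` has a tangent image `w` and a surplus `s` such that
a point off `h(S_G)` has `m + s` preimages in `v` if it lies in `w`, and `s` otherwise. -/
def HasDirDegree (h : RatFunc K) (v : Set (P1 K)) (m : ℕ) : Prop :=
  ∃ (s : ℕ) (w : Set (P1 K)), w ∈ directions (map h gauss) ∧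
    (∀ᶠ y in 𝓝[v] (gauss : P1 K), map h y ∈ w) ∧
    ∀ y, y ≠ map h gauss → pullbackDirac h y v =
      if y ∈ w then ((m + s : ℕ) : ℝ≥0∞) else (s : ℝ≥0∞)

theorem hasDirDegree_redDir_coe {g : RatFunc K} {φ : RatFunc (ResField K)} (hd : 0 < degree g)
    (hred : IsReduction g φ) (hG : map g (gauss : P1 K) = gauss) (a : IntRing K) :
    HasDirDegree g (redDir (res K a : OnePoint (ResField K))) (degAtFin φ (res K a)) := by
  classical
  obtain ⟨hφ, i, j, hinf, hfin⟩ := exists_rootsIn_fiberPoly hd hred hG a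
  have hm : 0 < degAtFin φ (res K a) := degAtFin_pos hφ _
  -- One classical point per residue class suffices, since the count is constant on the class by
  -- `pullbackDirac_const`.
  have hcount : ∀ e : OnePoint (ResField K), ∃ b : OnePoint K, classical b ∈ (redDir e : Set (P1 K)) ∧
      i + rootsIn (fiberPoly g b) a =
        j + if evalFin φ (res K a) = e then degAtFin φ (res K a) else 0 := by
    intro e
    induction e using OnePoint.rec with
    | infty =>
      refine ⟨OnePoint.infty, classical_mem_redDir.mpr rfl, ?_⟩
      rw [hinf, rootMultiplicity_fiberPoly]
    | coe e =>
      obtain ⟨c, rfl⟩ := exists_residue e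
      refine ⟨((c : K) : OnePoint K), ?_, ?_⟩
      · rw [redDir_coe, mem_ofPred_eq, classical_coe_absSub, sub_self, enorm_zero]
        exact one_pos
      · rw [hfin, rootMultiplicity_fiberPoly]
  -- A residue class other than the value of φ contributes no local degree, which shows i ≤ j.
  obtain ⟨s, hs⟩ : ∃ s, j = i + s := by
    obtain ⟨e, he⟩ : ∃ e : OnePoint (ResField K), e ≠ evalFin φ (res K a) := by
      by_cases h : evalFin φ (res K a) = OnePoint.infty
      · exact ⟨((0 : ResField K) : OnePoint (ResField K)), by rw [h]; exact OnePoint.coe_ne_infty _⟩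
      · exact ⟨OnePoint.infty, Ne.symm h⟩
    obtain ⟨b, -, hb⟩ := hcount e
    rw [if_neg he.symm] at hb
    exact ⟨_, hb.symm⟩
  refine ⟨s, redDir (evalFin φ (res K a)), ?_, ?_, ?_⟩
  · rw [hG, mem_directions_gauss]
    exact ⟨_, rfl⟩
  · obtain he | ⟨e, he⟩ : evalFin φ (res K a) = OnePoint.infty ∨
        ∃ e : ResField K, evalFin φ (res K a) = (e : OnePoint (ResField K)) := by
      induction evalFin φ (res K a) using OnePoint.rec with
      | infty => exact Or.inl rfl
      | coe e => exact Or.inr ⟨e, rfl⟩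
    · rw [he]
      have hinf' : i + rootsIn (fiberPoly g OnePoint.infty) a = j + degAtFin φ (res K a) := by
        rw [hinf, rootMultiplicity_fiberPoly, if_pos he]
      have hfin' := hfin 0
      rw [rootMultiplicity_fiberPoly, if_neg (by rw [he]; exact OnePoint.infty_ne_coe _)] at hfin'
      filter_upwards [eventually_absSub_map hd hG a 0] with y hy
      exact hy.2 (by lia)
    · rw [he]
      obtain ⟨c, rfl⟩ := exists_residue e
      have hinf' := hinf
      rw [rootMultiplicity_fiberPoly, if_neg (by rw [he]; exact OnePoint.coe_ne_infty _)] at hinf'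
      have hfin' := hfin c
      rw [rootMultiplicity_fiberPoly, if_pos he] at hfin'
      filter_upwards [eventually_absSub_map hd hG a c] with y hy
      have : (map g y).absSub c < 1 := hy.1 (by lia)
      change map g y ∈ redDir (res K c : OnePoint (ResField K))
      rw [redDir_coe]
      exact this
  · intro y hy
    rw [hG] at hy
    obtain ⟨e, he⟩ := exists_mem_redDir hy
    obtain ⟨b, hb, hb'⟩ := hcount e
    rw [pullbackDirac_const hd (isOpen_redDir _) (closure_redDir _) (isPreconnected_redDir e)
      (by rw [hG]; exact gauss_notMem_redDir e) he hb, pullbackDirac_classical_redDir hd]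
    by_cases h : evalFin φ (res K a) = e
    · rw [if_pos h] at hb'
      rw [if_pos (by rwa [h]), Nat.cast_inj]
      lia
    · rw [if_neg h] at hb'
      rw [if_neg (fun h' => h (redDir_disjoint h' he)), Nat.cast_inj]
      lia

end Local

end P1

end Berk

/-! ### Directional and surplus degrees of arbitrary maps at the Gauss point -/

namespace Berk

open RatMap

namespace P1

variable {K : Type*} [NontriviallyNormedField K] [IsUltrametricDist K]

omit [IsUltrametricDist K] in
theorem eq_of_mem_directions {x z : P1 K} {v w : Set (P1 K)} (hv : v ∈ directions x)
    (hw : w ∈ directions x) (hzv : z ∈ v) (hzw : z ∈ w) : v = w := by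
  obtain ⟨y, -, rfl⟩ := hv
  obtain ⟨y', -, rfl⟩ := hw
  rw [connectedComponentIn_eq hzv, connectedComponentIn_eq hzw]

variable [IsAlgClosed K]

theorem preimage_mem_directions {A : RatFunc K} (hA : degree A = 1) {x : P1 K} {w : Set (P1 K)}
    (hw : w ∈ directions (map A x)) : map A ⁻¹' w ∈ directions x := by
  obtain ⟨y, hy, rfl⟩ := hw
  have h := (mapHomeo A hA).symm.image_connectedComponentIn (s := {map A x}ᶜ) (x := y) hy
  refine ⟨(mapHomeo A hA).symm y, fun h => hy ?_, ?_⟩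
  · rw [← h, ← mapHomeo_apply A hA, Homeomorph.apply_symm_apply]
  · rw [Homeomorph.image_symm, preimage_compl] at h
    have h1 : (mapHomeo A hA : P1 K → P1 K) = map A := funext (mapHomeo_apply A hA)
    have h2 : (map A ⁻¹' {map A x} : Set (P1 K)) = {x} := by
      rw [← h1]
      ext z
      simp
    rw [h1, h2] at h
    exact h

theorem HasDirDegree.of_conj {h A B : RatFunc K} (hd : 0 < degree h) (hA : degree A = 1)
    (hB : degree B = 1) (hBG : map B (gauss : P1 K) = gauss) {v : Set (P1 K)} (hv : IsOpen v)
    {m : ℕ} (H : HasDirDegree (comp A (comp h B)) (map B ⁻¹' v) m) : HasDirDegree h v m := by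
  classical
  obtain ⟨s, w, hw, hev, hcount⟩ := H
  have hA0 : 0 < degree A := by rw [hA]; exact one_pos
  have hB0 : 0 < degree B := by rw [hB]; exact one_pos
  have hmap : ∀ y : P1 K, map (comp A (comp h B)) y = map A (map h (map B y)) := fun y => by
    rw [map_comp hA0 (degree_comp_pos hd hB0), map_comp hd hB0]
  rw [hmap, hBG] at hw
  refine ⟨s, map A ⁻¹' w, preimage_mem_directions hA hw, ?_, ?_⟩
  · have htend : Tendsto (mapHomeo B hB).symm (𝓝[v] (gauss : P1 K))
        (𝓝[map B ⁻¹' v] (gauss : P1 K)) := by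
      have hsymm : (mapHomeo B hB).symm gauss = gauss := by
        rw [Homeomorph.symm_apply_eq, mapHomeo_apply, hBG]
      refine tendsto_nhdsWithin_iff.mpr ⟨?_, ?_⟩
      · have := (mapHomeo B hB).symm.continuous.tendsto (gauss : P1 K)
        rw [hsymm] at this
        exact this.mono_left nhdsWithin_le_nhds
      · filter_upwards [self_mem_nhdsWithin] with y hy
        rw [mem_preimage, ← mapHomeo_apply B hB, Homeomorph.apply_symm_apply]
        exact hy
    filter_upwards [htend.eventually hev] with y hy
    rw [hmap, ← mapHomeo_apply B hB, Homeomorph.apply_symm_apply] at hy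
    exact hy
  · intro y hy
    rw [← pullbackDirac_conj hd hA hB y hv, hcount]
    · rfl
    · rw [hmap, hBG]
      exact fun h => hy ((bijective_map hA).1 h)

/-- The direction of infinity is carried to that of 0 by z ↦ 1 / z, which fixes the Gauss point. -/
theorem hasDirDegree_redDir {g : RatFunc K} {φ : RatFunc (ResField K)} (hd : 0 < degree g)
    (hred : IsReduction g φ) (hG : map g (gauss : P1 K) = gauss) (e : OnePoint (ResField K)) :
    HasDirDegree g (redDir e) (degAt φ e) := by
  induction e using OnePoint.rec with
  | coe e =>
    obtain ⟨a, rfl⟩ := exists_residue e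
    exact hasDirDegree_redDir_coe hd hred hG a
  | infty =>
    have hX : map RatFunc.X⁻¹ (gauss : P1 K) = gauss := by
      rw [eq_gauss_iff]
      have h0 : ∀ a : K, (map RatFunc.X⁻¹ (gauss : P1 K)).absSub a =
          (gauss : P1 K).val (RatFunc.X⁻¹ - RatFunc.C a) := map_absSub degree_X_inv_pos _
      have h1 : (gauss : P1 K).val RatFunc.X⁻¹ = 1 := by
        rw [val_inv _ RatFunc.X_ne_zero, ← absSub_zero, gauss_absSub, enorm_zero]
        simp
      have h2 : (map RatFunc.X⁻¹ (gauss : P1 K)).absSub 0 = 1 := by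
        rw [h0, map_zero, sub_zero, h1]
      refine ⟨h2.le, fun a => ?_⟩
      rcases eq_or_ne a 0 with rfl | ha
      · exact h2.ge
      have ha' : (a : K) ≠ 0 := fun h => ha (Subtype.ext h)
      have h3 : (RatFunc.X⁻¹ - RatFunc.C (a : K) : RatFunc K) =
          RatFunc.X⁻¹ * (RatFunc.C (-(a : K)) * (RatFunc.X - RatFunc.C (a : K)⁻¹)) := by
        have hXne : (RatFunc.X : RatFunc K) ≠ 0 := RatFunc.X_ne_zero
        have hCne : (RatFunc.C (a : K) : RatFunc K) ≠ 0 := by simpa using ha'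
        rw [map_inv₀, map_neg]
        field_simp
        ring
      have h4 : (gauss : P1 K).val (RatFunc.X - RatFunc.C (a : K)⁻¹) = max 1 ‖(a : K)⁻¹‖ₑ :=
        gauss_absSub _
      have h5 : (gauss : P1 K).val (RatFunc.C (-(a : K)) * (RatFunc.X - RatFunc.C (a : K)⁻¹)) =
          ‖(a : K)‖ₑ * max 1 ‖(a : K)⁻¹‖ₑ := by
        rw [val_C_mul _ (neg_ne_zero.mpr ha'), h4, enorm_neg]
      rw [h0, h3, val_mul, h1, h5, one_mul, enorm_inv ha']
      · calc (1 : ℝ≥0∞) = ‖(a : K)‖ₑ * ‖(a : K)‖ₑ⁻¹ :=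
              (ENNReal.mul_inv_cancel (by simpa using ha') enorm_ne_top).symm
          _ ≤ _ := by gcongr; exact le_max_right _ _
      · rw [h1]
        exact fun h => one_ne_zero h.1
      · rw [h1]
        exact fun h => ENNReal.one_ne_top h.1
    refine HasDirDegree.of_conj (A := RatFunc.X) (B := RatFunc.X⁻¹) hd degree_X degree_X_inv hX
      (isOpen_redDir _) ?_
    have hpre : (map RatFunc.X⁻¹ ⁻¹' redDir (OnePoint.infty : OnePoint (ResField K)) : Set (P1 K)) =
        redDir (res K 0 : OnePoint (ResField K)) := by
      have hdir := preimage_mem_directions (K := K) (A := RatFunc.X⁻¹) (x := gauss)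
        (w := redDir (OnePoint.infty : OnePoint (ResField K))) degree_X_inv
        (by rw [hX, mem_directions_gauss]; exact ⟨_, rfl⟩)
      refine eq_of_mem_directions hdir (mem_directions_gauss.mpr ⟨_, rfl⟩)
        (z := classical ((0 : K) : OnePoint K)) ?_ ?_
      · rw [mem_preimage]
        change classical (OnePoint.infty : OnePoint K) ∈ _
        exact classical_mem_redDir.mpr rfl
      · rw [redDir_coe, mem_ofPred_eq, classical_coe_absSub]
        simp
    rw [hpre, comp_X]
    have hm := hasDirDegree_redDir_coe (degree_comp_pos hd degree_X_inv_pos) (IsReduction.comp_X_inv hred)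
      (by rw [map_comp hd degree_X_inv_pos, hX, hG]) (0 : IntRing K)
    rw [map_zero] at hm ⊢
    exact hm

/-- An affine A = u (z - k) suffices, provided A ∘ h = R / Q has reductions of which that of R is
not a constant multiple of that of Q. Choose j where the reduction of Q has a nonzero coefficient,
and k so that the j-th coefficient of P - k (denominator) vanishes, P being the numerator. Scaling
gives R with nonzero reduction and zero j-th coefficient. -/
theorem exists_reduction {h : RatFunc K} (hd : 0 < degree h) :
    ∃ (A : RatFunc K) (φ : RatFunc (ResField K)), degree A = 1 ∧
      map A (map h (gauss : P1 K)) = gauss ∧ IsReduction (comp A h) φ := by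
  obtain ⟨c₂, Q, hc₂, hQ, hQr⟩ := exists_integral_multiple h.denom_ne_zero
  obtain ⟨j, hj⟩ : ∃ j, (Q.map (res K)).coeff j ≠ 0 := by
    by_contra! h
    exact hQr (Polynomial.ext fun i => by rw [h i, Polynomial.coeff_zero])
  rw [Polynomial.coeff_map] at hj
  have hjK : h.denom.coeff j ≠ 0 := by
    rw [hQ, Polynomial.coeff_C_mul, Polynomial.coeff_map]
    refine mul_ne_zero hc₂ fun h0 => hj ?_
    have : Q.coeff j = 0 := Subtype.ext h0
    rw [this, map_zero]
  set k : K := h.num.coeff j / h.denom.coeff j with hk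
  obtain ⟨c₃, R, hc₃, hR, hRr⟩ := exists_integral_multiple (fiberPoly_ne_zero hd (k : OnePoint K))
  have hRj : R.coeff j = 0 := by
    have h1 := congrArg (fun p => Polynomial.coeff p j) hR
    change (h.num - Polynomial.C k * h.denom).coeff j = _ at h1
    rw [Polynomial.coeff_sub, Polynomial.coeff_C_mul, hk, div_mul_cancel₀ _ hjK, sub_self,
      Polynomial.coeff_C_mul, Polynomial.coeff_map, eq_comm, mul_eq_zero] at h1
    exact Subtype.ext (h1.resolve_left hc₃)
  have hu : c₂ / c₃ ≠ 0 := div_ne_zero hc₂ hc₃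
  set A : RatFunc K := algebraMap K[X] (RatFunc K)
    (Polynomial.C (c₂ / c₃) * (Polynomial.X - Polynomial.C k)) with hA
  have hA1 : degree A = 1 := by
    rw [degree, hA, RatFunc.num_algebraMap, RatFunc.denom_algebraMap, Polynomial.natDegree_one,
      Polynomial.natDegree_C_mul hu, Polynomial.natDegree_X_sub_C, max_eq_left zero_le_one]
  have hA0 : 0 < degree A := by rw [hA1]; exact one_pos
  have hcomp : comp A h = RatFunc.C (c₂ / c₃) * (h - RatFunc.C k) := by
    rw [hA, comp_algebraMap]
    simp
  have hg : comp A h = algebraMap K[X] (RatFunc K) (R.map (IntRing K).subtype) /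
      algebraMap K[X] (RatFunc K) (Q.map (IntRing K).subtype) := by
    rw [hcomp, eq_div_iff (RatFunc.algebraMap_ne_zero (map_subtype_ne_zero hQr))]
    have h1 := sub_C_mul_denom h k
    change _ * algebraMap K[X] (RatFunc K) h.denom = _ at h1
    rw [hR, hQ, map_mul, map_mul, RatFunc.algebraMap_C, RatFunc.algebraMap_C] at h1
    have hC3 : (RatFunc.C c₃ : RatFunc K) ≠ 0 := by simpa using hc₃
    rw [map_div₀]
    field_simp
    linear_combination h1
  refine ⟨A, _, hA1, ?_, R, Q, hQr, hg, rfl⟩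
  rw [← map_comp hA0 hd, eq_gauss_iff]
  have hcd : 0 < degree (comp A h) := degree_comp_pos hA0 hd
  have key : ∀ c : IntRing K, (map (comp A h) (gauss : P1 K)).absSub c = 1 := by
    intro c
    have hne : (R - Polynomial.C c * Q).map (res K) ≠ 0 := by
      rcases eq_or_ne (res K c) 0 with hc | hc
      · rwa [Polynomial.map_sub, Polynomial.map_mul, Polynomial.map_C, hc, Polynomial.C_0, zero_mul,
          sub_zero]
      · intro h0
        have h1 := congrArg (fun p => Polynomial.coeff p j) h0
        rw [Polynomial.map_sub, Polynomial.map_mul, Polynomial.map_C] at h1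
        simp only [Polynomial.coeff_sub, Polynomial.coeff_C_mul, Polynomial.coeff_map, hRj, map_zero,
          zero_sub, Polynomial.coeff_zero, neg_eq_zero, mul_eq_zero] at h1
        exact h1.elim hc hj
    have h1 := gauss_val_eq_one hne
    have h2 : algebraMap K[X] (RatFunc K) ((R - Polynomial.C c * Q).map (IntRing K).subtype) =
        (comp A h - RatFunc.C (c : K)) *
          algebraMap K[X] (RatFunc K) (Q.map (IntRing K).subtype) := by
      rw [Polynomial.map_sub, Polynomial.map_mul, Polynomial.map_C, map_sub, map_mul,
        RatFunc.algebraMap_C, sub_mul, hg,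
        div_mul_cancel₀ _ (RatFunc.algebraMap_ne_zero (map_subtype_ne_zero hQr))]
      rfl
    have hQ1 := gauss_val_eq_one hQr
    rw [h2, val_mul, hQ1, mul_one] at h1
    · rw [map_absSub hcd, h1]
    · rw [hQ1]
      exact fun h => ENNReal.one_ne_top h.2
    · rw [hQ1]
      exact fun h => one_ne_zero h.2
  exact ⟨(key 0).le, fun c => (key c).ge⟩

/-- The set in the definition of `dirDegree` is nonempty, so its infimum comes from some choice of
coordinates, and any choice yields the counting property. Independence of the choice need not be
shown. -/
theorem hasDirDegree_dirDegree {h : RatFunc K} (hd : 0 < degree h) {v : Set (P1 K)}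
    (hv : v ∈ directions (gauss : P1 K)) : HasDirDegree h v (dirDegree h gauss v) := by
  obtain ⟨e, rfl⟩ := mem_directions_gauss.mp hv
  have hne : {m : ℕ | ∃ A B : RatFunc K, degree A = 1 ∧ degree B = 1 ∧
      P1.map B P1.gauss = gauss ∧ P1.map A (P1.map h gauss) = P1.gauss ∧
      ∃ a : OnePoint K, P1.map B (P1.classical a) ∈ redDir e ∧
      ∃ φ : RatFunc (ResField K), IsReduction (comp A (comp h B)) φ ∧
        m = degAt φ (redPt a)}.Nonempty := by
    obtain ⟨A, φ, hA, hAG, hred⟩ := exists_reduction hd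
    obtain ⟨a, ha⟩ := redDir_nonempty (K := K) e
    exact ⟨_, A, RatFunc.X, hA, degree_X, map_X _, hAG, a, by rwa [map_X], φ,
      by rwa [comp_X_right], rfl⟩
  obtain ⟨A, B, hA, hB, hBG, hAG, a, ha, φ, hred, hm⟩ := Nat.sInf_mem hne
  change dirDegree h gauss (redDir e) = degAt φ (redPt a) at hm
  rw [hm]
  have hA0 : 0 < degree A := by rw [hA]; exact one_pos
  have hB0 : 0 < degree B := by rw [hB]; exact one_pos
  refine HasDirDegree.of_conj hd hA hB hBG (isOpen_redDir e) ?_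
  have hpre : (map B ⁻¹' redDir e : Set (P1 K)) = redDir (redPt a) :=
    eq_of_mem_directions (preimage_mem_directions hB (by rw [hBG]; exact hv))
      (mem_directions_gauss.mpr ⟨_, rfl⟩) ha (classical_mem_redDir.mpr rfl)
  rw [hpre]
  exact hasDirDegree_redDir (degree_comp_pos hA0 (degree_comp_pos hd hB0)) hred
    (by rw [map_comp hA0 (degree_comp_pos hd hB0), map_comp hd hB0, hBG, hAG]) _

theorem tangentImage_eq {h : RatFunc K} {v w : Set (P1 K)} (hv : v ∈ directions (gauss : P1 K))
    (hw : w ∈ directions (map h gauss)) (hev : ∀ᶠ y in 𝓝[v] (gauss : P1 K), map h y ∈ w) :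
    tangentImage h gauss v = w := by
  obtain ⟨e, rfl⟩ := mem_directions_gauss.mp hv
  have : (𝓝[redDir e] (gauss : P1 K)).NeBot :=
    mem_closure_iff_nhdsWithin_neBot.mp (gauss_mem_closure_redDir e)
  apply Subset.antisymm
  · apply sUnion_subset
    rintro w' ⟨hw', hev'⟩
    obtain ⟨y, hy, hy'⟩ := (hev.and hev').exists
    rw [eq_of_mem_directions hw hw' hy hy']
  · exact subset_sUnion_of_mem ⟨hw, hev⟩

theorem tangentImage_mem_directions {h : RatFunc K} (hd : 0 < degree h) {v : Set (P1 K)}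
    (hv : v ∈ directions (gauss : P1 K)) : tangentImage h gauss v ∈ directions (map h gauss) := by
  obtain ⟨s, w, hw, hev, -⟩ := hasDirDegree_dirDegree hd hv
  rwa [tangentImage_eq hv hw hev]

open Classical in
-- The defining property of the surplus degree holds because the set whose infimum it is has been
-- shown nonempty.
theorem pullbackDirac_direction {h : RatFunc K} (hd : 0 < degree h) {v : Set (P1 K)}
    (hv : v ∈ directions (gauss : P1 K)) {y : P1 K} (hy : y ≠ map h gauss) :
    pullbackDirac h y v = if y ∈ tangentImage h gauss v then
      ((dirDegree h gauss v + surplusDegree h gauss v : ℕ) : ℝ≥0∞)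
      else (surplusDegree h gauss v : ℝ≥0∞) := by
  obtain ⟨s, w, hw, hev, hcount⟩ := hasDirDegree_dirDegree hd hv
  have hne : {s : ℕ | ∀ y, y ≠ P1.map h gauss → pullbackDirac h y v =
      if y ∈ tangentImage h gauss v then ((dirDegree h gauss v + s : ℕ) : ℝ≥0∞)
      else (s : ℝ≥0∞)}.Nonempty := by
    refine ⟨s, fun y hy => ?_⟩
    rw [tangentImage_eq hv hw hev]
    exact hcount y hy
  exact Nat.sInf_mem hne y hy

end P1

end Berk

/-! ### Factor spaces: measurability and atomicity of quantized measures -/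

namespace Berk

open RatMap

section Factor

variable {K : Type*} [NontriviallyNormedField K]

theorem factorMap_of_mem {Γ : Set (P1 K)} {x : P1 K} (hx : x ∈ Γ) : (factorMap Γ x).1 = {x} :=
  congrArg Subtype.val (dif_pos hx)

theorem factorMap_of_notMem {Γ : Set (P1 K)} {x : P1 K} (hx : x ∉ Γ) :
    (factorMap Γ x).1 = connectedComponentIn Γᶜ x :=
  congrArg Subtype.val (dif_neg hx)

theorem mem_factorMap (Γ : Set (P1 K)) (x : P1 K) : x ∈ (factorMap Γ x).1 := by
  by_cases hx : x ∈ Γ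
  · rw [factorMap_of_mem hx]
    exact mem_singleton x
  · rw [factorMap_of_notMem hx]
    exact mem_connectedComponentIn hx

theorem factorMap_eq_iff {Γ : Set (P1 K)} {x : P1 K} {U : Factor Γ} :
    factorMap Γ x = U ↔ x ∈ U.1 := by
  constructor
  · rintro rfl
    exact mem_factorMap Γ x
  · intro hx
    apply Subtype.ext
    obtain ⟨y, hy, h⟩ | ⟨y, hy, h⟩ := U.2
    · rw [h] at hx ⊢
      rw [factorMap_of_notMem (connectedComponentIn_subset _ _ hx)]
      exact (connectedComponentIn_eq hx).symm
    · rw [h, mem_singleton_iff] at hx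
      rw [h, factorMap_of_mem (hx ▸ hy), hx]

theorem preimage_factorMap_singleton {Γ : Set (P1 K)} (U : Factor Γ) :
    factorMap Γ ⁻¹' {U} = U.1 := by
  ext x
  exact factorMap_eq_iff

/-- The representative picked in the definition of `factorProj` lies in the same finer cell as x,
hence in the same coarser cell. -/
theorem factorProj_factorMap {Γ Γ' : Set (P1 K)} (h : Γ ⊆ Γ') (x : P1 K) :
    factorProj Γ' Γ (factorMap Γ' x) = factorMap Γ x := by
  have hz := (factorMap Γ' x).nonempty.some_mem
  rw [factorProj]
  set z := (factorMap Γ' x).nonempty.some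
  rw [factorMap_eq_iff]
  by_cases hx : x ∈ Γ'
  · rw [factorMap_of_mem hx] at hz
    rw [mem_singleton_iff.mp hz]
    exact mem_factorMap Γ x
  · have hx' : x ∉ Γ := fun h' => hx (h h')
    rw [factorMap_of_notMem hx] at hz
    rw [factorMap_of_notMem hx']
    exact connectedComponentIn_mono _ (compl_subset_compl.mpr h) hz

instance (Γ : Set (P1 K)) : MeasurableSingletonClass (Factor Γ) := ⟨fun _ => trivial⟩

theorem measurable_factorProj (Γ' Γ : Set (P1 K)) : Measurable (factorProj Γ' Γ) :=
  measurable_from_top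

variable [IsUltrametricDist K] [IsAlgClosed K] {Γ : Set (P1 K)}

/-- By local connectedness the components are open, so arbitrary unions of them are open. This makes
the factor map measurable for the discrete σ-algebra. -/
theorem isOpen_inter_preimage_factorMap (hΓ : Γ.Finite) (A : Set (Factor Γ)) :
    IsOpen (factorMap Γ ⁻¹' A ∩ Γᶜ) := by
  rw [isOpen_iff_forall_mem_open]
  rintro x ⟨hxA, hx⟩
  refine ⟨connectedComponentIn Γᶜ x, ?_, hΓ.isClosed.isOpen_compl.connectedComponentIn,
    mem_connectedComponentIn hx⟩
  intro y hy
  have hyΓ := connectedComponentIn_subset _ _ hy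
  refine ⟨?_, hyΓ⟩
  have : factorMap Γ y = factorMap Γ x := by
    rw [factorMap_eq_iff, factorMap_of_notMem hx]
    exact hy
  rw [mem_preimage, this]
  exact hxA

theorem measurable_factorMap (hΓ : Γ.Finite) : Measurable (factorMap Γ) := by
  intro A _
  rw [← inter_union_compl (factorMap Γ ⁻¹' A) Γ]
  exact (hΓ.subset inter_subset_right).measurableSet.union
    (isOpen_inter_preimage_factorMap hΓ A).measurableSet

theorem quantize_singleton (hΓ : Γ.Finite) (ν : Measure (P1 K)) (U : Factor Γ) :
    quantize Γ ν {U} = ν U.1 := by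
  rw [quantize, Measure.map_apply (measurable_factorMap hΓ) (measurableSet_singleton U),
    preimage_factorMap_singleton]

/-- There may be uncountably many null cells. A compact subset of the union of the null components
is covered by finitely many of them, and inner regularity of ν on open sets then gives the claim;
the finitely many points of Γ are harmless. -/
theorem quantize_null_cells (hΓ : Γ.Finite) (ν : Measure (P1 K)) [ν.Regular] :
    quantize Γ ν {U | ν U.1 = 0} = 0 := by
  rw [quantize, Measure.map_apply (measurable_factorMap hΓ) trivial]
  set Z : Set (Factor Γ) := {U | ν U.1 = 0}
  rw [← inter_union_compl (factorMap Γ ⁻¹' Z) Γ]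
  refine measure_union_null ?_ ?_
  · rw [← biUnion_of_singleton (factorMap Γ ⁻¹' Z ∩ Γ),
      measure_biUnion_null_iff (hΓ.subset inter_subset_right).countable]
    rintro x ⟨hxZ, hxΓ⟩
    rw [← factorMap_of_mem hxΓ]
    exact hxZ
  · rw [(isOpen_inter_preimage_factorMap hΓ Z).measure_eq_iSup_isCompact]
    simp only [ENNReal.iSup_eq_zero]
    intro C hC hCc
    refine hCc.measure_zero_of_nhdsWithin fun x hx => ?_
    obtain ⟨hxZ, hxΓ⟩ := hC hx
    refine ⟨(factorMap Γ x).1, mem_nhdsWithin_of_mem_nhds ?_, hxZ⟩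
    rw [factorMap_of_notMem hxΓ]
    exact (hΓ.isClosed.isOpen_compl.connectedComponentIn).mem_nhds (mem_connectedComponentIn hxΓ)

/-- Only countably many disjoint cells can have positive mass, and the remaining ones are null
together. -/
theorem quantize_eq_sum (hΓ : Γ.Finite) (ν : Measure (P1 K)) [ν.Regular] [IsFiniteMeasure ν] :
    quantize Γ ν = Measure.sum fun U : Factor Γ => ν U.1 • Measure.dirac U := by
  set Z : Set (Factor Γ) := {U | ν U.1 = 0} with hZ
  have hcount : Zᶜ.Countable := by
    have := Measure.countable_meas_pos_of_disjoint_iUnion (μ := ν) (As := fun U : Factor Γ => U.1)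
      (fun U => by
        rw [← preimage_factorMap_singleton]
        exact measurable_factorMap hΓ (measurableSet_singleton U))
      (fun U V hUV => Set.disjoint_left.mpr fun x hx hx' => hUV
        ((factorMap_eq_iff.mpr hx).symm.trans (factorMap_eq_iff.mpr hx')))
    refine this.mono fun U hU => ?_
    exact pos_iff_ne_zero.mpr hU
  classical
  ext A hA
  have h1 : quantize Γ ν A = quantize Γ ν (A ∩ Zᶜ) := by
    refine (measure_inter_conull ?_).symm
    exact measure_mono_null (fun U hU => not_not.mp hU) (quantize_null_cells hΓ ν)
  rw [h1, ← biUnion_of_singleton (A ∩ Zᶜ), measure_biUnion (hcount.mono inter_subset_right)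
    (fun U _ V _ hUV => by simpa using hUV) (fun U _ => measurableSet_singleton U),
    tsum_subtype (A ∩ Zᶜ) (fun U => quantize Γ ν {U}), Measure.sum_apply _ hA]
  refine tsum_congr fun U => ?_
  rw [Measure.smul_apply, Measure.dirac_apply' _ hA, smul_eq_mul, indicator_apply, indicator_apply,
    quantize_singleton hΓ]
  by_cases hU : U ∈ A
  · by_cases hUZ : ν U.1 = 0
    · simp [hUZ]
    · simp [hU, hZ, hUZ]
  · simp [hU]

end Factor

/-! ### Atoms, iterated pullback and the balance equation -/

section Balanced

variable {K : Type*} [NontriviallyNormedField K] [IsUltrametricDist K] [IsAlgClosed K]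

open P1

theorem pullbackDirac_eq_sum_dirac {h : RatFunc K} (hd : 0 < degree h) {y : P1 K} {ι : Type*}
    [Fintype ι] {M : ι → P1 K} (hM : IsFiber h y M) :
    pullbackDirac h y = ∑ i, Measure.dirac (M i) := by
  classical
  ext s hs
  rw [pullbackDirac_apply hd hM hs, Measure.finsetSum_apply]
  simp_rw [Measure.dirac_apply' _ hs, indicator_apply, Pi.one_apply]
  rw [Finset.sum_boole, countIn]

variable {f : RatFunc K} {ν : Measure (P1 K)} [IsProbabilityMeasure ν]

omit [IsAlgClosed K] in
-- If this failed, `Measure.bind` would take its default value 0, contradicting the total mass d of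
-- the pullback.
theorem aemeasurable_pullbackDirac (hd : 0 < degree f)
    (hbal : pullback f ν = (degree f : ℝ≥0∞) • ν) : AEMeasurable (pullbackDirac f) ν := by
  by_contra h
  rw [pullback, Measure.bind, Measure.map_of_not_aemeasurable h, Measure.join_zero] at hbal
  have := congrArg (fun μ : Measure (P1 K) => μ univ) hbal
  simp only [Measure.coe_zero, Pi.zero_apply, Measure.smul_apply, measure_univ, smul_eq_mul,
    mul_one] at this
  exact hd.ne (by exact_mod_cast this)

omit [IsAlgClosed K] in
theorem lintegral_pullbackDirac (hd : 0 < degree f)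
    (hbal : pullback f ν = (degree f : ℝ≥0∞) • ν) {s : Set (P1 K)} (hs : MeasurableSet s) :
    ∫⁻ y, pullbackDirac f y s ∂ν = degree f * ν s := by
  rw [← Measure.bind_apply hs (aemeasurable_pullbackDirac hd hbal)]
  change pullback f ν s = _
  rw [hbal]
  rfl

/-- The mass of f^*δ_y at x is the local degree at x when y = f(x), and 0 otherwise. -/
theorem degree_mul_measure_singleton (hd : 0 < degree f)
    (hbal : pullback f ν = (degree f : ℝ≥0∞) • ν) (x : P1 K) :
    degree f * ν {x} = localDegree f x * ν {map f x} := by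
  classical
  rw [← lintegral_pullbackDirac hd hbal (measurableSet_singleton x),
    ← lintegral_indicator_const (measurableSet_singleton _)]
  congr 1
  ext y
  obtain ⟨M, hM⟩ := exists_isFiber hd y
  rw [pullbackDirac_apply hd hM (measurableSet_singleton x), indicator_apply]
  split_ifs with hy
  · obtain rfl : y = map f x := hy
    rw [localDegree_eq hd hM]
  · rw [countIn, Nat.cast_eq_zero, Finset.card_eq_zero, Finset.filter_eq_empty_iff]
    rintro i - hi
    exact hy (by rw [mem_singleton_iff, ← hM.map_eq i, mem_singleton_iff.mp hi])

theorem measure_singleton_map (hd : 0 < degree f)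
    (hbal : pullback f ν = (degree f : ℝ≥0∞) • ν) (x : P1 K) : ν {map f x} = 0 ↔ ν {x} = 0 := by
  have h := degree_mul_measure_singleton hd hbal x
  have h1 : (degree f : ℝ≥0∞) ≠ 0 := by exact_mod_cast hd.ne'
  have h2 : (localDegree f x : ℝ≥0∞) ≠ 0 := by exact_mod_cast (localDegree_pos hd x).ne'
  constructor
  · intro h0
    rw [h0, mul_zero] at h
    exact (mul_eq_zero.mp h).resolve_left h1
  · intro h0
    rw [h0, mul_zero] at h
    exact (mul_eq_zero.mp h.symm).resolve_left h2

omit [IsUltrametricDist K] [IsAlgClosed K] in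
theorem iter_succ (f : RatFunc K) (n : ℕ) : iter f (n + 1) = comp f (iter f n) :=
  Function.iterate_succ_apply' _ _ _

theorem degree_iter (hd : 0 < degree f) (n : ℕ) : degree (iter f n) = degree f ^ n := by
  induction n with
  | zero => exact degree_X
  | succ n ih => rw [iter_succ, P1.degree_comp hd (by rw [ih]; positivity), ih, pow_succ']

theorem degree_iter_pos (hd : 0 < degree f) (n : ℕ) : 0 < degree (iter f n) := by
  rw [degree_iter hd]
  positivity

theorem measure_singleton_map_iter (hd : 0 < degree f)
    (hbal : pullback f ν = (degree f : ℝ≥0∞) • ν) (x : P1 K) (n : ℕ) :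
    ν {map (iter f n) x} = 0 ↔ ν {x} = 0 := by
  induction n with
  | zero =>
    change ν {map RatFunc.X x} = 0 ↔ _
    rw [map_X]
  | succ n ih =>
    rw [iter_succ, map_comp hd (degree_iter_pos hd n), measure_singleton_map hd hbal, ih]

theorem tangentImage_isOpen {h : RatFunc K} (hd : 0 < degree h) {v : Set (P1 K)}
    (hv : v ∈ directions (gauss : P1 K)) : IsOpen (tangentImage h gauss v) := by
  obtain ⟨y, -, hy⟩ := tangentImage_mem_directions hd hv
  rw [hy]
  exact isOpen_compl_singleton.connectedComponentIn

omit [IsProbabilityMeasure ν] in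
theorem aemeasurable_pullbackDirac_direction {h : RatFunc K} (hd : 0 < degree h) {v : Set (P1 K)}
    (hv : v ∈ directions (gauss : P1 K)) (hatom : ν {map h gauss} = 0) :
    AEMeasurable (fun y => pullbackDirac h y v) ν := by
  classical
  refine ⟨fun y => if y ∈ tangentImage h gauss v then
      ((dirDegree h gauss v + surplusDegree h gauss v : ℕ) : ℝ≥0∞)
      else (surplusDegree h gauss v : ℝ≥0∞),
    Measurable.ite (tangentImage_isOpen hd hv).measurableSet measurable_const measurable_const, ?_⟩
  filter_upwards [compl_mem_ae_iff.mpr hatom] with y hy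
  rw [pullbackDirac_direction hd hv hy]

/-- Induction on n through (f ∘ g)^*δ_y = ∫ g^*δ_z d(f^*δ_y)(z) with g = f^n: integrating over ν
turns the outer measure into f^*ν = dν. The absence of an atom at g(G) provides the measurability
needed to exchange the integrals. -/
theorem lintegral_pullbackDirac_iter (hd : 0 < degree f)
    (hbal : pullback f ν = (degree f : ℝ≥0∞) • ν) (hatom : ν {(gauss : P1 K)} = 0) {n : ℕ}
    (hn : 1 ≤ n) {v : Set (P1 K)} (hv : v ∈ directions (gauss : P1 K)) :
    ∫⁻ y, pullbackDirac (iter f n) y v ∂ν = degree (iter f n) * ν v := by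
  have hvm : MeasurableSet v := by
    obtain ⟨e, rfl⟩ := mem_directions_gauss.mp hv
    exact (isOpen_redDir e).measurableSet
  induction n, hn using Nat.le_induction with
  | base =>
    have : iter f 1 = f := comp_X_right f
    rw [this, lintegral_pullbackDirac hd hbal hvm]
  | succ n hn ih =>
    have hg := degree_iter_pos hd n
    have hmeas : AEMeasurable (fun y => pullbackDirac (iter f n) y v) (pullback f ν) := by
      rw [hbal]
      exact (aemeasurable_pullbackDirac_direction hg hv
        ((measure_singleton_map_iter hd hbal gauss n).mpr hatom)).smul_measure _
    have h1 : ∀ y, pullbackDirac (comp f (iter f n)) y v =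
        ∫⁻ z, pullbackDirac (iter f n) z v ∂(pullbackDirac f y) := by
      intro y
      obtain ⟨M, hM⟩ := exists_isFiber hd y
      rw [pullbackDirac_comp hd hg hM hvm, pullbackDirac_eq_sum_dirac hd hM,
        lintegral_finsetSum_measure]
      simp_rw [lintegral_dirac]
    rw [iter_succ]
    simp_rw [h1]
    rw [← Measure.lintegral_bind (aemeasurable_pullbackDirac hd hbal) hmeas]
    change ∫⁻ z, pullbackDirac (iter f n) z v ∂(pullback f ν) = _
    rw [hbal, lintegral_smul_measure, ih, P1.degree_comp hd hg, Nat.cast_mul, mul_assoc]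
    rfl

omit [IsAlgClosed K] in
theorem finite_vertexSet (h : RatFunc K) : (vertexSet h).Finite := by
  rw [vertexSet]
  exact toFinite _

omit [IsAlgClosed K] in
variable (K) in
theorem finite_gaussSet : (gaussSet K).Finite := finite_singleton _

/-- Cells of Γ_h refine the components of the complement of h(G), so for x ≠ h(G) the cell of x lies
in the tangent image as soon as x does. -/
theorem pullbackDirac_eq_quantDegree {h : RatFunc K} (hd : 0 < degree h) (U : Factor (gaussSet K))
    (hU : U.1 ≠ {gauss}) {x : P1 K} (hx : x ≠ map h gauss) :
    U.1 ∈ directions (gauss : P1 K) ∧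
      pullbackDirac h x U.1 = quantDegree h (factorMap (vertexSet h) x) U := by
  classical
  have hdir : U.1 ∈ directions (gauss : P1 K) := by
    obtain ⟨y, hy, h⟩ | ⟨y, hy, h⟩ := U.2
    · exact ⟨y, hy, h⟩
    · exact absurd (h.trans (by rw [mem_singleton_iff.mp hy])) hU
  refine ⟨hdir, ?_⟩
  have hiff : x ∈ tangentImage h gauss U.1 ↔
      (factorMap (vertexSet h) x).1 ⊆ tangentImage h gauss U.1 := by
    refine ⟨fun hxT => ?_, fun H => H (mem_factorMap _ x)⟩
    by_cases hxΓ : x ∈ vertexSet h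
    · rw [factorMap_of_mem hxΓ]
      exact singleton_subset_iff.mpr hxT
    · rw [factorMap_of_notMem hxΓ]
      obtain ⟨y, -, hy⟩ := tangentImage_mem_directions hd hdir
      rw [hy] at hxT ⊢
      rw [connectedComponentIn_eq hxT]
      refine connectedComponentIn_mono _ (compl_subset_compl.mpr ?_)
      rw [singleton_subset_iff, vertexSet]
      exact Or.inr rfl
  rw [pullbackDirac_direction hd hdir hx, quantDegree, if_neg hU]
  by_cases hxT : x ∈ tangentImage h gauss U.1
  · rw [if_pos hxT, if_pos (hiff.mp hxT)]
  · rw [if_neg hxT, if_neg (fun H => hxT (hiff.mpr H))]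

theorem tsum_quantDegree [ν.Regular] {h : RatFunc K} (hd : 0 < degree h)
    (hG : ν {(gauss : P1 K)} = 0) (hhG : ν {map h gauss} = 0)
    (hint : ∀ v ∈ directions (gauss : P1 K), ∫⁻ y, pullbackDirac h y v ∂ν = degree h * ν v)
    (U : Factor (gaussSet K)) :
    ∑' V, (quantDegree h V U : ℝ≥0∞) * quantize (vertexSet h) ν {V} = degree h * ν U.1 := by
  have hΓ := finite_vertexSet h
  by_cases hU : U.1 = {gauss}
  · rw [hU, hG, mul_zero, ENNReal.tsum_eq_zero]
    intro V
    rw [quantize_singleton hΓ, quantDegree, if_pos hU]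
    split_ifs with hV
    · rw [hV, hhG, mul_zero]
    · rw [Nat.cast_zero, zero_mul]
  · have h1 : ∑' V, (quantDegree h V U : ℝ≥0∞) * quantize (vertexSet h) ν {V} =
        ∫⁻ V, (quantDegree h V U : ℝ≥0∞) ∂(quantize (vertexSet h) ν) := by
      conv_rhs => rw [quantize_eq_sum hΓ]
      rw [lintegral_sum_measure]
      refine tsum_congr fun V => ?_
      rw [lintegral_smul_measure, lintegral_dirac, quantize_singleton hΓ, smul_eq_mul, mul_comm]
    have hae : ∀ᵐ x ∂ν, x ≠ map h gauss := compl_mem_ae_iff.mpr hhG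
    -- This point serves only to extract that U is a direction.
    obtain ⟨x, hx⟩ := hae.exists
    rw [h1, quantize, lintegral_map measurable_from_top (measurable_factorMap hΓ),
      ← hint _ (pullbackDirac_eq_quantDegree hd U hU hx).1]
    refine lintegral_congr_ae ?_
    filter_upwards [hae] with y hy
    rw [(pullbackDirac_eq_quantDegree hd U hU hy).2]

theorem quantBalanced_quantize [ν.Regular] {h : RatFunc K} (hd : 0 < degree h)
    (hG : ν {(gauss : P1 K)} = 0) (hhG : ν {map h gauss} = 0)
    (hint : ∀ v ∈ directions (gauss : P1 K), ∫⁻ y, pullbackDirac h y v ∂ν = degree h * ν v) :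
    QuantBalanced h (quantize (vertexSet h) ν) := by
  have hsub : gaussSet K ⊆ vertexSet h := by
    rw [gaussSet, singleton_subset_iff, vertexSet]
    exact Or.inl rfl
  have hproj : (quantize (vertexSet h) ν).map (factorProj (vertexSet h) (gaussSet K)) =
      quantize (gaussSet K) ν := by
    rw [quantize, Measure.map_map (measurable_factorProj _ _)
      (measurable_factorMap (finite_vertexSet h)), quantize]
    congr 1
    ext1 x
    exact factorProj_factorMap hsub x
  rw [QuantBalanced, hproj, quantize_eq_sum (finite_gaussSet K), quantPullback]
  simp_rw [tsum_quantDegree hd hG hhG hint]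
  ext A hA
  rw [Measure.smul_apply, Measure.sum_apply _ hA, Measure.sum_apply _ hA, smul_eq_mul,
    ← ENNReal.tsum_mul_left]
  refine tsum_congr fun U => ?_
  rw [Measure.smul_apply, Measure.smul_apply, smul_eq_mul, smul_eq_mul, ← mul_assoc, ← mul_assoc,
    ENNReal.inv_mul_cancel (by exact_mod_cast hd.ne') (ENNReal.natCast_ne_top _), one_mul]

end Balanced

end Berk

end

theorem mainTheorem6 {K : Type*} [NontriviallyNormedField K] [IsUltrametricDist K]
    [CompleteSpace K] [IsAlgClosed K]
    (f : RatFunc K) (hf : 1 < RatMap.degree f)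
    (ν : Measure (Berk.P1 K)) [IsProbabilityMeasure ν] [ν.Regular]
    (hbal : Berk.pullback f ν = (RatMap.degree f : ℝ≥0∞) • ν)
    (hatom : ν {Berk.P1.map f Berk.P1.gauss} = 0)
    (n : ℕ) (hn : 1 ≤ n) :
    IsProbabilityMeasure (Berk.quantize (Berk.vertexSet (RatMap.iter f n)) ν) ∧
      Berk.QuantBalanced (RatMap.iter f n)
        (Berk.quantize (Berk.vertexSet (RatMap.iter f n)) ν) := by
  have hd : 0 < RatMap.degree f := zero_lt_one.trans hf
  have hG : ν {Berk.P1.gauss} = 0 := (Berk.measure_singleton_map hd hbal _).mp hatom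
  refine ⟨Measure.isProbabilityMeasure_map
    (Berk.measurable_factorMap (Berk.finite_vertexSet _)).aemeasurable, ?_⟩
  exact Berk.quantBalanced_quantize (Berk.degree_iter_pos hd n) hG
    ((Berk.measure_singleton_map_iter hd hbal _ n).mpr hG)
    fun v hv => Berk.lintegral_pullbackDirac_iter hd hbal hG hn hv
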